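/- Let $n\ge 2$ be an integer, let $R\subseteq(0,\infty)$ and $Q\subseteq\mathbb R$ be nonempty open intervals, and let $p=p(\rho,S)$ be a non-constant real-analytic function on $R\times Q$ (the equation of state). Consider classical ($C^2$) solutions $U(t,r),\rho(t,r),S(t,r)$, on open regions in $\{r>0\}$ and with $(\rho,S)\in R\times Q$, of the radial Euler equations $$U_t+UU_r+\frac{p_SS_r+p_\rho\rho_r}{\rho}=0,\qquad \rho_t+(U\rho)_r+\frac{n-1}{r}U\rho=0,\qquad S_t+US_r=0 .$$ A transported radial domain is an interval $V(t)=[a(t),b(t)]$, $a<b$, inside the region of the solution, with $a'(t)=U(t,a(t))$ and $b'(t)=U(t,b(t))$. Let $X$ be the set of all $(t,r,U,\rho,S,U_r,\rho_r,S_r)\in\mathbb R^8$ with $r>0$, $\rho\in R$, $S\in Q$. A $C^1$ function $J$ on an open set $\Omega\subseteq X$ is said to define an integral invariant on $\Omega$ if $$\frac{d}{dt}\int_{V(t)}\rho\,J(t,r,U,\rho,S,U_r,\rho_r,S_r)\,r^{n-1}\,dr=0$$ for all solutions and all transported radial domains $V(t)$ on which $(t,r,U,\rho,S,U_r,\rho_r,S_r)$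 stays in $\Omega$. Call $p$ entropic if $p=\kappa(S)$ for some function $\kappa$. Write $p_r=p_SS_r+p_\rho\rho_r$. Below, $f$ denotes $C^1$ functions. (i) For every equation of state, $J=f(S,\,r^{1-n}S_r/\rho)$ defines an integral invariant. If $p$ is not entropic, there are no others: a $C^1$ function $J$ on an open set $\Omega\subseteq X$ defines an integral invariant on $\Omega$ if and only if every point of $\Omega$ has a neighbourhood on which $J=f(S,\,r^{1-n}S_r/\rho)$ for some $f$; and if $\Omega=X$, this holds with a single $f$ on all of $X$. (ii) Integral invariants on open sets $\Omega\subseteq X$ which are not locally of the form in (i) exist if and only if $p$ is entropic. Let $p=\kappa(S)$ be entropic, let $\varepsilon\in\{1,-1\}$, and let $X_\varepsilon\subseteq X$ be the set where $\varepsilon U>0$ and $U^2+\tfrac2n\,r\,p_r/\rho>0$. A $C^1$ function $J$ on an open set $\Omega\subseteq X_\varepsilon$ defines an integral invariant on $\Omega$ if and only if every point of $\Omega$ has a neighbourhood on which $$J=f\Big(S,\ r^{1-n}S_r/\rho,\ U^2+\tfrac2n\,r\,p_r/\rho,\ \varepsilon A(r,U,p_r/\rho)-t\Big),\qquad A(r,U,q)=\int_0^1\frac{r\,dy}{\sqrt{U^2+\tfrac2n(1-y^n)\,r\,q}},$$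 for some $f$; and if $\Omega=X_\varepsilon$, this holds with a single $f$ on all of $X_\varepsilon$. -/

import Mathlib

open Set Topology

namespace RadialEuler

/-- Points of the first-order jet space, with coordinates
`(t, r, U, ρ, S, U_r, ρ_r, S_r)`. -/
abbrev Jet : Type := Fin 8 → ℝ

namespace Jet

/-- time -/
abbrev t (x : Jet) : ℝ := x 0
/-- radius -/
abbrev r (x : Jet) : ℝ := x 1
/-- radial velocity -/
abbrev U (x : Jet) : ℝ := x 2
/-- density -/
abbrev ρ (x : Jet) : ℝ := x 3
/-- entropy -/
abbrev S (x : Jet) : ℝ := x 4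
/-- radial derivative of the velocity -/
abbrev Ur (x : Jet) : ℝ := x 5
/-- radial derivative of the density -/
abbrev ρr (x : Jet) : ℝ := x 6
/-- radial derivative of the entropy -/
abbrev Sr (x : Jet) : ℝ := x 7

end Jet

/-- `∂p/∂ρ` for `p = p(ρ, S)`. -/
noncomputable def pRho (p : ℝ → ℝ → ℝ) (ρ S : ℝ) : ℝ := deriv (fun q => p q S) ρ

/-- `∂p/∂S` for `p = p(ρ, S)`. -/
noncomputable def pS (p : ℝ → ℝ → ℝ) (ρ S : ℝ) : ℝ := deriv (fun s => p ρ s) S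

/-- A (non-constant, real-analytic) equation of state `p = p(ρ, S)`, for densities in an open
interval `R ⊆ (0, ∞)` and entropies in an open interval `Q`. -/
structure IsEquationOfState (R Q : Set ℝ) (p : ℝ → ℝ → ℝ) : Prop where
  isOpen_density : IsOpen R
  isPreconnected_density : IsPreconnected R
  nonempty_density : R.Nonempty
  density_pos : ∀ ρ ∈ R, 0 < ρ
  isOpen_entropy : IsOpen Q
  isPreconnected_entropy : IsPreconnected Q
  nonempty_entropy : Q.Nonempty
  analytic : AnalyticOnNhd ℝ (fun z : ℝ × ℝ => p z.1 z.2) (R ×ˢ Q)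
  nonconstant : ¬ ∃ c : ℝ, ∀ ρ ∈ R, ∀ S ∈ Q, p ρ S = c

/-- The entropic case `p = κ(S)`. -/
def IsEntropic (R Q : Set ℝ) (p : ℝ → ℝ → ℝ) : Prop :=
  ∃ κ : ℝ → ℝ, ∀ ρ ∈ R, ∀ S ∈ Q, p ρ S = κ S

/-- `(U, ρ, S)`, as functions of `(t, r)`, form a classical (`C²`) solution of the radial Euler
equations in dimension `n` on the open space-time region `G ⊆ {r > 0}`. -/
structure IsRadialFlow (n : ℕ) (R Q : Set ℝ) (p : ℝ → ℝ → ℝ) (G : Set (ℝ × ℝ))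
    (U ρ S : ℝ → ℝ → ℝ) : Prop where
  isOpen : IsOpen G
  radius_pos : ∀ z ∈ G, 0 < z.2
  contDiffOn_velocity : ContDiffOn ℝ 2 (fun z : ℝ × ℝ => U z.1 z.2) G
  contDiffOn_density : ContDiffOn ℝ 2 (fun z : ℝ × ℝ => ρ z.1 z.2) G
  contDiffOn_entropy : ContDiffOn ℝ 2 (fun z : ℝ × ℝ => S z.1 z.2) G
  density_mem : ∀ t r, (t, r) ∈ G → ρ t r ∈ R
  entropy_mem : ∀ t r, (t, r) ∈ G → S t r ∈ Q
  velocity_eqn : ∀ t r, (t, r) ∈ G →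
    deriv (fun τ => U τ r) t + U t r * deriv (fun y => U t y) r
      + (pS p (ρ t r) (S t r) * deriv (fun y => S t y) r
          + pRho p (ρ t r) (S t r) * deriv (fun y => ρ t y) r) / ρ t r = 0
  density_eqn : ∀ t r, (t, r) ∈ G →
    deriv (fun τ => ρ τ r) t + deriv (fun y => U t y * ρ t y) r
      + ((n : ℝ) - 1) / r * (U t r * ρ t r) = 0
  entropy_eqn : ∀ t r, (t, r) ∈ G →
    deriv (fun τ => S τ r) t + U t r * deriv (fun y => S t y) r = 0

/-- The first-order jet at `(t, r)` of the fields `(U, ρ, S)`. -/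
noncomputable def jetAt (U ρ S : ℝ → ℝ → ℝ) (t r : ℝ) : Jet :=
  ![t, r, U t r, ρ t r, S t r,
    deriv (fun y => U t y) r, deriv (fun y => ρ t y) r, deriv (fun y => S t y) r]

/-- `V(t) = [a(t), b(t)]`, `t₁ < t < t₂`, is a radial domain transported by the flow with velocity
`U`, contained in the region `G`. -/
def IsTransportedDomain (G : Set (ℝ × ℝ)) (U : ℝ → ℝ → ℝ) (t₁ t₂ : ℝ) (a b : ℝ → ℝ) : Prop :=
  ∀ t ∈ Ioo t₁ t₂, a t < b t ∧ HasDerivAt a (U t (a t)) t ∧ HasDerivAt b (U t (b t)) t ∧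
    ∀ r ∈ Icc (a t) (b t), (t, r) ∈ G

/-- `∫_{V(t)} ρ J r^{n-1} dr` with `J = J(t, r, U, ρ, S, U_r, ρ_r, S_r)` defined on `Ω` is an
integral invariant: for every radial flow and every transported radial domain `V(t)` on which the
first-order jet of the flow stays in `Ω`, the time derivative of the integral exists and is `0`. -/
def IsIntegralInvariant (n : ℕ) (R Q : Set ℝ) (p : ℝ → ℝ → ℝ) (Ω : Set Jet) (J : Jet → ℝ) :
    Prop :=
  ∀ (G : Set (ℝ × ℝ)) (U ρ S : ℝ → ℝ → ℝ), IsRadialFlow n R Q p G U ρ S →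
    ∀ (t₁ t₂ : ℝ) (a b : ℝ → ℝ), IsTransportedDomain G U t₁ t₂ a b →
      (∀ t ∈ Ioo t₁ t₂, ∀ r ∈ Icc (a t) (b t), jetAt U ρ S t r ∈ Ω) →
        ∀ t ∈ Ioo t₁ t₂,
          HasDerivAt (fun τ => ∫ r in (a τ)..(b τ), ρ τ r * J (jetAt U ρ S τ r) * r ^ (n - 1)) 0 t

/-- `J = f(I₁, …, I_k)` on `Ω` for some (continuously differentiable) function `f`. -/
def IsFunctionOf {k : ℕ} (I : Jet → (Fin k → ℝ)) (J : Jet → ℝ) (Ω : Set Jet) : Prop :=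
  ∃ f : (Fin k → ℝ) → ℝ, ContDiffOn ℝ 1 f (I '' Ω) ∧ ∀ x ∈ Ω, J x = f (I x)

/-- `J` is a function of `I₁, …, I_k` in a neighbourhood of every point of `Ω`. -/
def IsLocallyFunctionOf {k : ℕ} (I : Jet → (Fin k → ℝ)) (J : Jet → ℝ) (Ω : Set Jet) : Prop :=
  ∀ x ∈ Ω, ∃ N : Set Jet, IsOpen N ∧ x ∈ N ∧ N ⊆ Ω ∧ IsFunctionOf I J N

/-- All first-order jets with `r > 0` and `(ρ, S)` in the domain of the equation of state. -/
def jetDomain (R Q : Set ℝ) : Set Jet := {x | 0 < x.r ∧ x.ρ ∈ R ∧ x.S ∈ Q}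

/-- `p_r / ρ`, as a function on the jet space. -/
noncomputable def pressureForce (p : ℝ → ℝ → ℝ) (x : Jet) : ℝ :=
  (pS p x.ρ x.S * x.Sr + pRho p x.ρ x.S * x.ρr) / x.ρ

/-- `r^{1-n} S_r / ρ` -/
noncomputable def entropyGradient (n : ℕ) (x : Jet) : ℝ := x.r ^ (1 - (n : ℤ)) * x.Sr / x.ρ

/-- `U² + (2/n) r p_r / ρ` -/
noncomputable def energyInvariant (n : ℕ) (p : ℝ → ℝ → ℝ) (x : Jet) : ℝ :=
  x.U ^ 2 + 2 / (n : ℝ) * x.r * pressureForce p x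

/-- `A(r, U, q) = ∫_0^1 r dy / √(U² + (2/n) (1 - y^n) r q)` -/
noncomputable def travelTime (n : ℕ) (r U q : ℝ) : ℝ :=
  ∫ y in (0 : ℝ)..1, r / √(U ^ 2 + 2 / (n : ℝ) * (1 - y ^ n) * r * q)

/-- The invariants `S`, `r^{1-n} S_r / ρ` of a general equation of state. -/
noncomputable def generalInvariants (n : ℕ) (x : Jet) : Fin 2 → ℝ :=
  ![x.S, entropyGradient n x]

/-- The part of the jet space with outward (`ε = 1`) respectively inward (`ε = -1`) velocity on
which the integrand of `A(r, U, p_r / ρ)` is regular on the whole of `[0, 1]`. -/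
def travelDomain (n : ℕ) (R Q : Set ℝ) (p : ℝ → ℝ → ℝ) (ε : ℝ) : Set Jet :=
  {x | x ∈ jetDomain R Q ∧ 0 < ε * x.U ∧ 0 < energyInvariant n p x}

/-- The invariants `S`, `r^{1-n} S_r / ρ`, `U² + (2/n) r p_r / ρ`, `ε A(r, U, p_r / ρ) - t` of an
entropic equation of state, where `ε` is the sign of `U`. -/
noncomputable def entropicInvariants (n : ℕ) (p : ℝ → ℝ → ℝ) (ε : ℝ) (x : Jet) : Fin 4 → ℝ :=
  ![x.S, entropyGradient n x, energyInvariant n p x,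
    ε * travelTime n x.r x.U (pressureForce p x) - x.t]

end RadialEuler

namespace RadialEuler

/-! ### A Banach algebra of power series in two variables -/

/-- The Banach space `ℓ¹(ℕ × ℕ)`; its elements are read as power series in two variables `τ, y`,
the unit vector with index `(j, k)` being `binom(j + k, j) τ^j y^k`. -/
def PSeries : Type := lp (fun _ : ℕ × ℕ => ℝ) 1

namespace PSeries

noncomputable instance : NormedAddCommGroup PSeries :=
  inferInstanceAs (NormedAddCommGroup (lp (fun _ : ℕ × ℕ => ℝ) 1))
noncomputable instance : NormedSpace ℝ PSeries :=
  inferInstanceAs (NormedSpace ℝ (lp (fun _ : ℕ × ℕ => ℝ) 1))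
instance : CompleteSpace PSeries :=
  inferInstanceAs (CompleteSpace (lp (fun _ : ℕ × ℕ => ℝ) 1))

/-- The coefficient of `a` at the unit vector with index `p`. -/
def coef (a : PSeries) (p : ℕ × ℕ) : ℝ := (show lp (fun _ : ℕ × ℕ => ℝ) 1 from a).1 p

/-- The unit vectors. -/
noncomputable def e (p : ℕ × ℕ) : PSeries := lp.single (E := fun _ : ℕ × ℕ => ℝ) 1 p 1

theorem coef_add (a b : PSeries) (p : ℕ × ℕ) : (a + b).coef p = a.coef p + b.coef p := rfl

theorem coef_smul (c : ℝ) (a : PSeries) (p : ℕ × ℕ) : (c • a).coef p = c * a.coef p := rfl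

theorem norm_e (p : ℕ × ℕ) : ‖e p‖ = 1 := by
  have := lp.norm_single (E := fun _ : ℕ × ℕ => ℝ) (p := 1) one_pos p (1 : ℝ)
  rw [norm_one] at this
  exact this

theorem hasSum_coef_smul_e (a : PSeries) : HasSum (fun p => a.coef p • e p) a := by
  have h := lp.hasSum_single (E := fun _ : ℕ × ℕ => ℝ) (p := 1) ENNReal.one_ne_top a
  have h2 : ∀ p, lp.single (E := fun _ : ℕ × ℕ => ℝ) 1 p (a.coef p) = a.coef p • e p := by
    intro p
    have := lp.single_smul (E := fun _ : ℕ × ℕ => ℝ) 1 p (a.coef p) (1 : ℝ)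
    rw [smul_eq_mul, mul_one] at this
    exact this
  exact (funext h2 : (fun p => lp.single (E := fun _ : ℕ × ℕ => ℝ) 1 p (a.coef p)) = _) ▸ h

theorem hasSum_norm_coef (a : PSeries) : HasSum (fun p => ‖a.coef p‖) ‖a‖ := by
  have h := lp.hasSum_norm (E := fun _ : ℕ × ℕ => ℝ) (p := 1) (by norm_num) a
  simp only [ENNReal.toReal_one, Real.rpow_one] at h
  exact h

variable {F : Type*} [NormedAddCommGroup F] [NormedSpace ℝ F]

/-- The unit vectors span a dense subspace, so the linear and multilinear identities below only have
to be checked on them. -/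
theorem clm_ext {f g : PSeries →L[ℝ] F} (h : ∀ p, f (e p) = g (e p)) : f = g := by
  ext a
  have h1 := (f.hasSum (hasSum_coef_smul_e a))
  have h2 := (g.hasSum (hasSum_coef_smul_e a))
  refine h1.unique ?_
  convert h2 using 2 with p
  simp [h]

theorem bilin_ext {f g : PSeries →L[ℝ] PSeries →L[ℝ] F} (h : ∀ p q, f (e p) (e q) = g (e p) (e q)) :
    f = g :=
  clm_ext fun p => clm_ext fun q => h p q

theorem summable_norm_coef_smul (a : PSeries) (φ : ℕ × ℕ → F) (hφ : ∀ p, ‖φ p‖ ≤ 1) :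
    Summable (fun p => ‖a.coef p • φ p‖) := by
  refine Summable.of_nonneg_of_le (fun _ => norm_nonneg _) (fun p => ?_) a.hasSum_norm_coef.summable
  rw [norm_smul]
  exact mul_le_of_le_one_right (norm_nonneg _) (hφ p)

variable [CompleteSpace F]

/-- The continuous linear extension of a map into the unit ball, defined on the unit vectors. -/
noncomputable def lift (φ : ℕ × ℕ → F) (hφ : ∀ p, ‖φ p‖ ≤ 1) : PSeries →L[ℝ] F :=
  LinearMap.mkContinuous
    { toFun := fun a => ∑' p, a.coef p • φ p
      map_add' := fun a b => by
        simp only [coef_add, add_smul]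
        exact ((summable_norm_coef_smul a φ hφ).of_norm).tsum_add
          ((summable_norm_coef_smul b φ hφ).of_norm)
      map_smul' := fun c a => by
        simp only [coef_smul, mul_smul, RingHom.id_apply]
        exact ((summable_norm_coef_smul a φ hφ).of_norm).tsum_const_smul c } 1 (fun a => by
      refine (norm_tsum_le_tsum_norm (summable_norm_coef_smul a φ hφ)).trans ?_
      rw [one_mul, ← a.hasSum_norm_coef.tsum_eq]
      refine (summable_norm_coef_smul a φ hφ).tsum_le_tsum (fun p => ?_)
        a.hasSum_norm_coef.summable
      rw [norm_smul]
      exact mul_le_of_le_one_right (norm_nonneg _) (hφ p))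

theorem norm_lift_le (φ : ℕ × ℕ → F) (hφ : ∀ p, ‖φ p‖ ≤ 1) : ‖lift φ hφ‖ ≤ 1 :=
  LinearMap.mkContinuous_norm_le _ zero_le_one _

theorem coef_e (p q : ℕ × ℕ) : (e p).coef q = if q = p then 1 else 0 := by
  change lp.single (E := fun _ : ℕ × ℕ => ℝ) 1 p 1 q = _
  rw [lp.single_apply, Pi.single_apply]

@[simp] theorem lift_e (φ : ℕ × ℕ → F) (hφ : ∀ p, ‖φ p‖ ≤ 1) (p : ℕ × ℕ) :
    lift φ hφ (e p) = φ p := by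
  change ∑' q, (e p).coef q • φ q = φ p
  rw [tsum_eq_single p]
  · simp [coef_e]
  · intro q hq
    simp [coef_e, hq]

/-- The multiplicity `binom(j + k, j)`. -/
def mult (p : ℕ × ℕ) : ℕ := (p.1 + p.2).choose p.1

theorem mult_pos (p : ℕ × ℕ) : 0 < mult p := Nat.choose_pos (Nat.le_add_right _ _)

/-- A single term of Vandermonde's identity. It makes the structure constants at most 1, hence the
norm submultiplicative. -/
theorem mult_mul_mult_le (p q : ℕ × ℕ) : mult p * mult q ≤ mult (p + q) := by
  unfold mult
  have h : (p + q).1 + (p + q).2 = (p.1 + p.2) + (q.1 + q.2) :=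
    add_add_add_comm _ _ _ _
  rw [h, Prod.fst_add, Nat.add_choose_eq (p.1 + p.2) (q.1 + q.2)]
  exact Finset.single_le_sum
    (f := fun ij : ℕ × ℕ => (p.1 + p.2).choose ij.1 * (q.1 + q.2).choose ij.2)
    (fun _ _ => Nat.zero_le _) (a := (p.1, q.1)) (Finset.HasAntidiagonal.mem_antidiagonal.2 rfl)

/-- The structure constants of the multiplication of power series. -/
noncomputable def ratio (p q : ℕ × ℕ) : ℝ := (mult p * mult q : ℝ) / mult (p + q)

theorem ratio_nonneg (p q : ℕ × ℕ) : 0 ≤ ratio p q := by unfold ratio; positivity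

theorem ratio_le_one (p q : ℕ × ℕ) : ratio p q ≤ 1 := by
  unfold ratio
  rw [div_le_one (by exact_mod_cast mult_pos _)]
  exact_mod_cast mult_mul_mult_le p q

theorem norm_ratio_smul_e_le (p q r : ℕ × ℕ) : ‖ratio p q • e r‖ ≤ 1 := by
  rw [norm_smul, norm_e, mul_one, Real.norm_of_nonneg (ratio_nonneg p q)]
  exact ratio_le_one p q

/-- Multiplication of power series, as a continuous bilinear map. -/
noncomputable def mulCLM : PSeries →L[ℝ] PSeries →L[ℝ] PSeries :=
  lift (fun p => lift (fun q => ratio p q • e (p + q)) (fun _ => norm_ratio_smul_e_le _ _ _))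
    (fun _ => norm_lift_le _ _)

noncomputable instance : Mul PSeries := ⟨fun a b => mulCLM a b⟩

theorem mul_def (a b : PSeries) : a * b = mulCLM a b := rfl

theorem e_mul_e (p q : ℕ × ℕ) : e p * e q = ratio p q • e (p + q) := by
  simp [mul_def, mulCLM]

noncomputable instance : One PSeries := ⟨e 0⟩

theorem one_def : (1 : PSeries) = e 0 := rfl

theorem mul_comm' (a b : PSeries) : a * b = b * a := by
  have : mulCLM = mulCLM.flip := by
    refine bilin_ext fun p q => ?_
    rw [ContinuousLinearMap.flip_apply, ← mul_def, ← mul_def, e_mul_e, e_mul_e, add_comm q p]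
    unfold ratio
    rw [add_comm q p, mul_comm]
  exact congrArg (fun f : PSeries →L[ℝ] PSeries →L[ℝ] PSeries => f a b) this

theorem mul_assoc' (a b c : PSeries) : a * b * c = a * (b * c) := by
  let L : PSeries →L[ℝ] PSeries →L[ℝ] PSeries →L[ℝ] PSeries :=
    ((ContinuousLinearMap.compL ℝ PSeries PSeries (PSeries →L[ℝ] PSeries) mulCLM)).comp mulCLM
  let R : PSeries →L[ℝ] PSeries →L[ℝ] PSeries →L[ℝ] PSeries :=
    ((ContinuousLinearMap.compL ℝ PSeries (PSeries →L[ℝ] PSeries) (PSeries →L[ℝ] PSeries)).flip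
      mulCLM).comp ((ContinuousLinearMap.compL ℝ PSeries PSeries PSeries).comp mulCLM)
  have hL : ∀ a b c, L a b c = a * b * c := fun _ _ _ => rfl
  have hR : ∀ a b c, R a b c = a * (b * c) := fun _ _ _ => rfl
  have : L = R := by
    refine clm_ext fun p => clm_ext fun q => clm_ext fun r => ?_
    rw [hL, hR, e_mul_e, e_mul_e, mul_def, mul_def, map_smul, map_smul,
      smul_apply, ← mul_def, ← mul_def, e_mul_e, e_mul_e, smul_smul, smul_smul,
      add_assoc]
    -- Both scalars equal `mult p * mult q * mult r / mult (p + q + r)`.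
    congr 1
    have h1 : (mult (p + q) : ℝ) ≠ 0 := by exact_mod_cast (mult_pos _).ne'
    have h2 : (mult (q + r) : ℝ) ≠ 0 := by exact_mod_cast (mult_pos _).ne'
    unfold ratio
    rw [add_assoc]
    field_simp
  rw [← hL, ← hR, this]

theorem one_mul' (a : PSeries) : 1 * a = a := by
  have : mulCLM 1 = ContinuousLinearMap.id ℝ PSeries := by
    refine clm_ext fun p => ?_
    rw [← mul_def, one_def, e_mul_e, zero_add]
    have h1 : (mult p : ℝ) ≠ 0 := by exact_mod_cast (mult_pos _).ne'
    simp [ratio, mult]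
    rw [div_self (by unfold mult at h1; exact h1), one_smul]
  exact congrArg (fun f : PSeries →L[ℝ] PSeries => f a) this

theorem norm_mulCLM_le : ‖mulCLM‖ ≤ 1 := norm_lift_le _ _

noncomputable instance : NormedCommRing PSeries where
  __ := (inferInstance : NormedAddCommGroup PSeries)
  mul := (· * ·)
  one := 1
  left_distrib a b c := by simp [mul_def]
  right_distrib a b c := by simp [mul_def]
  zero_mul a := by simp [mul_def]
  mul_zero a := by simp [mul_def]
  mul_assoc := mul_assoc'
  one_mul := one_mul'
  mul_one a := by rw [mul_comm', one_mul']
  mul_comm := mul_comm'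
  dist_eq := NormedAddGroup.dist_eq
  norm_mul_le a b := by
    refine (mulCLM.le_opNorm₂ a b).trans ?_
    have := norm_mulCLM_le
    have h : 0 ≤ ‖a‖ * ‖b‖ := by positivity
    nlinarith

instance : NormOneClass PSeries := ⟨norm_e 0⟩

noncomputable instance : NormedAlgebra ℝ PSeries where
  toAlgebra := Algebra.ofModule (fun r a b => by simp [mul_def]) (fun r a b => by simp [mul_def])
  norm_smul_le := norm_smul_le

/-- The constant coefficient. -/
noncomputable def constCoef : PSeries →L[ℝ] ℝ :=
  lift (fun p => if p = 0 then 1 else 0) (fun p => by split_ifs <;> simp)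

/-- The shift lowering the exponent of `τ`. -/
noncomputable def shiftLeft : PSeries →L[ℝ] PSeries :=
  lift (fun p => if p.1 = 0 then 0 else e (p.1 - 1, p.2))
    (fun p => by split_ifs <;> simp [norm_e])

/-- The shift lowering the exponent of `y`. -/
noncomputable def shiftRight : PSeries →L[ℝ] PSeries :=
  lift (fun p => if p.2 = 0 then 0 else e (p.1, p.2 - 1))
    (fun p => by split_ifs <;> simp [norm_e])

/-- The combination of shifts whose resolvent is the evaluation at a point. -/
noncomputable def shiftAt (z : ℝ × ℝ) : PSeries →L[ℝ] PSeries := z.1 • shiftLeft + z.2 • shiftRight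

/-- Both shifts have norm at most 1, so |τ|, |y| < 1/2 suffices for `1 - shiftAt z` to be
invertible. -/
theorem norm_shiftAt_lt {z : ℝ × ℝ} (hz : z ∈ Metric.ball (0 : ℝ × ℝ) (1 / 2)) :
    ‖shiftAt z‖ < 1 := by
  have h0 : ‖z‖ < 1 / 2 := by simpa using hz
  have h1 : ‖z.1‖ < 1 / 2 := (norm_fst_le z).trans_lt h0
  have h2 : ‖z.2‖ < 1 / 2 := (norm_snd_le z).trans_lt h0
  have h3 : ‖shiftLeft‖ ≤ 1 := norm_lift_le _ _
  have h4 : ‖shiftRight‖ ≤ 1 := norm_lift_le _ _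
  refine (norm_add_le _ _).trans_lt ?_
  rw [norm_smul, norm_smul]
  have h5 := mul_le_mul_of_nonneg_left h3 (norm_nonneg z.1)
  have h6 := mul_le_mul_of_nonneg_left h4 (norm_nonneg z.2)
  linarith

/-- Evaluation at the point `z = (τ, y)`. -/
noncomputable def eval (z : ℝ × ℝ) : PSeries →L[ℝ] ℝ :=
  constCoef.comp (Ring.inverse (1 - shiftAt z))

/-- Inversion in the Banach algebra of operators is smooth, so the functions represented by power
series are smooth without any term-by-term differentiation. -/
theorem contDiffAt_eval {z : ℝ × ℝ} (hz : z ∈ Metric.ball (0 : ℝ × ℝ) (1 / 2)) {n : WithTop ℕ∞} :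
    ContDiffAt ℝ n eval z := by
  have h1 : ContDiffAt ℝ n (fun z : ℝ × ℝ => 1 - shiftAt z) z := by
    unfold shiftAt
    fun_prop
  have h2 : ContDiffAt ℝ n Ring.inverse (1 - shiftAt z) :=
    contDiffAt_ringInverse ℝ (Units.oneSub (shiftAt z) (norm_shiftAt_lt hz))
  have h3 := h2.comp z h1
  exact contDiffAt_const.clm_comp h3

theorem eval_eq {z : ℝ × ℝ} (hz : z ∈ Metric.ball (0 : ℝ × ℝ) (1 / 2)) (a : PSeries) :
    eval z a = constCoef a + eval z (shiftAt z a) := by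
  have hu : IsUnit (1 - shiftAt z) := (Units.oneSub (shiftAt z) (norm_shiftAt_lt hz)).isUnit
  have h := Ring.inverse_mul_cancel _ hu
  rw [mul_sub, mul_one, sub_eq_iff_eq_add] at h
  have h2 := congrArg (fun f : PSeries →L[ℝ] PSeries => constCoef (f a)) h
  simpa [eval] using h2

/-- Each application of `shiftAt z` removes one factor τ or y with weight `z.1` or `z.2`, and there
are binom(j + k, j) orders in which (j, k) can be brought down to 0. The induction is on j + k. -/
theorem eval_e {z : ℝ × ℝ} (hz : z ∈ Metric.ball (0 : ℝ × ℝ) (1 / 2)) (p : ℕ × ℕ) :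
    eval z (e p) = mult p * z.1 ^ p.1 * z.2 ^ p.2 := by
  obtain ⟨m, hm⟩ : ∃ m, p.1 + p.2 = m := ⟨_, rfl⟩
  induction m generalizing p with
  | zero =>
    obtain ⟨j, k⟩ := p
    obtain ⟨rfl, rfl⟩ : j = 0 ∧ k = 0 := by simpa using hm
    rw [eval_eq hz]
    simp [constCoef, shiftAt, shiftLeft, shiftRight, mult]
  | succ m ih =>
    obtain ⟨j, k⟩ := p
    rw [eval_eq hz]
    rcases j with _ | j
    · rcases k with _ | k
      · simp at hm
      · have := ih (0, k) (by simpa using hm)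
        simp [constCoef, shiftAt, shiftLeft, shiftRight, mult, this]
        ring
    · rcases k with _ | k
      · have := ih (j, 0) (by simpa using hm)
        simp [constCoef, shiftAt, shiftLeft, shiftRight, mult, this]
        ring
      · have h1 := ih (j, k + 1) (by simp at hm ⊢; omega)
        have h2 := ih (j + 1, k) (by simp at hm ⊢; omega)
        -- Pascal's rule, according to the variable that is removed first.
        have h3 : mult (j + 1, k + 1) = mult (j, k + 1) + mult (j + 1, k) := by
          simp only [mult]
          rw [show j + 1 + (k + 1) = (j + (k + 1)) + 1 by ring,
            show j + 1 + k = j + (k + 1) by ring, Nat.choose_succ_succ]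
        simp [constCoef, shiftAt, shiftLeft, shiftRight, h1, h2, h3]
        ring

theorem eval_one {z : ℝ × ℝ} (hz : z ∈ Metric.ball (0 : ℝ × ℝ) (1 / 2)) : eval z 1 = 1 := by
  rw [one_def, eval_e hz]; simp [mult]

theorem eval_mul {z : ℝ × ℝ} (hz : z ∈ Metric.ball (0 : ℝ × ℝ) (1 / 2)) (a b : PSeries) :
    eval z (a * b) = eval z a * eval z b := by
  have : (ContinuousLinearMap.compL ℝ PSeries PSeries ℝ (eval z)).comp mulCLM =
      ((ContinuousLinearMap.mul ℝ ℝ).bilinearComp (eval z) (eval z)) := by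
    refine bilin_ext fun p q => ?_
    change eval z (e p * e q) = eval z (e p) * eval z (e q)
    have h1 : (mult (p + q) : ℝ) ≠ 0 := by exact_mod_cast (mult_pos _).ne'
    rw [e_mul_e, map_smul, eval_e hz, eval_e hz, eval_e hz, ratio, smul_eq_mul]
    simp only [Prod.fst_add, Prod.snd_add, pow_add]
    field_simp
  exact congrArg (fun f : PSeries →L[ℝ] PSeries →L[ℝ] ℝ => f a b) this

/-- Evaluation at a point, as an algebra homomorphism. -/
noncomputable def evalHom {z : ℝ × ℝ} (hz : z ∈ Metric.ball (0 : ℝ × ℝ) (1 / 2)) :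
    PSeries →ₐ[ℝ] ℝ :=
  AlgHom.ofLinearMap (eval z).toLinearMap (eval_one hz) (eval_mul hz)

theorem evalHom_apply {z : ℝ × ℝ} (hz : z ∈ Metric.ball (0 : ℝ × ℝ) (1 / 2)) (a : PSeries) :
    evalHom hz a = eval z a := rfl

/-- The partial derivative of the evaluation in direction `v`. -/
noncomputable def evalDeriv (z v : ℝ × ℝ) : PSeries →L[ℝ] ℝ := fderiv ℝ eval z v

theorem hasFDerivAt_eval {z : ℝ × ℝ} (hz : z ∈ Metric.ball (0 : ℝ × ℝ) (1 / 2)) :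
    HasFDerivAt eval (fderiv ℝ eval z) z :=
  ((contDiffAt_eval hz (n := 1)).differentiableAt one_ne_zero).hasFDerivAt

theorem hasDerivAt_eval_fst {τ y : ℝ} (hz : (τ, y) ∈ Metric.ball (0 : ℝ × ℝ) (1 / 2))
    (a : PSeries) : HasDerivAt (fun s => eval (s, y) a) (evalDeriv (τ, y) (1, 0) a) τ := by
  have h1 : HasDerivAt (fun s : ℝ => (s, y)) (1, 0) τ :=
    (hasDerivAt_id τ).prodMk (hasDerivAt_const τ y)
  have h2 := (hasFDerivAt_eval hz).comp_hasDerivAt τ h1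
  exact h2.clm_apply (hasDerivAt_const τ a) |>.congr_deriv (by simp [evalDeriv])

theorem hasDerivAt_eval_snd {τ y : ℝ} (hz : (τ, y) ∈ Metric.ball (0 : ℝ × ℝ) (1 / 2))
    (a : PSeries) : HasDerivAt (fun s => eval (τ, s) a) (evalDeriv (τ, y) (0, 1) a) y := by
  have h1 : HasDerivAt (fun s : ℝ => (τ, s)) (0, 1) y :=
    (hasDerivAt_const y τ).prodMk (hasDerivAt_id y)
  have h2 := (hasFDerivAt_eval hz).comp_hasDerivAt y h1
  exact h2.clm_apply (hasDerivAt_const y a) |>.congr_deriv (by simp [evalDeriv])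

theorem evalDeriv_fst_e {τ y : ℝ} (hz : (τ, y) ∈ Metric.ball (0 : ℝ × ℝ) (1 / 2)) (p : ℕ × ℕ) :
    evalDeriv (τ, y) (1, 0) (e p) = mult p * (p.1 * τ ^ (p.1 - 1)) * y ^ p.2 := by
  refine (hasDerivAt_eval_fst hz (e p)).unique ?_
  have h1 := ((hasDerivAt_pow p.1 τ).const_mul (mult p : ℝ)).mul_const (y ^ p.2)
  refine h1.congr_of_eventuallyEq ?_
  have hc : ContinuousAt (fun s : ℝ => (s, y)) τ := by fun_prop
  filter_upwards [hc.preimage_mem_nhds (Metric.isOpen_ball.mem_nhds hz)] with s hs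
  exact eval_e hs p

theorem evalDeriv_snd_e {τ y : ℝ} (hz : (τ, y) ∈ Metric.ball (0 : ℝ × ℝ) (1 / 2)) (p : ℕ × ℕ) :
    evalDeriv (τ, y) (0, 1) (e p) = mult p * τ ^ p.1 * (p.2 * y ^ (p.2 - 1)) := by
  refine (hasDerivAt_eval_snd hz (e p)).unique ?_
  have h1 := (hasDerivAt_pow p.2 y).const_mul (mult p * τ ^ p.1 : ℝ)
  refine h1.congr_of_eventuallyEq ?_
  have hc : ContinuousAt (fun s : ℝ => (τ, s)) y := by fun_prop
  filter_upwards [hc.preimage_mem_nhds (Metric.isOpen_ball.mem_nhds hz)] with s hs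
  exact eval_e hs p

/-- The bilinear map `(a, v) ↦ ∫₀^τ a ∂_y v dτ`, which does not lose derivatives in the norm of
`PSeries`. -/
noncomputable def intMulDeriv : PSeries →L[ℝ] PSeries →L[ℝ] PSeries :=
  lift (fun p => lift (fun q => ((q.2 : ℝ) / (p.2 + q.2)) • ratio p q •
      e (p.1 + q.1 + 1, p.2 + q.2 - 1)) (fun q => by
    rw [norm_smul, Real.norm_of_nonneg (by positivity)]
    refine mul_le_one₀ (div_le_one_of_le₀ ?_ (by positivity)) (norm_nonneg _)
      (norm_ratio_smul_e_le _ _ _)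
    exact le_add_of_nonneg_left (Nat.cast_nonneg _)))
    (fun _ => norm_lift_le _ _)

theorem intMulDeriv_e (p q : ℕ × ℕ) : intMulDeriv (e p) (e q) =
    ((q.2 : ℝ) / (p.2 + q.2)) • ratio p q • e (p.1 + q.1 + 1, p.2 + q.2 - 1) := by
  simp [intMulDeriv]

/-- For a product of unit vectors with total exponents J of τ and K of y, the derivative of the
second factor gives k' and the integration gives 1/(J+1). Since binom(J+K, J) K = binom(J+K, J+1)
(J+1), the normalization of the unit vectors turns this into the factor k'/K ≤ 1 of `intMulDeriv`.
The integration in τ thus pays for the derivative in y, and the Cauchy problem becomes a fixed-point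
equation in one Banach space. -/
theorem evalDeriv_intMulDeriv {τ y : ℝ} (hz : (τ, y) ∈ Metric.ball (0 : ℝ × ℝ) (1 / 2))
    (a v : PSeries) : evalDeriv (τ, y) (1, 0) (intMulDeriv a v) =
      eval (τ, y) a * evalDeriv (τ, y) (0, 1) v := by
  have : (ContinuousLinearMap.compL ℝ PSeries PSeries ℝ (evalDeriv (τ, y) (1, 0))).comp intMulDeriv =
      ((ContinuousLinearMap.mul ℝ ℝ).bilinearComp (eval (τ, y)) (evalDeriv (τ, y) (0, 1))) := by
    refine bilin_ext fun p q => ?_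
    change evalDeriv (τ, y) (1, 0) (intMulDeriv (e p) (e q)) =
      eval (τ, y) (e p) * evalDeriv (τ, y) (0, 1) (e q)
    rw [intMulDeriv_e, map_smul, map_smul, evalDeriv_fst_e hz, eval_e hz, evalDeriv_snd_e hz]
    obtain ⟨j, k⟩ := p
    obtain ⟨j', _ | k'⟩ := q
    · simp
    · have h1 : (mult (j + j', k + (k' + 1)) : ℝ) ≠ 0 := by exact_mod_cast (mult_pos _).ne'
      have h2 : mult (j + j' + 1, k + k') * (j + j' + 1) =
          mult (j + j', k + (k' + 1)) * (k + k' + 1) := by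
        simp only [mult]
        have := Nat.choose_succ_right_eq (j + j' + 1 + (k + k')) (j + j')
        rw [this, show j + j' + 1 + (k + k') = j + j' + (k + (k' + 1)) by ring,
          show j + j' + (k + (k' + 1)) - (j + j') = k + k' + 1 by omega]
      have h2' : (mult (j + j' + 1, k + k') : ℝ) * (j + j' + 1) =
          mult (j + j', k + (k' + 1)) * (k + k' + 1) := by exact_mod_cast h2
      have h3 : (k : ℝ) + (k' + 1) ≠ 0 := by positivity
      simp only [ratio, smul_eq_mul, Prod.mk_add_mk, Nat.add_sub_cancel, ← add_assoc] at h1 ⊢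
      push_cast
      simp only [← add_assoc] at h2' h3 ⊢
      rw [pow_add, pow_add]
      field_simp
      linear_combination (mult (j, k)) * (mult (j', k' + 1)) * τ ^ j * τ ^ j' * y ^ k * y ^ k' * h2'
  exact congrArg (fun f : PSeries →L[ℝ] PSeries →L[ℝ] ℝ => f a v) this

theorem eval_intMulDeriv_zero {y : ℝ} (hz : ((0 : ℝ), y) ∈ Metric.ball (0 : ℝ × ℝ) (1 / 2))
    (a v : PSeries) : eval (0, y) (intMulDeriv a v) = 0 := by
  have : (ContinuousLinearMap.compL ℝ PSeries PSeries ℝ (eval (0, y))).comp intMulDeriv = 0 := by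
    refine bilin_ext fun p q => ?_
    change eval (0, y) (intMulDeriv (e p) (e q)) = 0
    rw [intMulDeriv_e, map_smul, map_smul, eval_e hz]
    simp
  exact congrArg (fun f : PSeries →L[ℝ] PSeries →L[ℝ] ℝ => f a v) this

/-- The variable `y`. -/
noncomputable def varY : PSeries := e (0, 1)

theorem eval_varY {z : ℝ × ℝ} (hz : z ∈ Metric.ball (0 : ℝ × ℝ) (1 / 2)) : eval z varY = z.2 := by
  rw [varY, eval_e hz]; simp [mult]

theorem evalDeriv_snd_varY {τ y : ℝ} (hz : (τ, y) ∈ Metric.ball (0 : ℝ × ℝ) (1 / 2)) :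
    evalDeriv (τ, y) (0, 1) varY = 1 := by
  rw [varY, evalDeriv_snd_e hz]; simp [mult]

/-- binom(j + k, j) ≤ 2^(j + k) is balanced by |τ|^j |y|^k ≤ 2^-(j + k). The bound is uniform in z,
so that in `exists_lift_analyticAt` one ball of power series serves all evaluation points. -/
theorem norm_eval_le {z : ℝ × ℝ} (hz : z ∈ Metric.ball (0 : ℝ × ℝ) (1 / 2)) (a : PSeries) :
    ‖eval z a‖ ≤ ‖a‖ := by
  have h0 : ‖z‖ < 1 / 2 := by simpa using hz
  have h1 : ‖z.1‖ ≤ 1 / 2 := ((norm_fst_le z).trans_lt h0).le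
  have h2 : ‖z.2‖ ≤ 1 / 2 := ((norm_snd_le z).trans_lt h0).le
  have hb : ∀ p, ‖eval z (e p)‖ ≤ 1 := by
    intro p
    rw [eval_e hz, norm_mul, norm_mul, norm_pow, norm_pow, Real.norm_natCast]
    have h3 : (mult p : ℝ) ≤ 2 ^ (p.1 + p.2) := by
      exact_mod_cast Nat.choose_le_two_pow (p.1 + p.2) p.1
    calc (mult p : ℝ) * ‖z.1‖ ^ p.1 * ‖z.2‖ ^ p.2
        ≤ 2 ^ (p.1 + p.2) * (1 / 2) ^ p.1 * (1 / 2) ^ p.2 := by gcongr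
      _ = 1 := by rw [mul_assoc, ← pow_add, ← mul_pow]; norm_num
  have h : eval z = lift (fun p => eval z (e p)) hb := clm_ext fun p => by rw [lift_e]
  rw [h]
  exact ((lift _ hb).le_opNorm a).trans
    (mul_le_of_le_one_left (norm_nonneg _) (norm_lift_le _ hb))

/-- The standard basis of `ℝ × ℝ`. -/
def planeBasis (b : Bool) : ℝ × ℝ := if b then (1, 0) else (0, 1)

theorem norm_planeBasis (b : Bool) : ‖planeBasis b‖ = 1 := by
  cases b <;> simp [planeBasis, Prod.norm_def]

/-- The coordinates of pairs of power series. -/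
noncomputable def planeCoord (b : Bool) : PSeries × PSeries →L[ℝ] PSeries :=
  if b then ContinuousLinearMap.fst ℝ PSeries PSeries else ContinuousLinearMap.snd ℝ PSeries PSeries

theorem norm_planeCoord_le (b : Bool) : ‖planeCoord b‖ ≤ 1 := by
  cases b
  · exact ContinuousLinearMap.norm_snd_le ℝ PSeries PSeries
  · exact ContinuousLinearMap.norm_fst_le ℝ PSeries PSeries

/-- The power series with the same coefficients as `q`, for arguments in `PSeries`. -/
noncomputable def liftSeries (q : FormalMultilinearSeries ℝ (ℝ × ℝ) ℝ) :
    FormalMultilinearSeries ℝ (PSeries × PSeries) PSeries := fun m =>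
  ∑ f : Fin m → Bool, q m (fun i => planeBasis (f i)) •
    (ContinuousMultilinearMap.mkPiAlgebra ℝ (Fin m) PSeries).compContinuousLinearMap
      (fun i => planeCoord (f i))

/-- There are 2^m words of length m in the two coordinates, each contributing at most ‖q m‖;
substituting power series costs at most a factor 2 in the radius. -/
theorem norm_liftSeries_le (q : FormalMultilinearSeries ℝ (ℝ × ℝ) ℝ) (m : ℕ) :
    ‖liftSeries q m‖ ≤ 2 ^ m * ‖q m‖ := by
  refine (norm_sum_le _ _).trans ?_
  have h : ∀ f : Fin m → Bool, ‖q m (fun i => planeBasis (f i)) •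
      (ContinuousMultilinearMap.mkPiAlgebra ℝ (Fin m) PSeries).compContinuousLinearMap
      (fun i => planeCoord (f i))‖ ≤ ‖q m‖ := by
    intro f
    rw [norm_smul]
    have h1 : ‖q m (fun i => planeBasis (f i))‖ ≤ ‖q m‖ := by
      simpa [norm_planeBasis] using (q m).le_opNorm (fun i => planeBasis (f i))
    have h2 : ‖(ContinuousMultilinearMap.mkPiAlgebra ℝ (Fin m) PSeries).compContinuousLinearMap
        (fun i => planeCoord (f i))‖ ≤ 1 := by
      refine (ContinuousMultilinearMap.norm_compContinuousLinearMap_le _ _).trans ?_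
      rw [ContinuousMultilinearMap.norm_mkPiAlgebra, one_mul]
      exact Finset.prod_le_one (fun _ _ => norm_nonneg _) (fun _ _ => norm_planeCoord_le _)
    exact (mul_le_of_le_one_right (norm_nonneg _) h2).trans h1
  refine (Finset.sum_le_sum fun f _ => h f).trans ?_
  simp

theorem radius_liftSeries_pos (q : FormalMultilinearSeries ℝ (ℝ × ℝ) ℝ) (hq : 0 < q.radius) :
    0 < (liftSeries q).radius := by
  obtain ⟨r, hr0, hr⟩ := ENNReal.lt_iff_exists_nnreal_btwn.1 hq
  obtain ⟨C, -, hC⟩ := q.norm_mul_pow_le_of_lt_radius hr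
  have h0 : 0 < r := by exact_mod_cast hr0
  refine lt_of_lt_of_le ?_ ((liftSeries q).le_radius_of_bound (r := r / 2) C (fun m => ?_))
  · exact_mod_cast half_pos h0
  · calc ‖liftSeries q m‖ * ((r / 2 : NNReal) : ℝ) ^ m
        ≤ 2 ^ m * ‖q m‖ * ((r / 2 : NNReal) : ℝ) ^ m := by
          gcongr; exact norm_liftSeries_le q m
      _ = ‖q m‖ * (r : ℝ) ^ m := by
          push_cast; rw [div_pow]; field_simp
      _ ≤ C := hC m

/-- Evaluation is an algebra homomorphism, hence commutes with substitution; the right side is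
expanded in the basis of the plane to match the words on the left. -/
theorem eval_liftSeries (q : FormalMultilinearSeries ℝ (ℝ × ℝ) ℝ) {z : ℝ × ℝ}
    (hz : z ∈ Metric.ball (0 : ℝ × ℝ) (1 / 2)) (m : ℕ) (w : PSeries × PSeries) :
    eval z (liftSeries q m (fun _ => w)) = q m (fun _ => (eval z w.1, eval z w.2)) := by
  have h1 : (fun _ : Fin m => (eval z w.1, eval z w.2)) =
      fun _ => ∑ b : Bool, eval z (planeCoord b w) • planeBasis b := by
    ext i <;> simp [planeBasis, planeCoord]
  rw [h1, (q m).map_sum, liftSeries, sum_apply, map_sum]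
  refine Finset.sum_congr rfl fun f _ => ?_
  rw [ContinuousMultilinearMap.map_smul_univ, smul_apply, map_smul,
    smul_eq_mul, smul_eq_mul, mul_comm]
  congr 1
  rw [ContinuousMultilinearMap.compContinuousLinearMap_apply,
    ContinuousMultilinearMap.mkPiAlgebra_apply, ← evalHom_apply hz, map_prod]
  rfl

/-- An analytic function of two variables acts on power series close to a constant. -/
theorem exists_lift_analyticAt {g : ℝ × ℝ → ℝ} {z₀ : ℝ × ℝ} (hg : AnalyticAt ℝ g z₀) :
    ∃ G : PSeries × PSeries → PSeries, ContDiffAt ℝ 1 G 0 ∧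
      ∀ᶠ w in 𝓝 (0 : PSeries × PSeries), ∀ z ∈ Metric.ball (0 : ℝ × ℝ) (1 / 2),
        eval z (G w) = g (z₀ + (eval z w.1, eval z w.2)) := by
  obtain ⟨q, s, hq⟩ := hg
  have hpos := radius_liftSeries_pos q (hq.r_pos.trans_le hq.r_le)
  have hG := (liftSeries q).hasFPowerSeriesOnBall hpos
  refine ⟨(liftSeries q).sum, hG.analyticAt.contDiffAt, ?_⟩
  filter_upwards [Metric.eball_mem_nhds (0 : PSeries × PSeries) hpos,
    Metric.eball_mem_nhds (0 : PSeries × PSeries) hq.r_pos] with w hw1 hw2 z hz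
  have h1 := (hG.hasSum hw1).mapL (eval z)
  simp only [zero_add, eval_liftSeries q hz] at h1
  have h2 : (eval z w.1, eval z w.2) ∈ Metric.eball (0 : ℝ × ℝ) s := by
    have h3 : ‖(eval z w.1, eval z w.2)‖ ≤ ‖w‖ := by
      rw [Prod.norm_def, Prod.norm_def]
      exact max_le_max (norm_eval_le hz _) (norm_eval_le hz _)
    rw [Metric.mem_eball, edist_zero_right] at hw2 ⊢
    refine lt_of_le_of_lt ?_ hw2
    rw [← ofReal_norm, ← ofReal_norm]
    exact ENNReal.ofReal_le_ofReal h3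
  exact h1.unique (hq.hasSum h2)

end PSeries

/-! ### Local solutions with prescribed 2-jet (Cauchy–Kovalevskaya) -/

/-- Solvability of `u = u₀(ε) + ε K(ε, u)` for small `ε > 0`. -/
theorem exists_eq_add_smul {E : Type*} [NormedAddCommGroup E] [NormedSpace ℝ E] [CompleteSpace E]
    {u₀ : ℝ → E} {K : ℝ × E → E} (hu : ContDiffAt ℝ 1 u₀ 0) (hK : ContDiffAt ℝ 1 K (0, u₀ 0))
    {N : Set (ℝ × E)} (hN : N ∈ 𝓝 ((0 : ℝ), u₀ 0)) :
    ∃ ε > 0, ∃ u, (ε, u) ∈ N ∧ u = u₀ ε + ε • K (ε, u) := by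
  have h1 := (hu.hasStrictFDerivAt one_ne_zero)
  have h2 := (hK.hasStrictFDerivAt one_ne_zero)
  have h3 : HasStrictFDerivAt (fun x : ℝ × E => x.1 • K x) _ ((0 : ℝ), u₀ 0) :=
    hasStrictFDerivAt_fst.smul h2
  have h4 : HasStrictFDerivAt (fun x : ℝ × E => u₀ x.1) _ ((0 : ℝ), u₀ 0) :=
    HasStrictFDerivAt.comp ((0 : ℝ), u₀ 0) (g := u₀) h1 hasStrictFDerivAt_fst
  -- At ε = 0 the derivative of ε K in the direction of u vanishes, so the derivative of (ε, u) ↦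
  -- (ε, u - u₀ ε - ε K) is the shear (ε, u) ↦ (ε, u - ε M), which is invertible for every K.
  set M : ℝ →L[ℝ] E := fderiv ℝ u₀ 0 + ContinuousLinearMap.toSpanSingleton ℝ (K (0, u₀ 0)) with hM
  have h5 : HasStrictFDerivAt (fun x : ℝ × E => (x.1, x.2 - u₀ x.1 - x.1 • K x)) _
      ((0 : ℝ), u₀ 0) :=
    hasStrictFDerivAt_fst.prodMk ((hasStrictFDerivAt_snd.sub h4).sub h3)
  let L : (ℝ × E) ≃L[ℝ] (ℝ × E) := ContinuousLinearEquiv.equivOfInverse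
    ((ContinuousLinearMap.fst ℝ ℝ E).prod
      (ContinuousLinearMap.snd ℝ ℝ E - M.comp (ContinuousLinearMap.fst ℝ ℝ E)))
    ((ContinuousLinearMap.fst ℝ ℝ E).prod
      (ContinuousLinearMap.snd ℝ ℝ E + M.comp (ContinuousLinearMap.fst ℝ ℝ E)))
    (fun x => by simp) (fun x => by simp)
  have h6 : HasStrictFDerivAt (fun x : ℝ × E => (x.1, x.2 - u₀ x.1 - x.1 • K x))
      (L : (ℝ × E) →L[ℝ] (ℝ × E)) ((0 : ℝ), u₀ 0) := by
    refine h5.congr_fderiv ?_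
    ext x <;> simp [L, hM, sub_sub]
  -- By the inverse function theorem the image of N is a neighbourhood of (0, 0), so it contains (ε,
  -- 0) for some small ε > 0.
  have h7 := h6.map_nhds_eq_of_equiv
  simp only [sub_self, zero_smul] at h7
  have h8 := Filter.image_mem_map (m := fun x : ℝ × E => (x.1, x.2 - u₀ x.1 - x.1 • K x)) hN
  rw [h7] at h8
  have h9 : ContinuousAt (fun ε : ℝ => (ε, (0 : E))) 0 := by fun_prop
  obtain ⟨δ, hδ, hb⟩ := Metric.mem_nhds_iff.1 (h9.preimage_mem_nhds h8)
  obtain ⟨⟨ε, u⟩, hx, hxe⟩ := hb (show δ / 2 ∈ Metric.ball (0 : ℝ) δ by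
    rw [Metric.mem_ball, Real.dist_eq, sub_zero, abs_of_pos (by positivity)]; linarith)
  simp only [Prod.mk.injEq] at hxe
  obtain ⟨rfl, he⟩ := hxe
  refine ⟨δ / 2, by positivity, u, hx, ?_⟩
  rw [sub_sub, sub_eq_zero] at he
  exact he

namespace IsEquationOfState

variable {R Q : Set ℝ} {p : ℝ → ℝ → ℝ}

theorem isOpen_prod (hp : IsEquationOfState R Q p) : IsOpen (R ×ˢ Q) :=
  hp.isOpen_density.prod hp.isOpen_entropy

theorem pRho_eq_fderiv (hp : IsEquationOfState R Q p) {z : ℝ × ℝ} (hz : z ∈ R ×ˢ Q) :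
    pRho p z.1 z.2 = fderiv ℝ (fun z : ℝ × ℝ => p z.1 z.2) z (1, 0) := by
  have h1 : HasDerivAt (fun s : ℝ => (s, z.2)) (1, 0) z.1 :=
    (hasDerivAt_id _).prodMk (hasDerivAt_const _ _)
  exact ((hp.analytic z hz).differentiableAt.hasFDerivAt.comp_hasDerivAt z.1 h1).deriv

theorem pS_eq_fderiv (hp : IsEquationOfState R Q p) {z : ℝ × ℝ} (hz : z ∈ R ×ˢ Q) :
    pS p z.1 z.2 = fderiv ℝ (fun z : ℝ × ℝ => p z.1 z.2) z (0, 1) := by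
  have h1 : HasDerivAt (fun s : ℝ => (z.1, s)) (0, 1) z.2 :=
    (hasDerivAt_const _ _).prodMk (hasDerivAt_id _)
  exact ((hp.analytic z hz).differentiableAt.hasFDerivAt.comp_hasDerivAt z.2 h1).deriv

theorem analyticOnNhd_pRho (hp : IsEquationOfState R Q p) :
    AnalyticOnNhd ℝ (fun z : ℝ × ℝ => pRho p z.1 z.2) (R ×ˢ Q) := by
  have h : AnalyticOnNhd ℝ (fun z => fderiv ℝ (fun z : ℝ × ℝ => p z.1 z.2) z (1, 0)) (R ×ˢ Q) :=
    fun z hz => ((ContinuousLinearMap.apply ℝ ℝ ((1, 0) : ℝ × ℝ)).analyticAt _).comp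
      (hp.analytic.fderiv z hz)
  exact h.congr hp.isOpen_prod fun z hz => (hp.pRho_eq_fderiv hz).symm

theorem analyticOnNhd_pS (hp : IsEquationOfState R Q p) :
    AnalyticOnNhd ℝ (fun z : ℝ × ℝ => pS p z.1 z.2) (R ×ˢ Q) := by
  have h : AnalyticOnNhd ℝ (fun z => fderiv ℝ (fun z : ℝ × ℝ => p z.1 z.2) z (0, 1)) (R ×ˢ Q) :=
    fun z hz => ((ContinuousLinearMap.apply ℝ ℝ ((0, 1) : ℝ × ℝ)).analyticAt _).comp
      (hp.analytic.fderiv z hz)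
  exact h.congr hp.isOpen_prod fun z hz => (hp.pS_eq_fderiv hz).symm

end IsEquationOfState

namespace PSeries

/-- The polynomial `c₀ + c₁ (ε y) + c₂ (ε y)² / 2`. -/
noncomputable def quad (c₀ c₁ c₂ ε : ℝ) : PSeries :=
  c₀ • 1 + (ε * c₁) • varY + (ε ^ 2 * c₂ / 2) • (varY * varY)

theorem eval_quad {z : ℝ × ℝ} (hz : z ∈ Metric.ball (0 : ℝ × ℝ) (1 / 2)) (c₀ c₁ c₂ ε : ℝ) :
    eval z (quad c₀ c₁ c₂ ε) = c₀ + c₁ * (ε * z.2) + c₂ / 2 * (ε * z.2) ^ 2 := by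
  simp only [quad, map_add, map_smul, eval_one hz, eval_mul hz, eval_varY hz, smul_eq_mul]
  ring

theorem evalDeriv_quad {τ y : ℝ} (hz : (τ, y) ∈ Metric.ball (0 : ℝ × ℝ) (1 / 2))
    (c₀ c₁ c₂ ε : ℝ) : evalDeriv (τ, y) (1, 0) (quad c₀ c₁ c₂ ε) = 0 := by
  simp only [quad, map_add, map_smul, one_def, varY, e_mul_e, evalDeriv_fst_e hz]
  simp

theorem contDiff_quad (c₀ c₁ c₂ : ℝ) : ContDiff ℝ 1 (quad c₀ c₁ c₂) := by
  unfold quad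
  fun_prop

theorem quad_zero (c₀ c₁ c₂ : ℝ) : quad c₀ c₁ c₂ 0 = c₀ • 1 := by simp [quad]

/-- The function with power series `a` in the rescaled variables `(t - t₀) / ε²`,
`(r - r₀) / ε`. -/
noncomputable def field (t₀ r₀ ε : ℝ) (a : PSeries) (t r : ℝ) : ℝ :=
  eval ((t - t₀) / ε ^ 2, (r - r₀) / ε) a

/-- The domain of `field`. -/
def fieldDomain (t₀ r₀ ε : ℝ) : Set (ℝ × ℝ) :=
  {z | ((z.1 - t₀) / ε ^ 2, (z.2 - r₀) / ε) ∈ Metric.ball (0 : ℝ × ℝ) (1 / 2)}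

theorem isOpen_fieldDomain (t₀ r₀ ε : ℝ) : IsOpen (fieldDomain t₀ r₀ ε) :=
  Metric.isOpen_ball.preimage (by fun_prop)

theorem contDiffOn_field (t₀ r₀ ε : ℝ) (a : PSeries) :
    ContDiffOn ℝ 2 (fun z : ℝ × ℝ => field t₀ r₀ ε a z.1 z.2) (fieldDomain t₀ r₀ ε) := by
  intro z hz
  refine ContDiffAt.contDiffWithinAt ?_
  have h1 : ContDiffAt ℝ 2 (fun z : ℝ × ℝ => ((z.1 - t₀) / ε ^ 2, (z.2 - r₀) / ε)) z := by fun_prop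
  have h2 := (contDiffAt_eval hz (n := 2)).comp z h1
  exact h2.clm_apply contDiffAt_const

theorem hasDerivAt_field_time {t₀ r₀ ε t r : ℝ} (hz : (t, r) ∈ fieldDomain t₀ r₀ ε)
    (a : PSeries) : HasDerivAt (fun s => field t₀ r₀ ε a s r)
      (evalDeriv ((t - t₀) / ε ^ 2, (r - r₀) / ε) (1, 0) a / ε ^ 2) t := by
  have h1 : HasDerivAt (fun s : ℝ => (s - t₀) / ε ^ 2) (1 / ε ^ 2) t :=
    ((hasDerivAt_id t).sub_const t₀).div_const _
  have h2 := (hasDerivAt_eval_fst hz a).comp t h1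
  exact h2.congr_deriv (by ring)

theorem hasDerivAt_field_radius {t₀ r₀ ε t r : ℝ} (hz : (t, r) ∈ fieldDomain t₀ r₀ ε)
    (a : PSeries) : HasDerivAt (fun s => field t₀ r₀ ε a t s)
      (evalDeriv ((t - t₀) / ε ^ 2, (r - r₀) / ε) (0, 1) a / ε) r := by
  have h1 : HasDerivAt (fun s : ℝ => (s - r₀) / ε) (1 / ε) r :=
    ((hasDerivAt_id r).sub_const r₀).div_const _
  have h2 := (hasDerivAt_eval_snd hz a).comp r h1
  exact h2.congr_deriv (by ring)

end PSeries

open PSeries in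
/-- Local analytic solutions of the radial Euler equations with prescribed quadratic initial data
(a case of the Cauchy–Kovalevskaya theorem). -/
theorem exists_isRadialFlow (n : ℕ) {R Q : Set ℝ} {p : ℝ → ℝ → ℝ} (hp : IsEquationOfState R Q p)
    (t₀ : ℝ) {r₀ : ℝ} (hr₀ : 0 < r₀) (U₀ U₁ U₂ : ℝ) {ρ₀ : ℝ} (hρ₀ : ρ₀ ∈ R) (ρ₁ ρ₂ : ℝ)
    {S₀ : ℝ} (hS₀ : S₀ ∈ Q) (S₁ S₂ : ℝ) :
    ∃ (G : Set (ℝ × ℝ)) (U ρ S : ℝ → ℝ → ℝ), IsRadialFlow n R Q p G U ρ S ∧ (t₀, r₀) ∈ G ∧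
      ∀ r, (t₀, r) ∈ G → U t₀ r = U₀ + U₁ * (r - r₀) + U₂ / 2 * (r - r₀) ^ 2 ∧
        ρ t₀ r = ρ₀ + ρ₁ * (r - r₀) + ρ₂ / 2 * (r - r₀) ^ 2 ∧
        S t₀ r = S₀ + S₁ * (r - r₀) + S₂ / 2 * (r - r₀) ^ 2 := by
  have hz₀ : (ρ₀, S₀) ∈ R ×ˢ Q := ⟨hρ₀, hS₀⟩
  have hρpos : ρ₀ ≠ 0 := (hp.density_pos _ hρ₀).ne'
  have ha1 : AnalyticAt ℝ (fun z : ℝ × ℝ => pRho p z.1 z.2 / z.1) (ρ₀, S₀) :=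
    (hp.analyticOnNhd_pRho _ hz₀).div analyticAt_fst hρpos
  have ha2 : AnalyticAt ℝ (fun z : ℝ × ℝ => pS p z.1 z.2 / z.1) (ρ₀, S₀) :=
    (hp.analyticOnNhd_pS _ hz₀).div analyticAt_fst hρpos
  obtain ⟨G₁, hG₁, hG₁e⟩ := exists_lift_analyticAt ha1
  obtain ⟨G₂, hG₂, hG₂e⟩ := exists_lift_analyticAt ha2
  -- In the variables τ = (t - t₀)/ε², y = (r - r₀)/ε, the terms with a radial derivative carry one
  -- factor ε and the source term (n-1)Uρ/r carries ε². Integration in τ gives u = u₀(ε) + ε K(ε,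
  -- u). At ε = 0 the data are constants, around which the analytic coefficients are expanded.
  let u₀ : ℝ → PSeries × PSeries × PSeries := fun ε => (quad U₀ U₁ U₂ ε, quad ρ₀ ρ₁ ρ₂ ε, quad S₀ S₁ S₂ ε)
  have hu0 : u₀ 0 = (U₀ • 1, ρ₀ • 1, S₀ • 1) := by simp only [u₀, quad_zero]
  let dev : ℝ × PSeries × PSeries × PSeries → PSeries × PSeries := fun x => (x.2.2.1 - ρ₀ • 1, x.2.2.2 - S₀ • 1)
  let W : ℝ × PSeries × PSeries × PSeries → PSeries := fun x => Ring.inverse (r₀ • 1 + x.1 • varY)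
  -- The factor `x.1` in the density equation is the second ε of the source term. That term is
  -- paired with `varY` because ∂_y y = 1 reduces `intMulDeriv` to integration in τ. `W` represents
  -- 1/r.
  let K : ℝ × PSeries × PSeries × PSeries → PSeries × PSeries × PSeries := fun x =>
    (-(intMulDeriv x.2.1 x.2.1 + intMulDeriv (G₁ (dev x)) x.2.2.1
        + intMulDeriv (G₂ (dev x)) x.2.2.2),
      -(intMulDeriv x.2.1 x.2.2.1 + intMulDeriv x.2.2.1 x.2.1
        + (((n : ℝ) - 1) * x.1) • intMulDeriv (W x * x.2.1 * x.2.2.1) varY),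
      -(intMulDeriv x.2.1 x.2.2.2))
  have hu : ContDiffAt ℝ 1 u₀ 0 :=
    ((contDiff_quad _ _ _).prodMk ((contDiff_quad _ _ _).prodMk (contDiff_quad _ _ _))).contDiffAt
  have hdev0 : dev ((0 : ℝ), u₀ 0) = 0 := by simp only [dev, hu0, sub_self]; rfl
  have hdev : ContDiff ℝ 1 dev := by
    change ContDiff ℝ 1 fun x : ℝ × PSeries × PSeries × PSeries =>
      (x.2.2.1 - ρ₀ • (1 : PSeries), x.2.2.2 - S₀ • (1 : PSeries))
    fun_prop
  have hunit : IsUnit (r₀ • (1 : PSeries) + (0 : ℝ) • varY) := by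
    rw [zero_smul, add_zero, ← Algebra.algebraMap_eq_smul_one]
    exact (isUnit_iff_ne_zero.2 hr₀.ne').map (algebraMap ℝ PSeries)
  have hlin : Continuous fun x : ℝ × PSeries × PSeries × PSeries => r₀ • (1 : PSeries) + x.1 • varY := by fun_prop
  have hK : ContDiffAt ℝ 1 K (0, u₀ 0) := by
    have c1 : ContDiff ℝ 1 fun x : ℝ × PSeries × PSeries × PSeries => x.2.1 := by fun_prop
    have c2 : ContDiff ℝ 1 fun x : ℝ × PSeries × PSeries × PSeries => x.2.2.1 := by fun_prop
    have c3 : ContDiff ℝ 1 fun x : ℝ × PSeries × PSeries × PSeries => x.2.2.2 := by fun_prop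
    have d1 : ContDiffAt ℝ 1 (fun x => G₁ (dev x)) ((0 : ℝ), u₀ 0) :=
      ContDiffAt.comp _ (by rw [hdev0]; exact hG₁) hdev.contDiffAt
    have d2 : ContDiffAt ℝ 1 (fun x => G₂ (dev x)) ((0 : ℝ), u₀ 0) :=
      ContDiffAt.comp _ (by rw [hdev0]; exact hG₂) hdev.contDiffAt
    have dW : ContDiffAt ℝ 1 W ((0 : ℝ), u₀ 0) := by
      obtain ⟨v, hv⟩ := hunit
      have hi : ContDiffAt ℝ 1 Ring.inverse (r₀ • (1 : PSeries) + (0 : ℝ) • varY) := by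
        rw [← hv]; exact contDiffAt_ringInverse ℝ v
      have hl : ContDiffAt ℝ 1 (fun x : ℝ × PSeries × PSeries × PSeries => r₀ • (1 : PSeries) + x.1 • varY)
        ((0 : ℝ), u₀ 0) := by fun_prop
      exact ContDiffAt.comp ((0 : ℝ), u₀ 0) hi hl
    have hB : ∀ {f g : ℝ × PSeries × PSeries × PSeries → PSeries}, ContDiffAt ℝ 1 f ((0 : ℝ), u₀ 0) →
        ContDiffAt ℝ 1 g ((0 : ℝ), u₀ 0) →
        ContDiffAt ℝ 1 (fun x => intMulDeriv (f x) (g x)) ((0 : ℝ), u₀ 0) := fun hf hg =>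
      (contDiffAt_const.clm_apply hf).clm_apply hg
    have c0 : ContDiffAt ℝ 1 (fun x : ℝ × PSeries × PSeries × PSeries => ((n : ℝ) - 1) * x.1) ((0 : ℝ), u₀ 0) := by fun_prop
    have c1' := c1.contDiffAt (x := ((0 : ℝ), u₀ 0))
    have c2' := c2.contDiffAt (x := ((0 : ℝ), u₀ 0))
    have c3' := c3.contDiffAt (x := ((0 : ℝ), u₀ 0))
    refine ContDiffAt.prodMk ?_ (ContDiffAt.prodMk ?_ ?_)
    · exact (((hB c1' c1').add (hB d1 c2')).add (hB d2 c3')).neg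
    · exact (((hB c1' c2').add (hB c2' c1')).add
        (c0.smul (hB ((dW.mul c1').mul c2') contDiffAt_const))).neg
    · exact (hB c1' c3').neg
  -- These properties must still hold at the fixed point: r₀ + ε y is invertible, and the lifted
  -- coefficients evaluate to p_ρ/ρ and p_S/ρ.
  have hN : {x : ℝ × PSeries × PSeries × PSeries | IsUnit (r₀ • (1 : PSeries) + x.1 • varY)} ∩
      ({x | ∀ z ∈ Metric.ball (0 : ℝ × ℝ) (1 / 2), eval z (G₁ (dev x)) =
        pRho p (ρ₀ + eval z (dev x).1) (S₀ + eval z (dev x).2) / (ρ₀ + eval z (dev x).1)} ∩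
      {x | ∀ z ∈ Metric.ball (0 : ℝ × ℝ) (1 / 2), eval z (G₂ (dev x)) =
        pS p (ρ₀ + eval z (dev x).1) (S₀ + eval z (dev x).2) / (ρ₀ + eval z (dev x).1)}) ∈
      𝓝 ((0 : ℝ), u₀ 0) := by
    have hd : Filter.Tendsto dev (𝓝 ((0 : ℝ), u₀ 0)) (𝓝 0) := by
      have := hdev.continuous.tendsto ((0 : ℝ), u₀ 0)
      rwa [hdev0] at this
    exact Filter.inter_mem ((Units.isOpen.preimage hlin).mem_nhds hunit)
      (Filter.inter_mem (hd.eventually hG₁e) (hd.eventually hG₂e))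
  obtain ⟨ε, hε, ⟨u, v, w⟩, ⟨hinv, hG₁u, hG₂u⟩, hfix⟩ := exists_eq_add_smul hu hK hN
  have hε' : ε ≠ 0 := hε.ne'
  have hfu := congrArg Prod.fst hfix
  have hfv := congrArg (fun x => x.2.1) hfix
  have hfw := congrArg (fun x => x.2.2) hfix
  simp only [u₀, K, Prod.smul_mk, Prod.mk_add_mk] at hfu hfv hfw
  set W₁ : PSeries := Ring.inverse (r₀ • 1 + ε • varY) with hW₁
  have hWinv : (r₀ • 1 + ε • varY) * W₁ = 1 := Ring.mul_inverse_cancel _ hinv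
  have hdensity : ContinuousOn (fun z : ℝ × ℝ =>
      (field t₀ r₀ ε v z.1 z.2, field t₀ r₀ ε w z.1 z.2)) (fieldDomain t₀ r₀ ε) :=
    (contDiffOn_field t₀ r₀ ε v).continuousOn.prodMk (contDiffOn_field t₀ r₀ ε w).continuousOn
  set G : Set (ℝ × ℝ) := (fieldDomain t₀ r₀ ε ∩ (fun z : ℝ × ℝ =>
    (field t₀ r₀ ε v z.1 z.2, field t₀ r₀ ε w z.1 z.2)) ⁻¹' (R ×ˢ Q)) ∩ {z | 0 < z.2} with hG
  have hGsub : G ⊆ fieldDomain t₀ r₀ ε := fun z hz => hz.1.1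
  have hinit : ∀ r, (t₀, r) ∈ fieldDomain t₀ r₀ ε →
      field t₀ r₀ ε u t₀ r = U₀ + U₁ * (r - r₀) + U₂ / 2 * (r - r₀) ^ 2 ∧
        field t₀ r₀ ε v t₀ r = ρ₀ + ρ₁ * (r - r₀) + ρ₂ / 2 * (r - r₀) ^ 2 ∧
        field t₀ r₀ ε w t₀ r = S₀ + S₁ * (r - r₀) + S₂ / 2 * (r - r₀) ^ 2 := by
    intro r hr
    have hr' : ((0 : ℝ), (r - r₀) / ε) ∈ Metric.ball (0 : ℝ × ℝ) (1 / 2) := by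
      have : ((t₀ - t₀) / ε ^ 2, (r - r₀) / ε) ∈ Metric.ball (0 : ℝ × ℝ) (1 / 2) := hr
      rwa [sub_self, zero_div] at this
    have hc : ε * ((r - r₀) / ε) = r - r₀ := by field_simp
    unfold field
    rw [sub_self, zero_div]
    refine ⟨?_, ?_, ?_⟩
    · rw [hfu]
      simp only [map_add, map_neg, map_smul, eval_quad hr', eval_intMulDeriv_zero hr', hc]
      simp
    · rw [hfv]
      simp only [map_add, map_neg, map_smul, eval_quad hr', eval_intMulDeriv_zero hr', hc]
      simp
    · rw [hfw]
      simp only [map_add, map_neg, map_smul, eval_quad hr', eval_intMulDeriv_zero hr', hc]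
      simp
  have hmem : (t₀, r₀) ∈ fieldDomain t₀ r₀ ε := by simp [fieldDomain]
  refine ⟨G, field t₀ r₀ ε u, field t₀ r₀ ε v, field t₀ r₀ ε w, ?_, ?_, fun r hr =>
    hinit r (hGsub hr)⟩
  swap
  · obtain ⟨-, h2, h3⟩ := hinit r₀ hmem
    refine ⟨⟨hmem, ?_⟩, hr₀⟩
    simp only [mem_preimage, h2, h3]
    simpa using hz₀
  -- Applying ∂_τ to the fixed-point equation undoes the integrations and leaves the rescaled Euler
  -- equations.
  have key : ∀ t r, (t, r) ∈ G →
      ∃ z ∈ Metric.ball (0 : ℝ × ℝ) (1 / 2), z = ((t - t₀) / ε ^ 2, (r - r₀) / ε) ∧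
        evalDeriv z (1, 0) u = -ε * (eval z u * evalDeriv z (0, 1) u
          + pRho p (eval z v) (eval z w) / eval z v * evalDeriv z (0, 1) v
          + pS p (eval z v) (eval z w) / eval z v * evalDeriv z (0, 1) w) ∧
        evalDeriv z (1, 0) v = -ε * (eval z u * evalDeriv z (0, 1) v
          + eval z v * evalDeriv z (0, 1) u + ((n : ℝ) - 1) * ε * (eval z u * eval z v / r)) ∧
        evalDeriv z (1, 0) w = -ε * (eval z u * evalDeriv z (0, 1) w) := by
    intro t r htr
    refine ⟨((t - t₀) / ε ^ 2, (r - r₀) / ε), hGsub htr, rfl, ?_⟩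
    have hz : ((t - t₀) / ε ^ 2, (r - r₀) / ε) ∈ Metric.ball (0 : ℝ × ℝ) (1 / 2) := hGsub htr
    have h1 := hG₁u _ hz
    have h2 := hG₂u _ hz
    simp only [dev, map_sub, map_smul, eval_one hz, smul_eq_mul, mul_one,
      add_sub_cancel] at h1 h2
    have hr : (0 : ℝ) < r := htr.2
    have h3 := congrArg (eval ((t - t₀) / ε ^ 2, (r - r₀) / ε)) hWinv
    simp only [eval_mul hz, map_add, map_smul, eval_one hz, eval_varY hz, smul_eq_mul] at h3
    rw [mul_one, mul_div_cancel₀ _ hε', add_sub_cancel] at h3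
    have h4 : eval ((t - t₀) / ε ^ 2, (r - r₀) / ε) W₁ = 1 / r := by
      field_simp; linarith
    refine ⟨?_, ?_, ?_⟩
    · have := congrArg (evalDeriv ((t - t₀) / ε ^ 2, (r - r₀) / ε) (1, 0)) hfu
      simp only [map_add, map_neg, map_smul, evalDeriv_quad hz, evalDeriv_intMulDeriv hz,
        smul_eq_mul, dev, h1, h2] at this
      rw [this]; ring
    · have := congrArg (evalDeriv ((t - t₀) / ε ^ 2, (r - r₀) / ε) (1, 0)) hfv
      simp only [map_add, map_neg, map_smul, evalDeriv_quad hz, evalDeriv_intMulDeriv hz,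
        smul_eq_mul, W, ← hW₁, eval_mul hz, evalDeriv_snd_varY hz, h4] at this
      rw [this]; ring
    · have := congrArg (evalDeriv ((t - t₀) / ε ^ 2, (r - r₀) / ε) (1, 0)) hfw
      simp only [map_add, map_neg, map_smul, evalDeriv_quad hz, evalDeriv_intMulDeriv hz,
        smul_eq_mul] at this
      rw [this]; ring
  have hpos : ∀ t r, (t, r) ∈ G → field t₀ r₀ ε v t r ≠ 0 := fun t r htr =>
    (hp.density_pos _ htr.1.2.1).ne'
  refine
    { isOpen := (hdensity.isOpen_inter_preimage (isOpen_fieldDomain t₀ r₀ ε) hp.isOpen_prod).inter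
        (isOpen_lt continuous_const continuous_snd)
      radius_pos := fun z hz => hz.2
      contDiffOn_velocity := (contDiffOn_field t₀ r₀ ε u).mono hGsub
      contDiffOn_density := (contDiffOn_field t₀ r₀ ε v).mono hGsub
      contDiffOn_entropy := (contDiffOn_field t₀ r₀ ε w).mono hGsub
      density_mem := fun t r htr => htr.1.2.1
      entropy_mem := fun t r htr => htr.1.2.2
      velocity_eqn := fun t r htr => ?_
      density_eqn := fun t r htr => ?_
      entropy_eqn := fun t r htr => ?_ }
  · obtain ⟨z, hz, hzeq, k1, k2, k3⟩ := key t r htr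
    have hv := hpos t r htr
    have hd := hGsub htr
    rw [(hasDerivAt_field_time hd u).deriv, (hasDerivAt_field_radius hd u).deriv,
      (hasDerivAt_field_radius hd v).deriv, (hasDerivAt_field_radius hd w).deriv]
    unfold field at hv ⊢
    rw [← hzeq] at hv ⊢
    rw [k1]
    field_simp
    ring
  · obtain ⟨z, hz, hzeq, k1, k2, k3⟩ := key t r htr
    have hd := hGsub htr
    have hr : r ≠ 0 := ne_of_gt htr.2
    rw [(hasDerivAt_field_time hd v).deriv,
      ((hasDerivAt_field_radius hd u).fun_mul (hasDerivAt_field_radius hd v)).deriv]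
    unfold field
    rw [← hzeq, k2]
    field_simp
    ring
  · obtain ⟨z, hz, hzeq, k1, k2, k3⟩ := key t r htr
    have hd := hGsub htr
    rw [(hasDerivAt_field_time hd w).deriv, (hasDerivAt_field_radius hd w).deriv]
    unfold field
    rw [← hzeq, k3]
    field_simp
    ring

/-! ### Integrals with parameters and Reynolds' transport theorem -/

section ParametricIntegral

variable {H : Type*} [NormedAddCommGroup H] [NormedSpace ℝ H]

/-- The segment `{x} × [0, 1]` lies in the open set `W`, as do its translates, with a uniform bound
on the derivative of a `C¹` function. -/
theorem exists_nhds_segment_bound {F : H × ℝ → ℝ} {W : Set (H × ℝ)} (hW : IsOpen W)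
    (hF : ContDiffOn ℝ 1 F W) {x₀ : H} (hx₀ : ∀ y ∈ Icc (0 : ℝ) 1, (x₀, y) ∈ W) :
    ∃ u ∈ 𝓝 x₀, ∃ C : ℝ, ∀ x ∈ u, ∀ y ∈ Icc (0 : ℝ) 1, (x, y) ∈ W ∧ ‖fderiv ℝ F (x, y)‖ ≤ C := by
  have hc : ContinuousOn (fderiv ℝ F) W := hF.continuousOn_fderiv_of_isOpen hW le_rfl
  have hmap : MapsTo (fun y : ℝ => (x₀, y)) (Icc 0 1) W := hx₀
  have hb : BddAbove ((fun y => ‖fderiv ℝ F (x₀, y)‖) '' Icc (0 : ℝ) 1) :=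
    (isCompact_Icc.image_of_continuousOn
      ((hc.comp (by fun_prop : ContinuousOn (fun y : ℝ => (x₀, y)) (Icc 0 1)) hmap).norm)).bddAbove
  obtain ⟨C, hC⟩ := hb
  have hopen : IsOpen (W ∩ (fun z => ‖fderiv ℝ F z‖) ⁻¹' Iio (C + 1)) :=
    hc.norm.isOpen_inter_preimage hW isOpen_Iio
  obtain ⟨u, v, hu, -, hxu, hv, huv⟩ := generalized_tube_lemma (isCompact_singleton (x := x₀))
    (isCompact_Icc (a := (0 : ℝ)) (b := 1)) hopen (by
      rintro ⟨x, y⟩ ⟨hx, hy⟩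
      obtain rfl : x = x₀ := hx
      exact ⟨hx₀ y hy, (hC ⟨y, hy, rfl⟩).trans_lt (lt_add_one C)⟩)
  refine ⟨u, hu.mem_nhds (hxu rfl), C + 1, fun x hx y hy => ?_⟩
  have := huv (mk_mem_prod hx (hv hy))
  exact ⟨this.1, le_of_lt this.2⟩

/-- Compactness of [0, 1] bounds the derivative near x₀ by a constant, which serves as the
dominating function. -/
theorem hasFDerivAt_integral_segment {F : H × ℝ → ℝ} {W : Set (H × ℝ)} (hW : IsOpen W)
    (hF : ContDiffOn ℝ 1 F W) {x₀ : H} (hx₀ : ∀ y ∈ Icc (0 : ℝ) 1, (x₀, y) ∈ W) :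
    IntervalIntegrable
      (fun y => (fderiv ℝ F (x₀, y)).comp (ContinuousLinearMap.inl ℝ H ℝ)) MeasureTheory.volume 0 1 ∧
    HasFDerivAt (fun x => ∫ y in (0 : ℝ)..1, F (x, y))
      (∫ y in (0 : ℝ)..1, (fderiv ℝ F (x₀, y)).comp (ContinuousLinearMap.inl ℝ H ℝ)) x₀ := by
  obtain ⟨u, hu, C, hC⟩ := exists_nhds_segment_bound hW hF hx₀
  have hI : uIoc (0 : ℝ) 1 ⊆ Icc 0 1 := by
    rw [uIoc_of_le zero_le_one]; exact Ioc_subset_Icc_self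
  have hIc : uIcc (0 : ℝ) 1 = Icc 0 1 := uIcc_of_le zero_le_one
  have hcF : ∀ x ∈ u, ContinuousOn (fun y => F (x, y)) (Icc 0 1) := fun x hx =>
    hF.continuousOn.comp (by fun_prop) (fun y hy => (hC x hx y hy).1)
  have hcD : ∀ x ∈ u, ContinuousOn
      (fun y => (fderiv ℝ F (x, y)).comp (ContinuousLinearMap.inl ℝ H ℝ)) (Icc 0 1) := fun x hx =>
    ((hF.continuousOn_fderiv_of_isOpen hW le_rfl).comp (by fun_prop)
      (fun y hy => (hC x hx y hy).1)).clm_comp continuousOn_const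
  refine ⟨ContinuousOn.intervalIntegrable (hIc ▸ hcD x₀ (mem_of_mem_nhds hu)), ?_⟩
  refine intervalIntegral.hasFDerivAt_integral_of_dominated_of_fderiv_le (bound := fun _ => C)
    (F' := fun x y => (fderiv ℝ F (x, y)).comp (ContinuousLinearMap.inl ℝ H ℝ)) hu ?_ ?_ ?_ ?_ ?_ ?_
  · filter_upwards [hu] with x hx
    exact ((hcF x hx).mono hI).aestronglyMeasurable measurableSet_uIoc
  · exact ContinuousOn.intervalIntegrable (hIc ▸ hcF x₀ (mem_of_mem_nhds hu))
  · exact ((hcD x₀ (mem_of_mem_nhds hu)).mono hI).aestronglyMeasurable measurableSet_uIoc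
  · refine Filter.Eventually.of_forall fun y hy x hx => ?_
    refine (ContinuousLinearMap.opNorm_comp_le _ _).trans ?_
    have h1 := (hC x hx y (hI hy)).2
    have h2 := ContinuousLinearMap.norm_inl_le_one ℝ H ℝ
    have h3 := mul_le_mul h1 h2 (norm_nonneg _) ((norm_nonneg _).trans h1)
    rwa [mul_one] at h3
  · exact intervalIntegrable_const
  · refine Filter.Eventually.of_forall fun y hy x hx => ?_
    have h1 : HasFDerivAt F (fderiv ℝ F (x, y)) (x, y) :=
      (((hF _ (hC x hx y (hI hy)).1).contDiffAt
        (hW.mem_nhds (hC x hx y (hI hy)).1)).differentiableAt one_ne_zero).hasFDerivAt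
    exact h1.comp x (hasFDerivAt_prodMk_left x y)

theorem contDiffAt_integral_segment {F : H × ℝ → ℝ} {W : Set (H × ℝ)} (hW : IsOpen W)
    (hF : ContDiffOn ℝ 1 F W) {x₀ : H} (hx₀ : ∀ y ∈ Icc (0 : ℝ) 1, (x₀, y) ∈ W) :
    ContDiffAt ℝ 1 (fun x => ∫ y in (0 : ℝ)..1, F (x, y)) x₀ := by
  have hI : uIoc (0 : ℝ) 1 ⊆ Icc 0 1 := by
    rw [uIoc_of_le zero_le_one]; exact Ioc_subset_Icc_self
  obtain ⟨u, hu, C₀, hC⟩ := exists_nhds_segment_bound hW hF hx₀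
  refine contDiffAt_one_iff.2 ⟨fun x => ∫ y in (0 : ℝ)..1,
    (fderiv ℝ F (x, y)).comp (ContinuousLinearMap.inl ℝ H ℝ), u, hu, ?_, fun x hx =>
    (hasFDerivAt_integral_segment hW hF fun y hy => (hC x hx y hy).1).2⟩
  intro x hx
  refine ContinuousAt.continuousWithinAt ?_
  have hx' : ∀ y ∈ Icc (0 : ℝ) 1, (x, y) ∈ W := fun y hy => (hC x hx y hy).1
  obtain ⟨v, hv, C, hC'⟩ := exists_nhds_segment_bound hW hF hx'
  have hcont := hF.continuousOn_fderiv_of_isOpen hW le_rfl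
  refine intervalIntegral.continuousAt_of_dominated_interval (bound := fun _ => C) ?_ ?_ ?_ ?_
  · filter_upwards [hv] with x' hx'
    have : ContinuousOn
        (fun y => (fderiv ℝ F (x', y)).comp (ContinuousLinearMap.inl ℝ H ℝ)) (Icc 0 1) :=
      (hcont.comp (by fun_prop) (fun y hy => (hC' x' hx' y hy).1)).clm_comp continuousOn_const
    exact (this.mono hI).aestronglyMeasurable measurableSet_uIoc
  · filter_upwards [hv] with x' hx'
    refine Filter.Eventually.of_forall fun y hy => ?_
    refine (ContinuousLinearMap.opNorm_comp_le _ _).trans ?_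
    have h1 := (hC' x' hx' y (hI hy)).2
    have h2 := ContinuousLinearMap.norm_inl_le_one ℝ H ℝ
    have h3 := mul_le_mul h1 h2 (norm_nonneg _) ((norm_nonneg _).trans h1)
    rwa [mul_one] at h3
  · exact intervalIntegrable_const
  · refine Filter.Eventually.of_forall fun y hy => ?_
    have h1 : ContinuousAt (fderiv ℝ F) (x, y) :=
      hcont.continuousAt (hW.mem_nhds (hx' y (hI hy)))
    have h2 : ContinuousAt (fun x : H => (x, y)) x := by fun_prop
    exact (ContinuousAt.comp (f := fun x : H => (x, y)) h1 h2).clm_comp continuousAt_const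

end ParametricIntegral

/-- a' = U(t, a(t)) is continuous, so a differentiable end point is automatically C¹, as the change
of variables in the transport theorem requires. -/
theorem IsTransportedDomain.contDiffOn_left {G : Set (ℝ × ℝ)} {U : ℝ → ℝ → ℝ} {t₁ t₂ : ℝ}
    {a b : ℝ → ℝ} (hV : IsTransportedDomain G U t₁ t₂ a b)
    (hU : ContinuousOn (fun z : ℝ × ℝ => U z.1 z.2) G) : ContDiffOn ℝ 1 a (Ioo t₁ t₂) := by
  have hd : ∀ t ∈ Ioo t₁ t₂, HasDerivAt a (U t (a t)) t := fun t ht => (hV t ht).2.1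
  have h := (contDiffOn_succ_iff_deriv_of_isOpen (𝕜 := ℝ) (n := 0) (f := a)
    (isOpen_Ioo (a := t₁) (b := t₂))).2
  refine h ⟨fun t ht => (hd t ht).differentiableAt.differentiableWithinAt, by simp, ?_⟩
  rw [contDiffOn_zero]
  refine ContinuousOn.congr (f := fun t => U t (a t)) ?_ fun t ht => (hd t ht).deriv
  refine hU.comp (f := fun t => (t, a t)) ?_ fun t ht =>
    (hV t ht).2.2.2 _ (left_mem_Icc.2 (hV t ht).1.le)
  exact continuousOn_id.prodMk fun t ht => (hd t ht).continuousAt.continuousWithinAt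

theorem IsTransportedDomain.contDiffOn_right {G : Set (ℝ × ℝ)} {U : ℝ → ℝ → ℝ} {t₁ t₂ : ℝ}
    {a b : ℝ → ℝ} (hV : IsTransportedDomain G U t₁ t₂ a b)
    (hU : ContinuousOn (fun z : ℝ × ℝ => U z.1 z.2) G) : ContDiffOn ℝ 1 b (Ioo t₁ t₂) := by
  have hd : ∀ t ∈ Ioo t₁ t₂, HasDerivAt b (U t (b t)) t := fun t ht => (hV t ht).2.2.1
  have h := (contDiffOn_succ_iff_deriv_of_isOpen (𝕜 := ℝ) (n := 0) (f := b)
    (isOpen_Ioo (a := t₁) (b := t₂))).2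
  refine h ⟨fun t ht => (hd t ht).differentiableAt.differentiableWithinAt, by simp, ?_⟩
  rw [contDiffOn_zero]
  refine ContinuousOn.congr (f := fun t => U t (b t)) ?_ fun t ht => (hd t ht).deriv
  refine hU.comp (f := fun t => (t, b t)) ?_ fun t ht =>
    (hV t ht).2.2.2 _ (right_mem_Icc.2 (hV t ht).1.le)
  exact continuousOn_id.prodMk fun t ht => (hd t ht).continuousAt.continuousWithinAt

/-- Reynolds' transport theorem on transported radial domains. -/
theorem hasDerivAt_integral_transported {G : Set (ℝ × ℝ)} (hG : IsOpen G) {U : ℝ → ℝ → ℝ}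
    (hU : ContDiffOn ℝ 1 (fun z : ℝ × ℝ => U z.1 z.2) G) {g : ℝ × ℝ → ℝ} (hg : ContDiffOn ℝ 1 g G)
    {t₁ t₂ : ℝ} {a b : ℝ → ℝ} (hV : IsTransportedDomain G U t₁ t₂ a b) {t : ℝ}
    (ht : t ∈ Ioo t₁ t₂) :
    HasDerivAt (fun τ => ∫ r in (a τ)..(b τ), g (τ, r))
      (∫ r in (a t)..(b t), (fderiv ℝ g (t, r) (1, U t r) +
        g (t, r) * fderiv ℝ (fun z : ℝ × ℝ => U z.1 z.2) (t, r) (0, 1))) t := by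
  set u : ℝ × ℝ → ℝ := fun z => U z.1 z.2 with hu
  have ha := hV.contDiffOn_left hU.continuousOn
  have hb := hV.contDiffOn_right hU.continuousOn
  let T : Set (ℝ × ℝ) := {z | z.1 ∈ Ioo t₁ t₂}
  have hT : IsOpen T := isOpen_Ioo.preimage continuous_fst
  have haT : ContDiffOn ℝ 1 (fun z : ℝ × ℝ => a z.1) T :=
    ha.comp contDiff_fst.contDiffOn fun z hz => hz
  have hbT : ContDiffOn ℝ 1 (fun z : ℝ × ℝ => b z.1) T :=
    hb.comp contDiff_fst.contDiffOn fun z hz => hz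
  -- The affine map of [0, 1] onto [a, b] makes the domain of integration independent of time.
  let ψ : ℝ × ℝ → ℝ × ℝ := fun z => (z.1, a z.1 + (b z.1 - a z.1) * z.2)
  have hψ : ContDiffOn ℝ 1 ψ T :=
    contDiff_fst.contDiffOn.prodMk (haT.add ((hbT.sub haT).mul contDiff_snd.contDiffOn))
  have hW : IsOpen (T ∩ ψ ⁻¹' G) := hψ.continuousOn.isOpen_inter_preimage hT hG
  let F : ℝ × ℝ → ℝ := fun z => g (ψ z) * (b z.1 - a z.1)
  have hF : ContDiffOn ℝ 1 F (T ∩ ψ ⁻¹' G) :=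
    (hg.comp (hψ.mono inter_subset_left) fun z hz => hz.2).mul
      ((hbT.sub haT).mono inter_subset_left)
  have hmemIcc : ∀ τ ∈ Ioo t₁ t₂, ∀ y ∈ Icc (0 : ℝ) 1,
      a τ + (b τ - a τ) * y ∈ Icc (a τ) (b τ) := by
    intro τ hτ y hy
    have h1 := (hV τ hτ).1
    constructor
    · nlinarith [hy.1]
    · nlinarith [hy.2]
  have hmem : ∀ τ ∈ Ioo t₁ t₂, ∀ y ∈ Icc (0 : ℝ) 1, (τ, y) ∈ T ∩ ψ ⁻¹' G := fun τ hτ y hy =>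
    ⟨hτ, (hV τ hτ).2.2.2 _ (hmemIcc τ hτ y hy)⟩
  obtain ⟨hint, hder⟩ := hasFDerivAt_integral_segment hW hF (hmem t ht)
  have hder' := hder.hasDerivAt
  rw [ContinuousLinearMap.intervalIntegral_apply hint] at hder'
  have hsub : ∀ τ, ∫ r in (a τ)..(b τ), g (τ, r) = ∫ y in (0 : ℝ)..1, F (τ, y) := by
    intro τ
    have := intervalIntegral.mul_integral_comp_add_mul (a := 0) (b := 1)
      (f := fun r => g (τ, r)) (b τ - a τ) (a τ)
    rw [mul_zero, add_zero, mul_one, add_sub_cancel] at this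
    rw [← this, ← intervalIntegral.integral_const_mul]
    exact intervalIntegral.integral_congr fun y _ => mul_comm _ _
  have hfun : (fun τ => ∫ r in (a τ)..(b τ), g (τ, r)) = fun τ => ∫ y in (0 : ℝ)..1, F (τ, y) :=
    funext hsub
  rw [hfun]
  refine hder'.congr_deriv ?_
  set k : ℝ × ℝ → ℝ := fun z => fderiv ℝ g z (1, u z) + g z * fderiv ℝ u z (0, 1) with hk
  have hgf : ∀ z ∈ G, HasFDerivAt g (fderiv ℝ g z) z := fun z hz =>
    (((hg z hz).contDiffAt (hG.mem_nhds hz)).differentiableAt one_ne_zero).hasFDerivAt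
  have huf : ∀ z ∈ G, HasFDerivAt u (fderiv ℝ u z) z := fun z hz =>
    (((hU z hz).contDiffAt (hG.mem_nhds hz)).differentiableAt one_ne_zero).hasFDerivAt
  have hkc : ContinuousOn k G :=
    ((hg.continuousOn_fderiv_of_isOpen hG le_rfl).clm_apply
      (continuousOn_const.prodMk hU.continuousOn)).add
      (hg.continuousOn.mul ((hU.continuousOn_fderiv_of_isOpen hG le_rfl).clm_apply
        continuousOn_const))
  set α := U t (a t) with hα
  set β := U t (b t) with hβ
  have hda : HasDerivAt a α t := (hV t ht).2.1
  have hdb : HasDerivAt b β t := (hV t ht).2.2.1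
  -- The flux of g relative to the moving frame, whose points have velocity α + (β - α) y. Its
  -- y-derivative is the difference between the integrand found under the integral sign and the
  -- claimed one, and it vanishes at y = 0 and y = 1 because the end points move with the flow.
  let q : ℝ → ℝ := fun y => g (ψ (t, y)) * (α + (β - α) * y - u (ψ (t, y)))
  have hψy : ∀ y, HasDerivAt (fun y => ψ (t, y)) (0, b t - a t) y := fun y =>
    (hasDerivAt_const y t).prodMk (by
      simpa using (((hasDerivAt_id y).const_mul (b t - a t)).const_add (a t)))
  have hψt : ∀ y, HasDerivAt (fun τ => ψ (τ, y)) (1, α + (β - α) * y) t := fun y =>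
    (hasDerivAt_id t).prodMk (hda.add ((hdb.sub hda).mul_const y))
  have hG1 : ∀ y ∈ Icc (0 : ℝ) 1, ψ (t, y) ∈ G := fun y hy => (hmem t ht y hy).2
  have hq : ∀ y ∈ uIcc (0 : ℝ) 1, HasDerivAt q
      ((fderiv ℝ F (t, y)).comp (ContinuousLinearMap.inl ℝ ℝ ℝ) 1
        - k (ψ (t, y)) * (b t - a t)) y := by
    intro y hy
    rw [uIcc_of_le zero_le_one] at hy
    have hFd : HasDerivAt (fun τ => F (τ, y)) (fderiv ℝ F (t, y) (1, 0)) t := by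
      have h1 : HasFDerivAt F (fderiv ℝ F (t, y)) (t, y) :=
        (((hF _ (hmem t ht y hy)).contDiffAt (hW.mem_nhds (hmem t ht y hy))).differentiableAt
          one_ne_zero).hasFDerivAt
      exact h1.comp_hasDerivAt t ((hasDerivAt_id t).prodMk (hasDerivAt_const t y))
    have hFd' : HasDerivAt (fun τ => F (τ, y))
        (fderiv ℝ g (ψ (t, y)) (1, α + (β - α) * y) * (b t - a t) + g (ψ (t, y)) * (β - α)) t :=
      ((hgf _ (hG1 y hy)).comp_hasDerivAt t (hψt y)).mul (hdb.sub hda)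
    have hval := hFd.unique hFd'
    have hqd := ((hgf _ (hG1 y hy)).comp_hasDerivAt y (hψy y)).mul
      (((((hasDerivAt_id y).const_mul (β - α)).const_add α)).sub
        ((huf _ (hG1 y hy)).comp_hasDerivAt y (hψy y)))
    refine hqd.congr_deriv ?_
    have hl : ∀ (L : ℝ × ℝ →L[ℝ] ℝ) (c d : ℝ), L (c, d) = c * L (1, 0) + d * L (0, 1) := by
      intro L c d
      rw [← smul_eq_mul, ← smul_eq_mul, ← map_smul, ← map_smul, ← map_add]
      simp
    simp only [ContinuousLinearMap.comp_apply, ContinuousLinearMap.inl_apply, hval, hk,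
      Function.comp_apply]
    rw [hl _ 0 (b t - a t), hl _ 0 (b t - a t), hl _ 1 (α + (β - α) * y), hl _ 1 (u _)]
    simp only [id, Pi.sub_apply, Function.comp_apply]
    ring
  have hcD : ContinuousOn (fun y => (fderiv ℝ F (t, y)).comp (ContinuousLinearMap.inl ℝ ℝ ℝ) 1)
      (uIcc 0 1) := by
    rw [uIcc_of_le zero_le_one]
    have h1 := (hF.continuousOn_fderiv_of_isOpen hW le_rfl).comp
      (by fun_prop : ContinuousOn (fun y : ℝ => (t, y)) (Icc 0 1)) (fun y hy => hmem t ht y hy)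
    exact h1.clm_apply continuousOn_const
  have hck : ContinuousOn (fun y => k (ψ (t, y)) * (b t - a t)) (uIcc 0 1) := by
    rw [uIcc_of_le zero_le_one]
    exact (hkc.comp (fun y _ => (hψy y).continuousAt.continuousWithinAt) hG1).mul continuousOn_const
  have hfin := intervalIntegral.integral_eq_sub_of_hasDerivAt hq (hcD.sub hck).intervalIntegrable
  rw [intervalIntegral.integral_sub hcD.intervalIntegrable hck.intervalIntegrable] at hfin
  have hq0 : q 0 = 0 := by simp [q, ψ, hu, hα]
  have hq1 : q 1 = 0 := by simp [q, ψ, hu, hβ]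
  rw [hq0, hq1, sub_zero, sub_eq_zero] at hfin
  rw [hfin]
  have := intervalIntegral.mul_integral_comp_add_mul (a := 0) (b := 1)
    (f := fun r => k (t, r)) (b t - a t) (a t)
  rw [mul_zero, add_zero, mul_one, add_sub_cancel] at this
  rw [intervalIntegral.integral_mul_const, mul_comm]
  exact this

/-! ### Motion of jets along particle paths -/

theorem hasDerivAt_comp_mk_left {f : ℝ × ℝ → ℝ} {f' : ℝ × ℝ →L[ℝ] ℝ} {t r : ℝ}
    (hf : HasFDerivAt f f' (t, r)) : HasDerivAt (fun τ => f (τ, r)) (f' (1, 0)) t :=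
  hf.comp_hasDerivAt t ((hasDerivAt_id t).prodMk (hasDerivAt_const t r))

theorem hasDerivAt_comp_mk_right {f : ℝ × ℝ → ℝ} {f' : ℝ × ℝ →L[ℝ] ℝ} {t r : ℝ}
    (hf : HasFDerivAt f f' (t, r)) : HasDerivAt (fun y => f (t, y)) (f' (0, 1)) r :=
  hf.comp_hasDerivAt r ((hasDerivAt_const r t).prodMk (hasDerivAt_id r))

theorem clm_plane_apply (L : ℝ × ℝ →L[ℝ] ℝ) (c d : ℝ) : L (c, d) = c * L (1, 0) + d * L (0, 1) := by
  rw [← smul_eq_mul, ← smul_eq_mul, ← map_smul, ← map_smul, ← map_add]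
  simp

/-- The commutator of `∂_t + u ∂_r` and `∂_r`. -/
theorem fderiv_radial_advect {f u k : ℝ × ℝ → ℝ} {z : ℝ × ℝ} (hf : ContDiffAt ℝ 2 f z)
    (hu : DifferentiableAt ℝ u z) (hk : (fun w => fderiv ℝ f w (1, u w)) =ᶠ[𝓝 z] k) :
    fderiv ℝ (fun w => fderiv ℝ f w (0, 1)) z (1, u z) =
      fderiv ℝ k z (0, 1) - fderiv ℝ f z (0, 1) * fderiv ℝ u z (0, 1) := by
  have hd : HasFDerivAt (fderiv ℝ f) (fderiv ℝ (fderiv ℝ f) z) z :=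
    ((hf.fderiv_right (m := 1) (by norm_num)).differentiableAt one_ne_zero).hasFDerivAt
  have hs : IsSymmSndFDerivAt ℝ f z := hf.isSymmSndFDerivAt (by simp)
  have h1 : HasFDerivAt (fun w => fderiv ℝ f w (0, 1)) _ z :=
    hd.clm_apply (hasFDerivAt_const ((0 : ℝ), (1 : ℝ)) z)
  have h2 : HasFDerivAt (fun w => fderiv ℝ f w (1, u w)) _ z :=
    hd.clm_apply ((hasFDerivAt_const (1 : ℝ) z).prodMk hu.hasFDerivAt)
  rw [← hk.fderiv_eq, h1.fderiv, h2.fderiv]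
  simp only [ContinuousLinearMap.comp_zero, zero_add, ContinuousLinearMap.flip_apply,
    add_apply, ContinuousLinearMap.comp_apply, ContinuousLinearMap.prod_apply, zero_apply]
  rw [hs.eq (1, u z) (0, 1), clm_plane_apply (fderiv ℝ f z) 0]
  ring

/-- The velocity of the first-order jet of a radial flow along particle paths, in terms of the jet
`x` and the second radial derivatives `U₂, ρ₂, S₂`. -/
noncomputable def jetVelocity (n : ℕ) (p : ℝ → ℝ → ℝ) (x : Jet) (U₂ ρ₂ S₂ : ℝ) : Jet :=
  ![1, x.U, -pressureForce p x, -(x.ρ * (x.Ur + ((n : ℝ) - 1) * x.U / x.r)), 0,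
    -(fderiv ℝ (fun z : ℝ × ℝ => pS p z.1 z.2 / z.1) (x.ρ, x.S) (x.ρr, x.Sr) * x.Sr
      + fderiv ℝ (fun z : ℝ × ℝ => pRho p z.1 z.2 / z.1) (x.ρ, x.S) (x.ρr, x.Sr) * x.ρr
      + x.Ur ^ 2 + (pS p x.ρ x.S * S₂ + pRho p x.ρ x.S * ρ₂) / x.ρ),
    -(x.ρr * (2 * x.Ur + ((n : ℝ) - 1) * x.U / x.r)
      + x.ρ * (((n : ℝ) - 1) * (x.Ur / x.r - x.U / x.r ^ 2)) + x.ρ * U₂),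
    -(x.Ur * x.Sr)]

namespace IsRadialFlow

variable {n : ℕ} {R Q : Set ℝ} {p : ℝ → ℝ → ℝ} {G : Set (ℝ × ℝ)} {U ρ S : ℝ → ℝ → ℝ}

theorem hasFDerivAt_of_contDiffOn {f : ℝ × ℝ → ℝ} (hG : IsOpen G) (hf : ContDiffOn ℝ 2 f G)
    {z : ℝ × ℝ} (hz : z ∈ G) : HasFDerivAt f (fderiv ℝ f z) z :=
  (((hf z hz).contDiffAt (hG.mem_nhds hz)).differentiableAt two_ne_zero).hasFDerivAt

theorem contDiffOn_radial {f : ℝ × ℝ → ℝ} (hG : IsOpen G) (hf : ContDiffOn ℝ 2 f G) :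
    ContDiffOn ℝ 1 (fun z => fderiv ℝ f z (0, 1)) G :=
  (hf.fderiv_of_isOpen hG (by norm_num)).clm_apply contDiffOn_const

theorem advect_velocity (h : IsRadialFlow n R Q p G U ρ S) {z : ℝ × ℝ} (hz : z ∈ G) :
    fderiv ℝ (fun z : ℝ × ℝ => U z.1 z.2) z (1, U z.1 z.2) =
      -(pS p (ρ z.1 z.2) (S z.1 z.2) / ρ z.1 z.2 *
          fderiv ℝ (fun z : ℝ × ℝ => S z.1 z.2) z (0, 1)
        + pRho p (ρ z.1 z.2) (S z.1 z.2) / ρ z.1 z.2 *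
          fderiv ℝ (fun z : ℝ × ℝ => ρ z.1 z.2) z (0, 1)) := by
  obtain ⟨t, r⟩ := z
  have hU := hasFDerivAt_of_contDiffOn h.isOpen h.contDiffOn_velocity hz
  have hρ := hasFDerivAt_of_contDiffOn h.isOpen h.contDiffOn_density hz
  have hS := hasFDerivAt_of_contDiffOn h.isOpen h.contDiffOn_entropy hz
  have e := h.velocity_eqn t r hz
  rw [(hasDerivAt_comp_mk_left hU).deriv, (hasDerivAt_comp_mk_right hU).deriv,
    (hasDerivAt_comp_mk_right hρ).deriv, (hasDerivAt_comp_mk_right hS).deriv] at e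
  rw [clm_plane_apply]
  simp only
  linear_combination e

theorem advect_density (h : IsRadialFlow n R Q p G U ρ S) {z : ℝ × ℝ} (hz : z ∈ G) :
    fderiv ℝ (fun z : ℝ × ℝ => ρ z.1 z.2) z (1, U z.1 z.2) =
      -(ρ z.1 z.2 * (fderiv ℝ (fun z : ℝ × ℝ => U z.1 z.2) z (0, 1)
        + ((n : ℝ) - 1) * U z.1 z.2 / z.2)) := by
  obtain ⟨t, r⟩ := z
  have hU := hasFDerivAt_of_contDiffOn h.isOpen h.contDiffOn_velocity hz
  have hρ := hasFDerivAt_of_contDiffOn h.isOpen h.contDiffOn_density hz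
  have e := h.density_eqn t r hz
  rw [(hasDerivAt_comp_mk_left hρ).deriv,
    ((hasDerivAt_comp_mk_right hU).fun_mul (hasDerivAt_comp_mk_right hρ)).deriv] at e
  rw [clm_plane_apply]
  simp only at e ⊢
  linear_combination e

theorem advect_entropy (h : IsRadialFlow n R Q p G U ρ S) {z : ℝ × ℝ} (hz : z ∈ G) :
    fderiv ℝ (fun z : ℝ × ℝ => S z.1 z.2) z (1, U z.1 z.2) = 0 := by
  obtain ⟨t, r⟩ := z
  have hS := hasFDerivAt_of_contDiffOn h.isOpen h.contDiffOn_entropy hz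
  have e := h.entropy_eqn t r hz
  rw [(hasDerivAt_comp_mk_left hS).deriv, (hasDerivAt_comp_mk_right hS).deriv] at e
  rw [clm_plane_apply]
  simp only
  linear_combination e

theorem jetAt_eq (h : IsRadialFlow n R Q p G U ρ S) {z : ℝ × ℝ} (hz : z ∈ G) :
    jetAt U ρ S z.1 z.2 = ![z.1, z.2, U z.1 z.2, ρ z.1 z.2, S z.1 z.2,
      fderiv ℝ (fun z : ℝ × ℝ => U z.1 z.2) z (0, 1),
      fderiv ℝ (fun z : ℝ × ℝ => ρ z.1 z.2) z (0, 1),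
      fderiv ℝ (fun z : ℝ × ℝ => S z.1 z.2) z (0, 1)] := by
  obtain ⟨t, r⟩ := z
  have hU := hasFDerivAt_of_contDiffOn h.isOpen h.contDiffOn_velocity hz
  have hρ := hasFDerivAt_of_contDiffOn h.isOpen h.contDiffOn_density hz
  have hS := hasFDerivAt_of_contDiffOn h.isOpen h.contDiffOn_entropy hz
  rw [jetAt, (hasDerivAt_comp_mk_right hU).deriv, (hasDerivAt_comp_mk_right hρ).deriv,
    (hasDerivAt_comp_mk_right hS).deriv]

theorem contDiffOn_jet (h : IsRadialFlow n R Q p G U ρ S) :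
    ContDiffOn ℝ 1 (fun z : ℝ × ℝ => jetAt U ρ S z.1 z.2) G := by
  refine ContDiffOn.congr ?_ fun z hz => h.jetAt_eq hz
  have h12 : (1 : WithTop ℕ∞) ≤ 2 := by norm_num
  rw [contDiffOn_pi]
  intro i
  fin_cases i
  · exact contDiff_fst.contDiffOn
  · exact contDiff_snd.contDiffOn
  · exact h.contDiffOn_velocity.of_le h12
  · exact h.contDiffOn_density.of_le h12
  · exact h.contDiffOn_entropy.of_le h12
  · exact contDiffOn_radial h.isOpen h.contDiffOn_velocity
  · exact contDiffOn_radial h.isOpen h.contDiffOn_density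
  · exact contDiffOn_radial h.isOpen h.contDiffOn_entropy

/-- The components t, r are immediate and U, ρ, S are the Euler equations. The last three follow by
differentiating these equations radially and commuting ∂_r with ∂_t + U ∂_r
(`fderiv_radial_advect`), which is where second derivatives enter. -/
theorem fderiv_jet (hp : IsEquationOfState R Q p) (h : IsRadialFlow n R Q p G U ρ S) {z : ℝ × ℝ}
    (hz : z ∈ G) :
    fderiv ℝ (fun z : ℝ × ℝ => jetAt U ρ S z.1 z.2) z (1, U z.1 z.2) =
      jetVelocity n p (jetAt U ρ S z.1 z.2)
        (fderiv ℝ (fun w => fderiv ℝ (fun z : ℝ × ℝ => U z.1 z.2) w (0, 1)) z (0, 1))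
        (fderiv ℝ (fun w => fderiv ℝ (fun z : ℝ × ℝ => ρ z.1 z.2) w (0, 1)) z (0, 1))
        (fderiv ℝ (fun w => fderiv ℝ (fun z : ℝ × ℝ => S z.1 z.2) w (0, 1)) z (0, 1)) := by
  have hzG := h.isOpen.mem_nhds hz
  have hU := hasFDerivAt_of_contDiffOn h.isOpen h.contDiffOn_velocity hz
  have hρ := hasFDerivAt_of_contDiffOn h.isOpen h.contDiffOn_density hz
  have hS := hasFDerivAt_of_contDiffOn h.isOpen h.contDiffOn_entropy hz
  have dr : ∀ {f : ℝ × ℝ → ℝ}, ContDiffOn ℝ 2 f G →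
      HasFDerivAt (fun w => fderiv ℝ f w (0, 1)) (fderiv ℝ (fun w => fderiv ℝ f w (0, 1)) z) z :=
    fun hf => ((((contDiffOn_radial h.isOpen hf) z hz).contDiffAt hzG).differentiableAt
      one_ne_zero).hasFDerivAt
  have hUr := dr h.contDiffOn_velocity
  have hρr := dr h.contDiffOn_density
  have hSr := dr h.contDiffOn_entropy
  have hmem : (ρ z.1 z.2, S z.1 z.2) ∈ R ×ˢ Q := ⟨h.density_mem _ _ hz, h.entropy_mem _ _ hz⟩
  have hρ0 : ρ z.1 z.2 ≠ 0 := (hp.density_pos _ hmem.1).ne'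
  have hr0 : z.2 ≠ 0 := (h.radius_pos z hz).ne'
  have hev : (fun z : ℝ × ℝ => jetAt U ρ S z.1 z.2) =ᶠ[𝓝 z] fun z => ![z.1, z.2, U z.1 z.2,
      ρ z.1 z.2, S z.1 z.2,
      fderiv ℝ (fun z : ℝ × ℝ => U z.1 z.2) z (0, 1),
      fderiv ℝ (fun z : ℝ × ℝ => ρ z.1 z.2) z (0, 1),
      fderiv ℝ (fun z : ℝ × ℝ => S z.1 z.2) z (0, 1)] := by
    filter_upwards [hzG] with w hw using h.jetAt_eq hw
  have hjd : DifferentiableAt ℝ (fun z : ℝ × ℝ => jetAt U ρ S z.1 z.2) z :=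
    ((h.contDiffOn_jet z hz).contDiffAt hzG).differentiableAt one_ne_zero
  have hcomp : ∀ (i : Fin 8) (f : ℝ × ℝ → ℝ), (fun z : ℝ × ℝ => jetAt U ρ S z.1 z.2 i) =ᶠ[𝓝 z] f →
      fderiv ℝ (fun z : ℝ × ℝ => jetAt U ρ S z.1 z.2) z (1, U z.1 z.2) i =
        fderiv ℝ f z (1, U z.1 z.2) := by
    intro i f hf
    rw [← hf.fderiv_eq]
    have := hasFDerivAt_pi'.1 hjd.hasFDerivAt i
    rw [this.fderiv]
    rfl
  have hUev : (fun w : ℝ × ℝ => fderiv ℝ (fun z : ℝ × ℝ => U z.1 z.2) w (1, U w.1 w.2)) =ᶠ[𝓝 z] _ :=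
    Filter.mem_of_superset hzG fun w hw => h.advect_velocity hw
  have hρev : (fun w : ℝ × ℝ => fderiv ℝ (fun z : ℝ × ℝ => ρ z.1 z.2) w (1, U w.1 w.2)) =ᶠ[𝓝 z] _ :=
    Filter.mem_of_superset hzG fun w hw => h.advect_density hw
  have hSev : (fun w : ℝ × ℝ => fderiv ℝ (fun z : ℝ × ℝ => S z.1 z.2) w (1, U w.1 w.2)) =ᶠ[𝓝 z] _ :=
    Filter.mem_of_superset hzG fun w hw => h.advect_entropy hw
  have comm : ∀ {f : ℝ × ℝ → ℝ} (_ : ContDiffOn ℝ 2 f G) {k : ℝ × ℝ → ℝ}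
      (_ : (fun w : ℝ × ℝ => fderiv ℝ f w (1, U w.1 w.2)) =ᶠ[𝓝 z] k),
      fderiv ℝ (fun w => fderiv ℝ f w (0, 1)) z (1, U z.1 z.2) = fderiv ℝ k z (0, 1)
        - fderiv ℝ f z (0, 1) * fderiv ℝ (fun z : ℝ × ℝ => U z.1 z.2) z (0, 1) := by
    intro f hf k hk
    exact fderiv_radial_advect (u := fun z : ℝ × ℝ => U z.1 z.2) ((hf z hz).contDiffAt hzG)
      hU.differentiableAt hk
  have hpair : HasFDerivAt (fun w : ℝ × ℝ => (ρ w.1 w.2, S w.1 w.2)) _ z := hρ.prodMk hS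
  have dg1 : HasFDerivAt (fun w : ℝ × ℝ => pRho p (ρ w.1 w.2) (S w.1 w.2) / ρ w.1 w.2)
      ((fderiv ℝ (fun z : ℝ × ℝ => pRho p z.1 z.2 / z.1) (ρ z.1 z.2, S z.1 z.2)).comp _) z :=
    HasFDerivAt.comp (f := fun w : ℝ × ℝ => (ρ w.1 w.2, S w.1 w.2))
      (g := fun z : ℝ × ℝ => pRho p z.1 z.2 / z.1) z
      ((hp.analyticOnNhd_pRho _ hmem).div analyticAt_fst hρ0).differentiableAt.hasFDerivAt hpair
  have dg2 : HasFDerivAt (fun w : ℝ × ℝ => pS p (ρ w.1 w.2) (S w.1 w.2) / ρ w.1 w.2)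
      ((fderiv ℝ (fun z : ℝ × ℝ => pS p z.1 z.2 / z.1) (ρ z.1 z.2, S z.1 z.2)).comp _) z :=
    HasFDerivAt.comp (f := fun w : ℝ × ℝ => (ρ w.1 w.2, S w.1 w.2))
      (g := fun z : ℝ × ℝ => pS p z.1 z.2 / z.1) z
      ((hp.analyticOnNhd_pS _ hmem).div analyticAt_fst hρ0).differentiableAt.hasFDerivAt hpair
  rw [h.jetAt_eq hz]
  ext i
  fin_cases i
  · refine (hcomp 0 _ (hev.mono fun w hw => congrFun hw 0)).trans ?_
    have : HasFDerivAt (fun z : ℝ × ℝ => z.1) (ContinuousLinearMap.fst ℝ ℝ ℝ) z := hasFDerivAt_fst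
    exact congrArg (fun L : ℝ × ℝ →L[ℝ] ℝ => L (1, U z.1 z.2)) this.fderiv
  · refine (hcomp 1 _ (hev.mono fun w hw => congrFun hw 1)).trans ?_
    have : HasFDerivAt (fun z : ℝ × ℝ => z.2) (ContinuousLinearMap.snd ℝ ℝ ℝ) z := hasFDerivAt_snd
    exact congrArg (fun L : ℝ × ℝ →L[ℝ] ℝ => L (1, U z.1 z.2)) this.fderiv
  · refine (hcomp 2 _ (hev.mono fun w hw => congrFun hw 2)).trans ?_
    refine (h.advect_velocity hz).trans ?_
    simp [jetVelocity, pressureForce]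
    ring
  · refine (hcomp 3 _ (hev.mono fun w hw => congrFun hw 3)).trans ?_
    refine (h.advect_density hz).trans ?_
    simp [jetVelocity]
  · refine (hcomp 4 _ (hev.mono fun w hw => congrFun hw 4)).trans ?_
    refine (h.advect_entropy hz).trans ?_
    simp [jetVelocity]
  · refine (hcomp 5 _ (hev.mono fun w hw => congrFun hw 5)).trans ?_
    refine (comm h.contDiffOn_velocity hUev).trans ?_
    have hk := ((dg2.fun_mul hSr).fun_add (dg1.fun_mul hρr)).fun_neg
    rw [hk.fderiv]
    simp [jetVelocity]
    ring
  · refine (hcomp 6 _ (hev.mono fun w hw => congrFun hw 6)).trans ?_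
    simp only [div_eq_mul_inv] at hρev
    refine (comm h.contDiffOn_density hρev).trans ?_
    have hinv : HasFDerivAt (fun w : ℝ × ℝ => w.2⁻¹) _ z :=
      (hasDerivAt_inv hr0).comp_hasFDerivAt z (hasFDerivAt_snd (𝕜 := ℝ) (p := z))
    have hk := (hρ.fun_mul (hUr.fun_add ((hU.const_mul ((n : ℝ) - 1)).fun_mul hinv))).fun_neg
    rw [hk.fderiv]
    simp [jetVelocity]
    field_simp
    ring
  · refine (hcomp 7 _ (hev.mono fun w hw => congrFun hw 7)).trans ?_
    refine (comm h.contDiffOn_entropy hSev).trans ?_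
    simp [jetVelocity]
    ring

end IsRadialFlow

/-! ### Transported domains and the pointwise criterion -/

theorem exists_isTransportedDomain {G : Set (ℝ × ℝ)} (hG : IsOpen G) {U : ℝ → ℝ → ℝ}
    (hU : ContDiffOn ℝ 1 (fun z : ℝ × ℝ => U z.1 z.2) G) {t₀ r₀ : ℝ} (hz : (t₀, r₀) ∈ G) :
    ∃ η > 0, ∀ δ ∈ Ioo (0 : ℝ) η, ∃ (t₁ t₂ : ℝ) (a b : ℝ → ℝ), t₀ ∈ Ioo t₁ t₂ ∧
      IsTransportedDomain G U t₁ t₂ a b ∧ a t₀ = r₀ ∧ b t₀ = r₀ + δ := by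
  -- Time is adjoined as a coordinate: particle paths are integral curves of the autonomous field
  -- (1, U), and Picard–Lindelöf gives a common time of existence for all starting points near (t₀,
  -- r₀).
  have hv : ContDiffAt ℝ 1 (fun z : ℝ × ℝ => ((1 : ℝ), U z.1 z.2)) (t₀, r₀) :=
    contDiffAt_const.prodMk ((hU _ hz).contDiffAt (hG.mem_nhds hz))
  obtain ⟨s, hs, ε, hε, H⟩ :=
    hv.exists_forall_mem_closedBall_exists_eq_forall_mem_Ioo_hasDerivAt t₀
  obtain ⟨η, hη, hball⟩ := Metric.isOpen_iff.1 hG _ hz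
  have ht₀ : t₀ ∈ Ioo (t₀ - ε) (t₀ + ε) := ⟨by linarith, by linarith⟩
  have path : ∀ r, |r - r₀| ≤ s → ∃ c : ℝ → ℝ, c t₀ = r ∧
      ∀ t ∈ Ioo (t₀ - ε) (t₀ + ε), HasDerivAt c (U t (c t)) t := by
    intro r hr
    obtain ⟨α, hα0, hα⟩ := H (t₀, r) (by
      rw [Metric.mem_closedBall, Prod.dist_eq]
      simp only [dist_self, Real.dist_eq]
      exact max_le hs.le hr)
    have h1 : ∀ t ∈ Ioo (t₀ - ε) (t₀ + ε), HasDerivAt (fun t => (α t).1) 1 t := fun t ht =>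
      (hasFDerivAt_fst (𝕜 := ℝ) (E := ℝ) (F := ℝ)).comp_hasDerivAt t (hα t ht)
    have h2 : ∀ t ∈ Ioo (t₀ - ε) (t₀ + ε), HasDerivAt (fun t => (α t).2)
        (U (α t).1 (α t).2) t := fun t ht =>
      (hasFDerivAt_snd (𝕜 := ℝ) (E := ℝ) (F := ℝ)).comp_hasDerivAt t (hα t ht)
    -- The first component has derivative 1, so it is the time itself.
    have h3 : EqOn (fun t => (α t).1) id (Ioo (t₀ - ε) (t₀ + ε)) :=
      isOpen_Ioo.eqOn_of_deriv_eq isPreconnected_Ioo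
        (fun t ht => (h1 t ht).differentiableAt.differentiableWithinAt)
        differentiableOn_id (fun t ht => by rw [(h1 t ht).deriv, deriv_id]) ht₀ (by simp [hα0])
    refine ⟨fun t => (α t).2, by simp [hα0], fun t ht => ?_⟩
    have h4 : (α t).1 = t := h3 ht
    have h5 := h2 t ht
    rwa [h4] at h5
  refine ⟨min s η, lt_min hs hη, fun δ hδ => ?_⟩
  obtain ⟨a, ha0, ha⟩ := path r₀ (by simpa using hs.le)
  obtain ⟨b, hb0, hb⟩ := path (r₀ + δ) (by
    rw [add_sub_cancel_left, abs_of_pos hδ.1]; exact (hδ.2.trans_le (min_le_left _ _)).le)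
  have hac := (ha t₀ ht₀).continuousAt
  have hbc := (hb t₀ ht₀).continuousAt
  have hδη : δ < η := hδ.2.trans_le (min_le_right _ _)
  have e1 : ∀ᶠ t in 𝓝 t₀, a t < b t :=
    hac.eventually_lt hbc (by rw [ha0, hb0]; linarith [hδ.1])
  have e2 : ∀ᶠ t in 𝓝 t₀, r₀ - η < a t := hac.eventually (lt_mem_nhds (by rw [ha0]; linarith))
  have e3 : ∀ᶠ t in 𝓝 t₀, b t < r₀ + η := hbc.eventually (gt_mem_nhds (by rw [hb0]; linarith))
  have e4 : ∀ᶠ t in 𝓝 t₀, t ∈ Ioo (t₀ - η) (t₀ + η) :=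
    Ioo_mem_nhds (by linarith) (by linarith)
  have e5 : ∀ᶠ t in 𝓝 t₀, t ∈ Ioo (t₀ - ε) (t₀ + ε) := Ioo_mem_nhds ht₀.1 ht₀.2
  obtain ⟨κ, hκ, hb'⟩ := Metric.eventually_nhds_iff_ball.1 (e1.and (e2.and (e3.and (e4.and e5))))
  rw [Real.ball_eq_Ioo] at hb'
  refine ⟨t₀ - κ, t₀ + κ, a, b, ⟨by linarith, by linarith⟩, fun t ht => ?_, ha0, hb0⟩
  obtain ⟨k1, k2, k3, k4, k5⟩ := hb' t ht
  refine ⟨k1, ha t k5, hb t k5, fun r hr => hball ?_⟩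
  rw [Metric.mem_ball, Prod.dist_eq]
  simp only [Real.dist_eq]
  exact max_lt (abs_lt.2 ⟨by linarith [k4.1], by linarith [k4.2]⟩)
    (abs_lt.2 ⟨by linarith [hr.1], by linarith [hr.2]⟩)

namespace IsRadialFlow

variable {n : ℕ} {R Q : Set ℝ} {p : ℝ → ℝ → ℝ} {G : Set (ℝ × ℝ)} {U ρ S : ℝ → ℝ → ℝ}

theorem contDiffOn_comp_jet (h : IsRadialFlow n R Q p G U ρ S) {Ω : Set Jet} {J : Jet → ℝ}
    (hJ : ContDiffOn ℝ 1 J Ω) : ContDiffOn ℝ 1 (fun z : ℝ × ℝ => J (jetAt U ρ S z.1 z.2))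
      (G ∩ (fun z : ℝ × ℝ => jetAt U ρ S z.1 z.2) ⁻¹' Ω) :=
  hJ.comp (h.contDiffOn_jet.mono inter_subset_left) fun _ hz => hz.2

theorem isOpen_inter_jet (h : IsRadialFlow n R Q p G U ρ S) {Ω : Set Jet} (hΩ : IsOpen Ω) :
    IsOpen (G ∩ (fun z : ℝ × ℝ => jetAt U ρ S z.1 z.2) ⁻¹' Ω) :=
  h.contDiffOn_jet.continuousOn.isOpen_inter_preimage h.isOpen hΩ

/-- The time derivative of the integral of `ρ J r^{n-1}` over a transported domain. -/
theorem hasDerivAt_integral (h : IsRadialFlow n R Q p G U ρ S) (hn : 1 ≤ n) {Ω : Set Jet}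
    (hΩ : IsOpen Ω) {J : Jet → ℝ} (hJ : ContDiffOn ℝ 1 J Ω) {t₁ t₂ : ℝ} {a b : ℝ → ℝ}
    (hV : IsTransportedDomain (G ∩ (fun z : ℝ × ℝ => jetAt U ρ S z.1 z.2) ⁻¹' Ω) U t₁ t₂ a b)
    {t : ℝ} (ht : t ∈ Ioo t₁ t₂) :
    HasDerivAt (fun τ => ∫ r in (a τ)..(b τ), ρ τ r * J (jetAt U ρ S τ r) * r ^ (n - 1))
      (∫ r in (a t)..(b t), ρ t r * r ^ (n - 1) *
        fderiv ℝ (fun z : ℝ × ℝ => J (jetAt U ρ S z.1 z.2)) (t, r) (1, U t r)) t := by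
  have h12 : (1 : WithTop ℕ∞) ≤ 2 := by norm_num
  have hG := h.isOpen_inter_jet hΩ
  have hJc := h.contDiffOn_comp_jet hJ
  have hρc := (h.contDiffOn_density.of_le h12).mono
    (inter_subset_left (t := (fun z : ℝ × ℝ => jetAt U ρ S z.1 z.2) ⁻¹' Ω))
  have hUc := (h.contDiffOn_velocity.of_le h12).mono
    (inter_subset_left (t := (fun z : ℝ × ℝ => jetAt U ρ S z.1 z.2) ⁻¹' Ω))
  have hgc : ContDiffOn ℝ 1 (fun z : ℝ × ℝ => ρ z.1 z.2 * J (jetAt U ρ S z.1 z.2) * z.2 ^ (n - 1))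
      (G ∩ (fun z : ℝ × ℝ => jetAt U ρ S z.1 z.2) ⁻¹' Ω) :=
    (hρc.mul hJc).mul (contDiff_snd.pow _).contDiffOn
  refine (hasDerivAt_integral_transported hG hUc hgc hV ht).congr_deriv ?_
  refine intervalIntegral.integral_congr fun r hr => ?_
  rw [uIcc_of_le (hV t ht).1.le] at hr
  have hz := (hV t ht).2.2.2 r hr
  have hρd := hasFDerivAt_of_contDiffOn h.isOpen h.contDiffOn_density hz.1
  have hJd : HasFDerivAt (fun z : ℝ × ℝ => J (jetAt U ρ S z.1 z.2)) _ (t, r) :=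
    (((hJc _ hz).contDiffAt (hG.mem_nhds hz)).differentiableAt one_ne_zero).hasFDerivAt
  have hrd : HasFDerivAt (fun z : ℝ × ℝ => z.2 ^ (n - 1)) _ (t, r) :=
    (hasDerivAt_pow (n - 1) r).comp_hasFDerivAt (t, r) (hasFDerivAt_snd (𝕜 := ℝ))
  have hg := (hρd.fun_mul hJd).fun_mul hrd
  have hr0 : r ≠ 0 := (h.radius_pos _ hz.1).ne'
  have hadv := h.advect_density hz.1
  simp only at hadv ⊢
  rw [hg.fderiv]
  simp only [add_apply, smul_apply, hadv, smul_eq_mul, ContinuousLinearMap.coe_snd']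
  -- The material derivative of ρ r^(n-1) is -ρ r^(n-1) U_r and cancels the divergence term of the
  -- transport theorem. The case n = 1 is separate because the exponent n - 1 - 1 is truncated.
  obtain ⟨m, rfl⟩ : ∃ m, n = m + 1 := ⟨n - 1, by omega⟩
  simp only [Nat.add_sub_cancel, Nat.cast_add, Nat.cast_one, add_sub_cancel_right]
  rcases m with _ | m
  · simp
    ring
  · simp only [Nat.add_sub_cancel, pow_succ]
    field_simp
    push_cast
    ring

theorem fderiv_comp_jet (hp : IsEquationOfState R Q p) (h : IsRadialFlow n R Q p G U ρ S)
    {Ω : Set Jet} (hΩ : IsOpen Ω) {J : Jet → ℝ} (hJ : ContDiffOn ℝ 1 J Ω) {z : ℝ × ℝ} (hz : z ∈ G)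
    (hzΩ : jetAt U ρ S z.1 z.2 ∈ Ω) :
    fderiv ℝ (fun z : ℝ × ℝ => J (jetAt U ρ S z.1 z.2)) z (1, U z.1 z.2) =
      fderiv ℝ J (jetAt U ρ S z.1 z.2) (jetVelocity n p (jetAt U ρ S z.1 z.2)
        (fderiv ℝ (fun w => fderiv ℝ (fun z : ℝ × ℝ => U z.1 z.2) w (0, 1)) z (0, 1))
        (fderiv ℝ (fun w => fderiv ℝ (fun z : ℝ × ℝ => ρ z.1 z.2) w (0, 1)) z (0, 1))
        (fderiv ℝ (fun w => fderiv ℝ (fun z : ℝ × ℝ => S z.1 z.2) w (0, 1)) z (0, 1))) := by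
  have h1 : HasFDerivAt J (fderiv ℝ J (jetAt U ρ S z.1 z.2)) (jetAt U ρ S z.1 z.2) :=
    (((hJ _ hzΩ).contDiffAt (hΩ.mem_nhds hzΩ)).differentiableAt one_ne_zero).hasFDerivAt
  have h2 : HasFDerivAt (fun z : ℝ × ℝ => jetAt U ρ S z.1 z.2) _ z :=
    (((h.contDiffOn_jet z hz).contDiffAt (h.isOpen.mem_nhds hz)).differentiableAt
      one_ne_zero).hasFDerivAt
  have h3 : HasFDerivAt (fun z : ℝ × ℝ => J (jetAt U ρ S z.1 z.2)) _ z := h1.comp z h2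
  rw [h3.fderiv, ← h.fderiv_jet hp hz]
  rfl

/-- Radial derivatives of a field which is quadratic in `r` at time `t₀`. -/
theorem fderiv_radial_of_quadratic {f : ℝ × ℝ → ℝ} (hG : IsOpen G) (hf : ContDiffOn ℝ 2 f G)
    {t₀ r₀ c₀ c₁ c₂ : ℝ} (hz : (t₀, r₀) ∈ G)
    (hq : ∀ r, (t₀, r) ∈ G → f (t₀, r) = c₀ + c₁ * (r - r₀) + c₂ / 2 * (r - r₀) ^ 2) :
    fderiv ℝ f (t₀, r₀) (0, 1) = c₁ ∧
      fderiv ℝ (fun w => fderiv ℝ f w (0, 1)) (t₀, r₀) (0, 1) = c₂ := by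
  have hopen : IsOpen {r | (t₀, r) ∈ G} := hG.preimage (by fun_prop)
  have h1 : ∀ r, (t₀, r) ∈ G → fderiv ℝ f (t₀, r) (0, 1) = c₁ + c₂ * (r - r₀) := by
    intro r hr
    refine (hasDerivAt_comp_mk_right (hasFDerivAt_of_contDiffOn hG hf hr)).unique ?_
    have hs := (hasDerivAt_id r).sub_const r₀
    have h2 := ((hs.const_mul c₁).const_add c₀).add ((hs.pow 2).const_mul (c₂ / 2))
    refine (h2.congr_of_eventuallyEq ?_).congr_deriv ?_
    · filter_upwards [hopen.mem_nhds hr] with y hy using hq y hy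
    · simp; ring
  refine ⟨by simpa using h1 r₀ hz, ?_⟩
  have h2 : HasFDerivAt (fun w => fderiv ℝ f w (0, 1)) _ (t₀, r₀) :=
    (((contDiffOn_radial hG hf _ hz).contDiffAt (hG.mem_nhds hz)).differentiableAt
      one_ne_zero).hasFDerivAt
  refine (hasDerivAt_comp_mk_right h2).unique ?_
  have h3 := (((hasDerivAt_id r₀).sub_const r₀).const_mul c₂).const_add c₁
  refine (h3.congr_of_eventuallyEq ?_).congr_deriv (by simp)
  filter_upwards [hopen.mem_nhds hz] with y hy using h1 y hy

end IsRadialFlow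

/-- The pointwise characterization of integral invariants: `J` is constant along the motion of jets,
whatever the second derivatives are. -/
theorem isIntegralInvariant_iff {n : ℕ} (hn : 1 ≤ n) {R Q : Set ℝ} {p : ℝ → ℝ → ℝ}
    (hp : IsEquationOfState R Q p) {Ω : Set Jet} (hΩ : IsOpen Ω) (hsub : Ω ⊆ jetDomain R Q)
    {J : Jet → ℝ} (hJ : ContDiffOn ℝ 1 J Ω) :
    IsIntegralInvariant n R Q p Ω J ↔
      ∀ x ∈ Ω, ∀ U₂ ρ₂ S₂ : ℝ, fderiv ℝ J x (jetVelocity n p x U₂ ρ₂ S₂) = 0 := by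
  constructor
  · intro hinv x hx U₂ ρ₂ S₂
    obtain ⟨hr, hρ, hS⟩ := hsub hx
    -- A flow whose 1-jet at (t, r) is x and whose second radial derivatives there are the given U₂,
    -- ρ₂, S₂.
    obtain ⟨G, U, ρ, S, h, hz, hquad⟩ := exists_isRadialFlow n hp x.t hr x.U x.Ur U₂ hρ x.ρr ρ₂
      hS x.Sr S₂
    obtain ⟨u1, u2⟩ := IsRadialFlow.fderiv_radial_of_quadratic h.isOpen h.contDiffOn_velocity hz
      fun r hr => (hquad r hr).1
    obtain ⟨v1, v2⟩ := IsRadialFlow.fderiv_radial_of_quadratic h.isOpen h.contDiffOn_density hz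
      fun r hr => (hquad r hr).2.1
    obtain ⟨w1, w2⟩ := IsRadialFlow.fderiv_radial_of_quadratic h.isOpen h.contDiffOn_entropy hz
      fun r hr => (hquad r hr).2.2
    have hjet : jetAt U ρ S x.t x.r = x := by
      have e := h.jetAt_eq hz
      simp only at e
      rw [e, u1, v1, w1]
      obtain ⟨q1, q2, q3⟩ := hquad x.r hz
      rw [q1, q2, q3]
      ext i
      fin_cases i <;> simp
    have hzΩ : jetAt U ρ S x.t x.r ∈ Ω := by rwa [hjet]
    have hkey := h.fderiv_comp_jet hp hΩ hJ hz hzΩ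
    rw [u2, v2, w2] at hkey
    simp only at hkey
    rw [hjet] at hkey
    rw [← hkey]
    by_contra hne
    set G' := G ∩ (fun z : ℝ × ℝ => jetAt U ρ S z.1 z.2) ⁻¹' Ω with hG'
    have hG'o : IsOpen G' := h.isOpen_inter_jet hΩ
    have hzG' : (x.t, x.r) ∈ G' := ⟨hz, hzΩ⟩
    have hUc : ContDiffOn ℝ 1 (fun z : ℝ × ℝ => U z.1 z.2) G' :=
      (h.contDiffOn_velocity.of_le (by norm_num)).mono inter_subset_left
    -- s is the material derivative, assumed non-zero. Then s times the integrand k is positive at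
    -- the point, hence on a short interval, and a domain transported from that interval has an
    -- integral with non-zero time derivative.
    set s : ℝ := fderiv ℝ (fun z : ℝ × ℝ => J (jetAt U ρ S z.1 z.2)) (x.t, x.r) (1, U x.t x.r)
      with hs
    let k : ℝ × ℝ → ℝ := fun z => ρ z.1 z.2 * z.2 ^ (n - 1) *
      fderiv ℝ (fun z : ℝ × ℝ => J (jetAt U ρ S z.1 z.2)) z (1, U z.1 z.2)
    have hkc : ContinuousOn k G' :=
      ((h.contDiffOn_density.continuousOn.mono inter_subset_left).mul (by fun_prop)).mul
        (((h.contDiffOn_comp_jet hJ).continuousOn_fderiv_of_isOpen hG'o le_rfl).clm_apply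
          (continuousOn_const.prodMk hUc.continuousOn))
    have hpos : 0 < s * k (x.t, x.r) := by
      have h1 : 0 < ρ x.t x.r := hp.density_pos _ (h.density_mem _ _ hz)
      have h2 : 0 < x.r ^ (n - 1) := pow_pos hr _
      have h3 : 0 < s * s := mul_self_pos.2 hne
      have : s * k (x.t, x.r) = ρ x.t x.r * x.r ^ (n - 1) * (s * s) := by
        simp only [k, ← hs]; ring
      rw [this]
      positivity
    have hnear : ∀ᶠ r in 𝓝 x.r, (x.t, r) ∈ G' ∧ 0 < s * k (x.t, r) := by
      have hc : ContinuousAt (fun r : ℝ => (x.t, r)) x.r := by fun_prop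
      have h1 : ∀ᶠ r in 𝓝 x.r, (x.t, r) ∈ G' := hc.preimage_mem_nhds (hG'o.mem_nhds hzG')
      have h2 : ContinuousAt (fun r => s * k (x.t, r)) x.r :=
        continuousAt_const.mul (ContinuousAt.comp (f := fun r : ℝ => (x.t, r))
          (hkc.continuousAt (hG'o.mem_nhds hzG')) hc)
      exact h1.and (h2.eventually (lt_mem_nhds hpos))
    obtain ⟨κ, hκ, hball⟩ := Metric.eventually_nhds_iff_ball.1 hnear
    obtain ⟨η, hη, hdom⟩ := exists_isTransportedDomain hG'o hUc hzG'
    have hmin : 0 < min η κ := lt_min hη hκ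
    obtain ⟨t₁, t₂, a, b, ht, hV, ha, hb⟩ := hdom (min η κ / 2)
      ⟨by positivity, by linarith [min_le_left η κ]⟩
    have hd := h.hasDerivAt_integral hn hΩ hJ hV ht
    have hd0 := hinv G U ρ S h t₁ t₂ a b (fun t ht => ⟨(hV t ht).1, (hV t ht).2.1, (hV t ht).2.2.1,
      fun r hr => ((hV t ht).2.2.2 r hr).1⟩) (fun t ht r hr => ((hV t ht).2.2.2 r hr).2) x.t ht
    have hzero := hd.unique hd0
    rw [ha, hb] at hzero
    have hb' : ∀ r ∈ Icc x.r (x.r + min η κ / 2), (x.t, r) ∈ G' ∧ 0 < s * k (x.t, r) := by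
      intro r hr
      refine hball r ?_
      rw [Metric.mem_ball, Real.dist_eq, abs_of_nonneg (by linarith [hr.1])]
      have := min_le_right η κ
      linarith [hr.2]
    have hle : x.r ≤ x.r + min η κ / 2 := by linarith
    have hcont : ContinuousOn (fun r => s * k (x.t, r)) (uIcc x.r (x.r + min η κ / 2)) := by
      rw [uIcc_of_le hle]
      exact continuousOn_const.mul (hkc.comp (by fun_prop) fun r hr => (hb' r hr).1)
    have hint := intervalIntegral.intervalIntegral_pos_of_pos_on hcont.intervalIntegrable
      (fun r hr => (hb' r (Ioo_subset_Icc_self hr)).2) (by linarith)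
    rw [intervalIntegral.integral_const_mul] at hint
    have hzero' : ∫ r in x.r..(x.r + min η κ / 2), k (x.t, r) = 0 := hzero
    rw [hzero', mul_zero] at hint
    exact lt_irrefl _ hint
  · intro hD G U ρ S h t₁ t₂ a b hV hjets t ht
    have hV' : IsTransportedDomain (G ∩ (fun z : ℝ × ℝ => jetAt U ρ S z.1 z.2) ⁻¹' Ω) U t₁ t₂ a b :=
      fun t ht => ⟨(hV t ht).1, (hV t ht).2.1, (hV t ht).2.2.1,
        fun r hr => ⟨(hV t ht).2.2.2 r hr, hjets t ht r hr⟩⟩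
    refine (h.hasDerivAt_integral hn hΩ hJ hV' ht).congr_deriv ?_
    rw [← intervalIntegral.integral_zero (a := a t) (b := b t) (μ := MeasureTheory.volume)]
    refine intervalIntegral.integral_congr fun r hr => ?_
    rw [uIcc_of_le (hV t ht).1.le] at hr
    have := h.fderiv_comp_jet hp hΩ hJ ((hV t ht).2.2.2 r hr) (hjets t ht r hr)
    simp only at this ⊢
    rw [this, hD _ (hjets t ht r hr), mul_zero]

/-! ### Linear equations for the partial derivatives of an invariant -/

/-- The partial derivatives of a function on the jet space. -/
noncomputable def jetPartial (J : Jet → ℝ) (i : Fin 8) (x : Jet) : ℝ := fderiv ℝ J x (Pi.single i 1)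

theorem fderiv_jet_apply (J : Jet → ℝ) (x v : Jet) :
    fderiv ℝ J x v = v 0 * jetPartial J 0 x + v 1 * jetPartial J 1 x + v 2 * jetPartial J 2 x
      + v 3 * jetPartial J 3 x + v 4 * jetPartial J 4 x + v 5 * jetPartial J 5 x
      + v 6 * jetPartial J 6 x + v 7 * jetPartial J 7 x := by
  have h : v = ∑ i, v i • (Pi.single i 1 : Jet) := by
    ext j
    simp [Finset.sum_apply, Pi.single_apply]
  conv_lhs => rw [h, map_sum]
  simp only [map_smul, smul_eq_mul, Fin.sum_univ_eight]
  rfl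

theorem continuousOn_jetPartial {Ω : Set Jet} (hΩ : IsOpen Ω) {J : Jet → ℝ}
    (hJ : ContDiffOn ℝ 1 J Ω) (i : Fin 8) : ContinuousOn (jetPartial J i) Ω :=
  (hJ.continuousOn_fderiv_of_isOpen hΩ le_rfl).clm_apply continuousOn_const

theorem hasFDerivAt_of_contDiffOn_one {E F : Type*} [NormedAddCommGroup E] [NormedSpace ℝ E]
    [NormedAddCommGroup F] [NormedSpace ℝ F] {Ω : Set E} (hΩ : IsOpen Ω) {J : E → F}
    (hJ : ContDiffOn ℝ 1 J Ω) {x : E} (hx : x ∈ Ω) : HasFDerivAt J (fderiv ℝ J x) x :=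
  (((hJ x hx).contDiffAt (hΩ.mem_nhds hx)).differentiableAt one_ne_zero).hasFDerivAt

/-- If a partial derivative of `J` vanishes identically, then the derivative of `J` is locally
invariant under translations in this direction. -/
theorem eventually_fderiv_add_eq {E : Type*} [NormedAddCommGroup E] [NormedSpace ℝ E] {Ω : Set E}
    (hΩ : IsOpen Ω) {J : E → ℝ} (hJ : ContDiffOn ℝ 1 J Ω) {v : E}
    (h0 : ∀ x ∈ Ω, fderiv ℝ J x v = 0) {x : E} (hx : x ∈ Ω) :
    ∀ᶠ δ in 𝓝 (0 : ℝ), x + δ • v ∈ Ω ∧ fderiv ℝ J (x + δ • v) = fderiv ℝ J x := by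
  have hc : ContinuousAt (fun q : ℝ × E => q.2 + q.1 • v) (0, x) := by fun_prop
  have hnear : ∀ᶠ q in 𝓝 ((0 : ℝ), x), q.2 + q.1 • v ∈ Ω := by
    refine hc.preimage_mem_nhds (hΩ.mem_nhds ?_)
    simpa using hx
  obtain ⟨κ, hκ, hb⟩ := Metric.eventually_nhds_iff_ball.1 hnear
  have hb' : ∀ δ ∈ Metric.ball (0 : ℝ) κ, ∀ y ∈ Metric.ball x κ, y + δ • v ∈ Ω := by
    intro δ hδ y hy
    exact hb (δ, y) (by
      rw [← ball_prod_same]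
      exact ⟨hδ, hy⟩)
  filter_upwards [Metric.ball_mem_nhds (0 : ℝ) hκ] with δ hδ
  refine ⟨hb' δ hδ x (Metric.mem_ball_self hκ), ?_⟩
  -- J is only C¹, so the vanishing of its derivative along v cannot be differentiated to kill mixed
  -- partials. Instead J(y + δ v) = J(y) on a whole ball, and functions that agree there have the
  -- same derivative at x.
  have hconst : ∀ y ∈ Metric.ball x κ, J (y + δ • v) = J y := by
    intro y hy
    have hd : ∀ s ∈ Metric.ball (0 : ℝ) κ, HasDerivAt (fun s : ℝ => J (y + s • v)) 0 s := by
      intro s hs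
      have h1 := hasFDerivAt_of_contDiffOn_one hΩ hJ (hb' s hs y hy)
      have h2 : HasDerivAt (fun s : ℝ => y + s • v) v s := by
        simpa using ((hasDerivAt_id s).smul_const v).const_add y
      have h3 := h1.comp_hasDerivAt s h2
      rwa [h0 _ (hb' s hs y hy)] at h3
    have := Metric.isOpen_ball.is_const_of_deriv_eq_zero (convex_ball (0 : ℝ) κ).isPreconnected
      (fun s hs => (hd s hs).differentiableAt.differentiableWithinAt)
      (fun s hs => (hd s hs).deriv) hδ (Metric.mem_ball_self hκ)
    simpa using this
  rw [← fderiv_comp_add_right]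
  refine Filter.EventuallyEq.fderiv_eq ?_
  filter_upwards [Metric.ball_mem_nhds x hκ] with y hy using hconst y hy

namespace IsEquationOfState

variable {R Q : Set ℝ} {p : ℝ → ℝ → ℝ}

theorem isPreconnected_prod (hp : IsEquationOfState R Q p) : IsPreconnected (R ×ˢ Q) :=
  hp.isPreconnected_density.prod hp.isPreconnected_entropy

/-- A continuous function on the jet space vanishes if its product with a non-zero analytic function
of `(ρ, S)` does. -/
theorem eq_zero_of_mul_eq_zero (hp : IsEquationOfState R Q p) {q : ℝ × ℝ → ℝ}
    (hq : AnalyticOnNhd ℝ q (R ×ˢ Q)) (hne : ∃ z ∈ R ×ˢ Q, q z ≠ 0) {Ω : Set Jet} (hΩ : IsOpen Ω)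
    (hsub : Ω ⊆ jetDomain R Q) {c : Jet → ℝ} (hc : ContinuousOn c Ω)
    (h : ∀ x ∈ Ω, q (x.ρ, x.S) * c x = 0) : ∀ x ∈ Ω, c x = 0 := by
  intro x hx
  by_contra hcx
  have h1 : ∀ᶠ y in 𝓝 x, y ∈ Ω ∧ c y ≠ 0 :=
    (hΩ.eventually_mem hx).and ((hc.continuousAt (hΩ.mem_nhds hx)).eventually_ne hcx)
  -- The slice through x along which only (ρ, S) varies. If c x ≠ 0, then q vanishes near (x.ρ,
  -- x.S), hence on all of R × Q by the identity theorem.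
  let ι : ℝ × ℝ → Jet := fun z => ![x.t, x.r, x.U, z.1, z.2, x.Ur, x.ρr, x.Sr]
  have hι : Continuous ι := by
    refine continuous_pi fun i => ?_
    fin_cases i <;> simp [ι] <;> fun_prop
  have hιx : ι (x.ρ, x.S) = x := by
    ext i; fin_cases i <;> rfl
  have h2 : ∀ᶠ z in 𝓝 (x.ρ, x.S), q z = 0 := by
    have := hι.tendsto (x.ρ, x.S)
    rw [hιx] at this
    filter_upwards [this.eventually h1] with z hz
    exact (mul_eq_zero.1 (h _ hz.1)).resolve_right hz.2
  obtain ⟨z, hz, hqz⟩ := hne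
  exact hqz (hq.eqOn_zero_of_preconnected_of_eventuallyEq_zero hp.isPreconnected_prod
    (hsub hx).2 h2 hz)

theorem hasDerivAt_density (hp : IsEquationOfState R Q p) {ρ S : ℝ} (hρ : ρ ∈ R) (hS : S ∈ Q) :
    HasDerivAt (fun q => p q S) (pRho p ρ S) ρ := by
  have h := (hp.analytic (ρ, S) ⟨hρ, hS⟩).differentiableAt.hasFDerivAt
  rw [hp.pRho_eq_fderiv (z := (ρ, S)) ⟨hρ, hS⟩]
  exact hasDerivAt_comp_mk_left h

theorem hasDerivAt_entropy (hp : IsEquationOfState R Q p) {ρ S : ℝ} (hρ : ρ ∈ R) (hS : S ∈ Q) :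
    HasDerivAt (fun s => p ρ s) (pS p ρ S) S := by
  have h := (hp.analytic (ρ, S) ⟨hρ, hS⟩).differentiableAt.hasFDerivAt
  rw [hp.pS_eq_fderiv (z := (ρ, S)) ⟨hρ, hS⟩]
  exact hasDerivAt_comp_mk_right h

theorem isEntropic_of_pRho_eq_zero (hp : IsEquationOfState R Q p)
    (h : ∀ z ∈ R ×ˢ Q, pRho p z.1 z.2 = 0) : IsEntropic R Q p := by
  obtain ⟨ρ₁, hρ₁⟩ := hp.nonempty_density
  refine ⟨fun S => p ρ₁ S, fun ρ hρ S hS => ?_⟩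
  refine hp.isOpen_density.is_const_of_deriv_eq_zero (f := fun q => p q S)
    hp.isPreconnected_density
    (fun q hq => (hp.hasDerivAt_density hq hS).differentiableAt.differentiableWithinAt)
    (fun q hq => ?_) hρ hρ₁
  rw [(hp.hasDerivAt_density hq hS).deriv]
  exact h (q, S) ⟨hq, hS⟩

theorem exists_pRho_ne_zero (hp : IsEquationOfState R Q p) (hne : ¬ IsEntropic R Q p) :
    ∃ z ∈ R ×ˢ Q, pRho p z.1 z.2 ≠ 0 := by
  by_contra! h
  exact hne (hp.isEntropic_of_pRho_eq_zero h)

/-- This is where the non-constancy of p enters. -/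
theorem exists_derivative_ne_zero (hp : IsEquationOfState R Q p) :
    (∃ z ∈ R ×ˢ Q, pRho p z.1 z.2 ≠ 0) ∨ (∃ z ∈ R ×ˢ Q, pS p z.1 z.2 ≠ 0) := by
  by_contra! h
  obtain ⟨h1, h2⟩ := h
  obtain ⟨κ, hκ⟩ := hp.isEntropic_of_pRho_eq_zero h1
  obtain ⟨ρ₁, hρ₁⟩ := hp.nonempty_density
  obtain ⟨S₁, hS₁⟩ := hp.nonempty_entropy
  refine hp.nonconstant ⟨p ρ₁ S₁, fun ρ hρ S hS => ?_⟩
  rw [hκ ρ hρ S hS, ← hκ ρ₁ hρ₁ S hS]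
  refine hp.isOpen_entropy.is_const_of_deriv_eq_zero (f := fun s => p ρ₁ s)
    hp.isPreconnected_entropy
    (fun q hq => (hp.hasDerivAt_entropy hρ₁ hq).differentiableAt.differentiableWithinAt)
    (fun q hq => ?_) hS hS₁
  rw [(hp.hasDerivAt_entropy hρ₁ hq).deriv]
  exact h2 (ρ₁, q) ⟨hρ₁, hq⟩

end IsEquationOfState

section Necessary

variable {n : ℕ} {R Q : Set ℝ} {p : ℝ → ℝ → ℝ} {Ω : Set Jet} {J : Jet → ℝ}

/-- A derivative identity along a direction in which `J` does not vary. -/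
theorem exists_ne_zero_fderiv_add_eq (hΩ : IsOpen Ω) (hJ : ContDiffOn ℝ 1 J Ω) {i : Fin 8}
    (h0 : ∀ x ∈ Ω, jetPartial J i x = 0) {x : Jet} (hx : x ∈ Ω) :
    ∃ δ : ℝ, δ ≠ 0 ∧ x + δ • (Pi.single i 1 : Jet) ∈ Ω ∧
      ∀ j, jetPartial J j (x + δ • (Pi.single i 1 : Jet)) = jetPartial J j x := by
  have h := (eventually_fderiv_add_eq hΩ hJ h0 hx).filter_mono
    (nhdsWithin_le_nhds (s := ({0}ᶜ : Set ℝ)))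
  obtain ⟨δ, ⟨h1, h2⟩, h3⟩ := (h.and self_mem_nhdsWithin).exists
  exact ⟨δ, h3, h1, fun j => by rw [jetPartial, h2, jetPartial]⟩

/-- The hypothesis is split by comparing two values of each free quantity. U₂, ρ₂, S₂ are free by
assumption; U_r becomes free once J_{U_r} = 0, because a small shift of x in that direction then
changes no partial derivative of J. -/
theorem jetPartials_of_invariant (hp : IsEquationOfState R Q p) (hΩ : IsOpen Ω)
    (hsub : Ω ⊆ jetDomain R Q) (hJ : ContDiffOn ℝ 1 J Ω)
    (h : ∀ x ∈ Ω, ∀ U₂ ρ₂ S₂ : ℝ, fderiv ℝ J x (jetVelocity n p x U₂ ρ₂ S₂) = 0) :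
    (∀ x ∈ Ω, jetPartial J 5 x = 0) ∧ (∀ x ∈ Ω, jetPartial J 6 x = 0) ∧
    (∀ x ∈ Ω, x.ρ * jetPartial J 3 x + x.Sr * jetPartial J 7 x = 0) ∧
    (∀ x ∈ Ω, jetPartial J 0 x + x.U * jetPartial J 1 x - pressureForce p x * jetPartial J 2 x
      - ((n : ℝ) - 1) * x.ρ * x.U / x.r * jetPartial J 3 x = 0) := by
  simp only [fderiv_jet_apply] at h
  have hρ : ∀ x ∈ Ω, x.ρ ≠ 0 := fun x hx => (hp.density_pos _ (hsub hx).2.1).ne'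
  have h6 : ∀ x ∈ Ω, jetPartial J 6 x = 0 := by
    intro x hx
    have e1 := h x hx 0 0 0
    have e2 := h x hx 1 0 0
    simp [jetVelocity] at e1 e2
    have : x.ρ * jetPartial J 6 x = 0 := by linear_combination e1 - e2
    exact (mul_eq_zero.1 this).resolve_left (hρ x hx)
  -- ρ₂ and S₂ occur with the coefficients p_ρ/ρ and p_S/ρ, not both of which vanish identically.
  have h5 : ∀ x ∈ Ω, jetPartial J 5 x = 0 := by
    have hc := continuousOn_jetPartial hΩ hJ 5
    rcases hp.exists_derivative_ne_zero with hne | hne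
    · refine hp.eq_zero_of_mul_eq_zero hp.analyticOnNhd_pRho hne hΩ hsub hc fun x hx => ?_
      have e1 := h x hx 0 0 0
      have e2 := h x hx 0 1 0
      have hx0 := hρ x hx
      simp [jetVelocity] at e1 e2
      have : pRho p x.ρ x.S / x.ρ * jetPartial J 5 x = 0 := by linear_combination e1 - e2
      rw [div_mul_eq_mul_div, div_eq_zero_iff] at this
      exact this.resolve_right hx0
    · refine hp.eq_zero_of_mul_eq_zero hp.analyticOnNhd_pS hne hΩ hsub hc fun x hx => ?_
      have e1 := h x hx 0 0 0
      have e2 := h x hx 0 0 1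
      have hx0 := hρ x hx
      simp [jetVelocity] at e1 e2
      have : pS p x.ρ x.S / x.ρ * jetPartial J 5 x = 0 := by linear_combination e1 - e2
      rw [div_mul_eq_mul_div, div_eq_zero_iff] at this
      exact this.resolve_right hx0
  have hred : ∀ x ∈ Ω, jetPartial J 0 x + x.U * jetPartial J 1 x
      - pressureForce p x * jetPartial J 2 x
      - x.ρ * (x.Ur + ((n : ℝ) - 1) * x.U / x.r) * jetPartial J 3 x
      - x.Ur * x.Sr * jetPartial J 7 x = 0 := by
    intro x hx
    have e1 := h x hx 0 0 0
    simp [jetVelocity, h5 x hx, h6 x hx] at e1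
    linear_combination e1
  have ha : ∀ x ∈ Ω, x.ρ * jetPartial J 3 x + x.Sr * jetPartial J 7 x = 0 := by
    intro x hx
    obtain ⟨δ, hδ, hmem, hδJ⟩ := exists_ne_zero_fderiv_add_eq hΩ hJ h5 hx
    have e1 := hred x hx
    have e2 := hred _ hmem
    simp [hδJ, pressureForce] at e1 e2
    have : δ * (x.ρ * jetPartial J 3 x + x.Sr * jetPartial J 7 x) = 0 := by
      linear_combination e1 - e2
    exact (mul_eq_zero.1 this).resolve_left hδ
  refine ⟨h5, h6, ha, fun x hx => ?_⟩
  linear_combination hred x hx + x.Ur * ha x hx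

/-- Since J_{ρ_r} = 0, the variable ρ_r is free, and it enters only through p_ρ ρ_r J_U/ρ. Once J_U
= 0, the velocity U is free as well, which separates J_t from the terms linear in U. -/
theorem jetPartials_of_invariant_of_not_isEntropic (hp : IsEquationOfState R Q p)
    (hne : ¬ IsEntropic R Q p) (hΩ : IsOpen Ω) (hsub : Ω ⊆ jetDomain R Q)
    (hJ : ContDiffOn ℝ 1 J Ω)
    (h : ∀ x ∈ Ω, ∀ U₂ ρ₂ S₂ : ℝ, fderiv ℝ J x (jetVelocity n p x U₂ ρ₂ S₂) = 0) :
    ∀ x ∈ Ω, jetPartial J 0 x = 0 ∧ jetPartial J 2 x = 0 ∧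
      x.r * jetPartial J 1 x = ((n : ℝ) - 1) * x.ρ * jetPartial J 3 x := by
  obtain ⟨-, h6, -, hb⟩ := jetPartials_of_invariant hp hΩ hsub hJ h
  have hρ : ∀ x ∈ Ω, x.ρ ≠ 0 := fun x hx => (hp.density_pos _ (hsub hx).2.1).ne'
  have h2 : ∀ x ∈ Ω, jetPartial J 2 x = 0 := by
    refine hp.eq_zero_of_mul_eq_zero hp.analyticOnNhd_pRho (hp.exists_pRho_ne_zero hne) hΩ hsub
      (continuousOn_jetPartial hΩ hJ 2) fun x hx => ?_
    obtain ⟨δ, hδ, hmem, hδJ⟩ := exists_ne_zero_fderiv_add_eq hΩ hJ h6 hx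
    have e1 := hb x hx
    have e2 := hb _ hmem
    have hx0 := hρ x hx
    simp [hδJ, pressureForce] at e1 e2
    have : δ / x.ρ * (pRho p x.ρ x.S * jetPartial J 2 x) = 0 := by linear_combination e1 - e2
    exact (mul_eq_zero.1 this).resolve_left (div_ne_zero hδ hx0)
  intro x hx
  have hr : x.r ≠ 0 := ne_of_gt (hsub hx).1
  obtain ⟨δ, hδ, hmem, hδJ⟩ := exists_ne_zero_fderiv_add_eq hΩ hJ h2 hx
  have e1 := hb x hx
  have e2 := hb _ hmem
  simp [hδJ, h2 x hx] at e1 e2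
  have h1 : x.r * jetPartial J 1 x = ((n : ℝ) - 1) * x.ρ * jetPartial J 3 x := by
    have e3 : δ * (jetPartial J 1 x - ((n : ℝ) - 1) * x.ρ / x.r * jetPartial J 3 x) = 0 := by
      linear_combination e2 - e1
    have e4 := (mul_eq_zero.1 e3).resolve_left hδ
    field_simp at e4
    linear_combination e4
  refine ⟨?_, h2 x hx, h1⟩
  field_simp at e1
  have : x.r * jetPartial J 0 x = 0 := by linear_combination e1 - x.U * h1
  exact (mul_eq_zero.1 this).resolve_left hr

end Necessary

/-! ### Functions of invariants and adapted charts -/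

/-- Functions of invariants are invariant. -/
theorem fderiv_eq_zero_of_isLocallyFunctionOf {k : ℕ} {I : Jet → (Fin k → ℝ)} {J : Jet → ℝ}
    {Ω : Set Jet} (h : IsLocallyFunctionOf I J Ω) {x v : Jet} (hx : x ∈ Ω)
    (hI : DifferentiableAt ℝ I x) (hv : ∀ i, HasDerivAt (fun s : ℝ => I (x + s • v) i) 0 0) :
    fderiv ℝ J x v = 0 := by
  obtain ⟨N, hN, hxN, -, f, hf, hJf⟩ := h x hx
  -- f is controlled only on the image of N, which need not be open, so the chain rule is applied
  -- within that image.
  have h1 : HasFDerivWithinAt f _ (I '' N) (I x) :=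
    ((hf (I x) (mem_image_of_mem I hxN)).differentiableWithinAt one_ne_zero).hasFDerivWithinAt
  have h2 := h1.comp_hasFDerivAt x hI.hasFDerivAt
    (by filter_upwards [hN.mem_nhds hxN] with y hy using mem_image_of_mem I hy)
  have h3 : J =ᶠ[𝓝 x] f ∘ I := by
    filter_upwards [hN.mem_nhds hxN] with y hy using hJf y hy
  have h4 : HasDerivAt (fun s : ℝ => x + s • v) v 0 := by
    simpa using ((hasDerivAt_id (0 : ℝ)).smul_const v).const_add x
  have h5 : fderiv ℝ I x v = 0 := by
    have h6 : HasFDerivAt I (fderiv ℝ I x) (x + (0 : ℝ) • v) := by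
      simpa using hI.hasFDerivAt
    exact (h6.comp_hasDerivAt (0 : ℝ) h4).unique (hasDerivAt_pi.2 hv)
  rw [h3.fderiv_eq, h2.fderiv, ContinuousLinearMap.comp_apply, h5, map_zero]

section Charts

variable {m k : ℕ} {I : Jet → (Fin k → ℝ)} {α : Jet → (Fin m → ℝ)}
  {Φ : (Fin m → ℝ) × (Fin k → ℝ) → Jet} {D : Set ((Fin m → ℝ) × (Fin k → ℝ))} {X Ω : Set Jet}
  {J : Jet → ℝ}

/-- By `hzero`, J is stationary in every direction tangent to the fibre, so it is constant on the
connected piece B. The velocity w is existential so that a chart may exhibit it in closed form;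
uniqueness of derivatives identifies it with the value of the derivative of Φ. -/
theorem eq_on_fiber (hD : IsOpen D) (hΦ : ContDiffOn ℝ 1 Φ D) (hΩ : IsOpen Ω)
    (hJ : ContDiffOn ℝ 1 J Ω)
    (hzero : ∀ z ∈ D, Φ z ∈ Ω → ∀ v, ∃ w, HasDerivAt (fun s : ℝ => Φ (z.1 + s • v, z.2)) w 0 ∧
      fderiv ℝ J (Φ z) w = 0)
    {B : Set (Fin m → ℝ)} (hB : IsOpen B) (hBc : Convex ℝ B) {c : Fin k → ℝ}
    (hBD : ∀ a ∈ B, (a, c) ∈ D ∧ Φ (a, c) ∈ Ω) {a a' : Fin m → ℝ} (ha : a ∈ B) (ha' : a' ∈ B) :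
    J (Φ (a, c)) = J (Φ (a', c)) := by
  have hd : ∀ a ∈ B, HasFDerivAt (fun a => J (Φ (a, c)))
      (((fderiv ℝ J (Φ (a, c))).comp (fderiv ℝ Φ (a, c))).comp
        (ContinuousLinearMap.inl ℝ (Fin m → ℝ) (Fin k → ℝ))) a := by
    intro a ha
    have h1 := hasFDerivAt_of_contDiffOn_one hΩ hJ (hBD a ha).2
    have h2 := hasFDerivAt_of_contDiffOn_one hD hΦ (hBD a ha).1
    exact HasFDerivAt.comp (g := fun q => J (Φ q)) (f := fun a => (a, c)) a
      (h1.comp (a, c) h2) (hasFDerivAt_prodMk_left a c)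
  refine hB.is_const_of_fderiv_eq_zero (𝕜 := ℝ) (f := fun a => J (Φ (a, c))) hBc.isPreconnected
    (fun a ha => (hd a ha).differentiableAt.differentiableWithinAt) (fun a ha => ?_) ha ha'
  rw [(hd a ha).fderiv]
  ext1 v
  obtain ⟨w, hw, hJw⟩ := hzero (a, c) (hBD a ha).1 (hBD a ha).2 v
  have h2 := hasFDerivAt_of_contDiffOn_one hD hΦ (hBD a ha).1
  have h3 : HasDerivAt (fun s : ℝ => (a + s • v, c)) (v, 0) 0 :=
    (by simpa using ((hasDerivAt_id (0 : ℝ)).smul_const v).const_add a :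
      HasDerivAt (fun s : ℝ => a + s • v) v 0).prodMk (hasDerivAt_const _ _)
  have h2' : HasFDerivAt Φ (fderiv ℝ Φ (a, c)) (a + (0 : ℝ) • v, c) := by simpa using h2
  have h4 := (h2'.comp_hasDerivAt (0 : ℝ) h3).unique hw
  rw [ContinuousLinearMap.comp_apply, ContinuousLinearMap.comp_apply,
    ContinuousLinearMap.inl_apply, h4, hJw]
  rfl

/-- A function which is constant along the fibers of a chart adapted to `I` is locally a function
of `I`. -/
theorem isLocallyFunctionOf_of_chart (hI : ContinuousOn I X)
    (hα : ContinuousOn α X) (hD : IsOpen D) (hΦ : ContDiffOn ℝ 1 Φ D)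
    (hinv : ∀ x ∈ X, (α x, I x) ∈ D ∧ Φ (α x, I x) = x) (hΩ : IsOpen Ω) (hΩX : Ω ⊆ X)
    (hJ : ContDiffOn ℝ 1 J Ω)
    (hzero : ∀ z ∈ D, Φ z ∈ Ω → ∀ v, ∃ w, HasDerivAt (fun s : ℝ => Φ (z.1 + s • v, z.2)) w 0 ∧
      fderiv ℝ J (Φ z) w = 0) : IsLocallyFunctionOf I J Ω := by
  intro x hx
  have hopen : IsOpen (D ∩ Φ ⁻¹' Ω) := hΦ.continuousOn.isOpen_inter_preimage hD hΩ
  have hmem : (α x, I x) ∈ D ∩ Φ ⁻¹' Ω := by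
    refine ⟨(hinv x (hΩX hx)).1, ?_⟩
    rw [mem_preimage, (hinv x (hΩX hx)).2]
    exact hx
  -- In a product of balls the pieces of the fibres are convex and each meets the slice a = α x, on
  -- which f is read off.
  obtain ⟨κ, hκ, hball⟩ := Metric.isOpen_iff.1 hopen _ hmem
  rw [← ball_prod_same] at hball
  have hN : IsOpen (Ω ∩ (fun y => (α y, I y)) ⁻¹' (Metric.ball (α x) κ ×ˢ Metric.ball (I x) κ)) :=
    ((hα.prodMk hI).mono hΩX).isOpen_inter_preimage hΩ
      (Metric.isOpen_ball.prod Metric.isOpen_ball)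
  refine ⟨_, hN, ⟨hx, Metric.mem_ball_self hκ, Metric.mem_ball_self hκ⟩, inter_subset_left,
    fun c => J (Φ (α x, c)), ?_, fun y hy => ?_⟩
  · refine hJ.comp (hΦ.comp (contDiff_const.prodMk contDiff_id).contDiffOn ?_) ?_
    · rintro _ ⟨y, hy, rfl⟩
      exact (hball (mk_mem_prod (Metric.mem_ball_self hκ) hy.2.2)).1
    · rintro _ ⟨y, hy, rfl⟩
      exact (hball (mk_mem_prod (Metric.mem_ball_self hκ) hy.2.2)).2
  · have h := eq_on_fiber hD hΦ hΩ hJ hzero Metric.isOpen_ball (convex_ball (α x) κ)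
      (c := I y) (fun a ha => hball ⟨ha, hy.2.2⟩) hy.2.1 (Metric.mem_ball_self hκ)
    rwa [(hinv y (hΩX hy.1)).2] at h

/-- A function which is constant along the fibers of a chart adapted to `I` is globally a function
of `I` if the fibers are convex. -/
theorem isFunctionOf_of_chart (hX : IsOpen X) (hD : IsOpen D) (hΦ : ContDiffOn ℝ 1 Φ D)
    (hinv : ∀ x ∈ X, (α x, I x) ∈ D ∧ Φ (α x, I x) = x) (hΦX : MapsTo Φ D X)
    (hJ : ContDiffOn ℝ 1 J X) (hconv : ∀ x ∈ X, Convex ℝ {a | (a, I x) ∈ D})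
    {σ : (Fin k → ℝ) → (Fin m → ℝ)} (hσ : ContDiffOn ℝ 1 σ (I '' X))
    (hσD : ∀ x ∈ X, (σ (I x), I x) ∈ D)
    (hzero : ∀ z ∈ D, ∀ v, ∃ w, HasDerivAt (fun s : ℝ => Φ (z.1 + s • v, z.2)) w 0 ∧
      fderiv ℝ J (Φ z) w = 0) : IsFunctionOf I J X := by
  -- σ selects a base point on each fibre, to which convexity connects all other points of that
  -- fibre.
  refine ⟨fun c => J (Φ (σ c, c)), ?_, fun x hx => ?_⟩
  · refine hJ.comp (hΦ.comp (hσ.prodMk contDiffOn_id) ?_) ?_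
    · rintro _ ⟨y, hy, rfl⟩
      exact hσD y hy
    · rintro _ ⟨y, hy, rfl⟩
      exact hΦX (hσD y hy)
  · have h := eq_on_fiber hD hΦ hX hJ (fun z hz _ => hzero z hz)
      (B := {a | (a, I x) ∈ D}) (hD.preimage (by fun_prop)) (hconv x hx)
      (c := I x) (fun a ha => ⟨ha, hΦX ha⟩) (hinv x hx).1 (hσD x hx)
    rwa [(hinv x hx).2] at h

theorem IsFunctionOf.isLocallyFunctionOf (hΩ : IsOpen Ω) (h : IsFunctionOf I J Ω) :
    IsLocallyFunctionOf I J Ω := fun _ hx => ⟨Ω, hΩ, hx, Subset.rfl, h⟩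

end Charts

/-! ### Invariants of a general equation of state -/

theorem IsEquationOfState.isOpen_jetDomain {R Q : Set ℝ} {p : ℝ → ℝ → ℝ}
    (hp : IsEquationOfState R Q p) : IsOpen (jetDomain R Q) := by
  have h1 : Continuous fun x : Jet => x.r := continuous_apply 1
  have h2 : Continuous fun x : Jet => x.ρ := continuous_apply 3
  have h3 : Continuous fun x : Jet => x.S := continuous_apply 4
  exact (isOpen_lt continuous_const h1).inter ((hp.isOpen_density.preimage h2).inter
    (hp.isOpen_entropy.preimage h3))

theorem entropyGradient_eq {n : ℕ} (hn : 1 ≤ n) (x : Jet) :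
    entropyGradient n x = x.Sr / (x.r ^ (n - 1) * x.ρ) := by
  have h : x.r ^ (1 - (n : ℤ)) = (x.r ^ (n - 1))⁻¹ := by
    rw [show (1 : ℤ) - n = -((n - 1 : ℕ) : ℤ) by push_cast [hn]; ring, zpow_neg, zpow_natCast]
  rw [entropyGradient, h, inv_mul_eq_div, div_div]

section General

variable {n : ℕ} {R Q : Set ℝ} {p : ℝ → ℝ → ℝ} {Ω : Set Jet} {J : Jet → ℝ}

theorem contDiffOn_generalInvariants (hn : 1 ≤ n) (hp : IsEquationOfState R Q p) :
    ContDiffOn ℝ 1 (generalInvariants n) (jetDomain R Q) := by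
  rw [contDiffOn_pi]
  intro i
  fin_cases i
  · exact (contDiff_apply ℝ ℝ (4 : Fin 8)).contDiffOn
  · change ContDiffOn ℝ 1 (fun x => entropyGradient n x) _
    simp only [entropyGradient_eq hn]
    refine ContDiffOn.div (contDiff_apply ℝ ℝ (7 : Fin 8)).contDiffOn
      (((contDiff_apply ℝ ℝ (1 : Fin 8)).pow _).mul (contDiff_apply ℝ ℝ (3 : Fin 8))).contDiffOn ?_
    intro x hx
    exact mul_ne_zero (pow_ne_zero _ (ne_of_gt hx.1)) (hp.density_pos _ hx.2.1).ne'

theorem hasDerivAt_line (x v : Jet) (i : Fin 8) : HasDerivAt (fun s : ℝ => (x + s • v) i) (v i) 0 := by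
  simpa using ((hasDerivAt_id (0 : ℝ)).mul_const (v i)).const_add (x i)

/-- In the mass coordinate dm = ρ r^(n-1) dr the quantity is dS/dm. Particles carry both S and m, so
it is constant along them, whatever p is. -/
theorem hasDerivAt_entropyGradient (hn : 1 ≤ n) (hp : IsEquationOfState R Q p) {x : Jet}
    (hx : x ∈ jetDomain R Q) (U₂ ρ₂ S₂ : ℝ) :
    HasDerivAt (fun s : ℝ => entropyGradient n (x + s • jetVelocity n p x U₂ ρ₂ S₂)) 0 0 := by
  simp only [entropyGradient_eq hn]
  have hr : x.r ≠ 0 := ne_of_gt hx.1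
  have hρ : x.ρ ≠ 0 := (hp.density_pos _ hx.2.1).ne'
  have hl := hasDerivAt_line x (jetVelocity n p x U₂ ρ₂ S₂)
  have h := (hl 7).fun_div (((hl 1).fun_pow (n - 1)).fun_mul (hl 3)) (by
    simpa using ⟨fun h => absurd h hr, hρ⟩)
  refine h.congr_deriv ?_
  obtain ⟨m, rfl⟩ : ∃ m, n = m + 1 := ⟨n - 1, by omega⟩
  simp only [zero_smul, add_zero, Nat.add_sub_cancel, jetVelocity]
  have hr' : x 1 ≠ 0 := hr
  have hρ' : x 3 ≠ 0 := hρ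
  rcases m with _ | m
  · simp
    left
    ring
  · simp [pow_succ]
    left
    field_simp
    ring

theorem fderiv_eq_zero_of_generalInvariants (hn : 1 ≤ n) (hp : IsEquationOfState R Q p)
    (hsub : Ω ⊆ jetDomain R Q) (h : IsLocallyFunctionOf (generalInvariants n) J Ω) :
    ∀ x ∈ Ω, ∀ U₂ ρ₂ S₂ : ℝ, fderiv ℝ J x (jetVelocity n p x U₂ ρ₂ S₂) = 0 := by
  intro x hx U₂ ρ₂ S₂
  refine fderiv_eq_zero_of_isLocallyFunctionOf h hx
    (hasFDerivAt_of_contDiffOn_one hp.isOpen_jetDomain (contDiffOn_generalInvariants hn hp)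
      (hsub hx)).differentiableAt fun i => ?_
  fin_cases i
  · exact (hasDerivAt_line x _ 4).congr_deriv (by simp [jetVelocity])
  · exact hasDerivAt_entropyGradient hn hp (hsub hx) U₂ ρ₂ S₂

/-- The parametrization of jets by `(t, r, U, ρ, U_r, ρ_r)` and the general invariants. -/
def generalChart (n : ℕ) (z : (Fin 6 → ℝ) × (Fin 2 → ℝ)) : Jet :=
  ![z.1 0, z.1 1, z.1 2, z.1 3, z.2 0, z.1 4, z.1 5, z.2 1 * z.1 3 * z.1 1 ^ (n - 1)]

/-- The domain of `generalChart`. -/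
def generalChartDomain (R Q : Set ℝ) : Set ((Fin 6 → ℝ) × (Fin 2 → ℝ)) :=
  {z | 0 < z.1 1 ∧ z.1 3 ∈ R ∧ z.2 0 ∈ Q}

/-- The coordinates complementary to the general invariants. -/
def generalFiberCoord (x : Jet) : Fin 6 → ℝ := ![x.t, x.r, x.U, x.ρ, x.Ur, x.ρr]

theorem isOpen_generalChartDomain (hp : IsEquationOfState R Q p) :
    IsOpen (generalChartDomain R Q) := by
  have h1 : Continuous fun z : (Fin 6 → ℝ) × (Fin 2 → ℝ) => z.1 1 := by fun_prop
  have h2 : Continuous fun z : (Fin 6 → ℝ) × (Fin 2 → ℝ) => z.1 3 := by fun_prop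
  have h3 : Continuous fun z : (Fin 6 → ℝ) × (Fin 2 → ℝ) => z.2 0 := by fun_prop
  exact (isOpen_lt continuous_const h1).inter ((hp.isOpen_density.preimage h2).inter
    (hp.isOpen_entropy.preimage h3))

theorem contDiff_generalChart (n : ℕ) : ContDiff ℝ 1 (generalChart n) := by
  rw [contDiff_pi]
  intro i
  fin_cases i <;> simp [generalChart] <;> fun_prop

theorem generalChart_invariants (hn : 1 ≤ n) (hp : IsEquationOfState R Q p) {x : Jet}
    (hx : x ∈ jetDomain R Q) : (generalFiberCoord x, generalInvariants n x) ∈ generalChartDomain R Q ∧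
      generalChart n (generalFiberCoord x, generalInvariants n x) = x := by
  refine ⟨hx, ?_⟩
  have hr : x.r ≠ 0 := ne_of_gt hx.1
  have hρ : x.ρ ≠ 0 := (hp.density_pos _ hx.2.1).ne'
  ext i
  fin_cases i
  all_goals first | rfl | skip
  simp [generalChart, generalFiberCoord, generalInvariants, entropyGradient_eq hn]
  field_simp

theorem continuous_generalFiberCoord : Continuous generalFiberCoord := by
  refine continuous_pi fun i => ?_
  fin_cases i <;> exact continuous_apply _

/-- With I = S_r/(ρ r^(n-1)) fixed, S_r = I ρ r^(n-1) has to follow r and ρ, which gives the last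
component of w. The directions t, U, U_r, ρ_r annihilate J one by one; `ha'` and `h1'` treat the
directions of ρ and r. -/
theorem generalChart_fiber_derivative (hp : IsEquationOfState R Q p) (hn : 1 ≤ n)
    (hne : ¬ IsEntropic R Q p)
    (hΩ : IsOpen Ω) (hsub : Ω ⊆ jetDomain R Q) (hJ : ContDiffOn ℝ 1 J Ω)
    (h : ∀ x ∈ Ω, ∀ U₂ ρ₂ S₂ : ℝ, fderiv ℝ J x (jetVelocity n p x U₂ ρ₂ S₂) = 0) :
    ∀ z ∈ generalChartDomain R Q, generalChart n z ∈ Ω → ∀ v, ∃ w,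
      HasDerivAt (fun s : ℝ => generalChart n (z.1 + s • v, z.2)) w 0 ∧
      fderiv ℝ J (generalChart n z) w = 0 := by
  intro z hz hzΩ v
  have hl : ∀ j, HasDerivAt (fun s : ℝ => (z.1 + s • v) j) (v j) 0 := fun j => by
    simpa using ((hasDerivAt_id (0 : ℝ)).mul_const (v j)).const_add (z.1 j)
  refine ⟨![v 0, v 1, v 2, v 3, 0, v 4, v 5, z.2 1 * v 3 * z.1 1 ^ (n - 1) +
    z.2 1 * z.1 3 * (((n - 1 : ℕ) : ℝ) * z.1 1 ^ (n - 1 - 1) * v 1)], ?_, ?_⟩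
  · refine hasDerivAt_pi.2 fun i => ?_
    fin_cases i
    · exact hl 0
    · exact hl 1
    · exact hl 2
    · exact hl 3
    · exact hasDerivAt_const _ _
    · exact hl 4
    · exact hl 5
    · have h7 := ((hl 3).const_mul (z.2 1)).fun_mul ((hl 1).fun_pow (n - 1))
      exact h7.congr_deriv (by simp)
  · obtain ⟨h5, h6, ha, -⟩ := jetPartials_of_invariant hp hΩ hsub hJ h
    obtain ⟨h0, h2, h1⟩ := jetPartials_of_invariant_of_not_isEntropic hp hne hΩ hsub hJ h _ hzΩ
    have ha := ha _ hzΩ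
    have hr : z.1 1 ≠ 0 := ne_of_gt hz.1
    have hρ : z.1 3 ≠ 0 := (hp.density_pos _ hz.2.1).ne'
    rw [fderiv_jet_apply, h0, h2, h5 _ hzΩ, h6 _ hzΩ]
    simp [generalChart] at h1 ha ⊢
    obtain ⟨m, rfl⟩ : ∃ m, n = m + 1 := ⟨n - 1, by omega⟩
    set J1 := jetPartial J 1 _
    set J3 := jetPartial J 3 _
    set J7 := jetPartial J 7 _
    have ha' : J3 + z.2 1 * z.1 1 ^ m * J7 = 0 := by
      have : z.1 3 * (J3 + z.2 1 * z.1 1 ^ m * J7) = 0 := by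
        simp only [Nat.add_sub_cancel] at ha
        linear_combination ha
      exact (mul_eq_zero.1 this).resolve_left hρ
    have h1' : J1 + z.2 1 * z.1 3 * (m * z.1 1 ^ (m - 1)) * J7 = 0 := by
      have : z.1 1 * (J1 + z.2 1 * z.1 3 * (m * z.1 1 ^ (m - 1)) * J7) = 0 := by
        -- The exponent m - 1 is truncated at m = 0, where the factor m vanishes anyway.
        have hpow : (m : ℝ) * (z.1 1 * z.1 1 ^ (m - 1)) = m * z.1 1 ^ m := by
          rcases m with _ | m
          · simp
          · rw [Nat.add_sub_cancel, pow_succ']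
        push_cast at h1
        linear_combination h1 + m * z.1 3 * ha' + z.2 1 * z.1 3 * J7 * hpow
      exact (mul_eq_zero.1 this).resolve_left hr
    simp only [Nat.add_sub_cancel]
    linear_combination v 1 * h1' + v 3 * ha'

theorem isLocallyFunctionOf_generalInvariants (hp : IsEquationOfState R Q p) (hn : 1 ≤ n)
    (hne : ¬ IsEntropic R Q p) (hΩ : IsOpen Ω) (hsub : Ω ⊆ jetDomain R Q)
    (hJ : ContDiffOn ℝ 1 J Ω)
    (h : ∀ x ∈ Ω, ∀ U₂ ρ₂ S₂ : ℝ, fderiv ℝ J x (jetVelocity n p x U₂ ρ₂ S₂) = 0) :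
    IsLocallyFunctionOf (generalInvariants n) J Ω :=
  isLocallyFunctionOf_of_chart (contDiffOn_generalInvariants hn hp).continuousOn
    continuous_generalFiberCoord.continuousOn (isOpen_generalChartDomain hp)
    (contDiff_generalChart n).contDiffOn (fun _ hx => generalChart_invariants hn hp hx) hΩ hsub hJ
    (generalChart_fiber_derivative hp hn hne hΩ hsub hJ h)

theorem isFunctionOf_generalInvariants (hp : IsEquationOfState R Q p) (hn : 1 ≤ n)
    (hne : ¬ IsEntropic R Q p) (hJ : ContDiffOn ℝ 1 J (jetDomain R Q))
    (h : ∀ x ∈ jetDomain R Q, ∀ U₂ ρ₂ S₂ : ℝ,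
      fderiv ℝ J x (jetVelocity n p x U₂ ρ₂ S₂) = 0) :
    IsFunctionOf (generalInvariants n) J (jetDomain R Q) := by
  obtain ⟨ρ₁, hρ₁⟩ := hp.nonempty_density
  have hmaps : MapsTo (generalChart n) (generalChartDomain R Q) (jetDomain R Q) := fun z hz => hz
  refine isFunctionOf_of_chart (α := generalFiberCoord) hp.isOpen_jetDomain
    (isOpen_generalChartDomain hp) (contDiff_generalChart n).contDiffOn
    (fun _ hx => generalChart_invariants hn hp hx) hmaps hJ (fun x hx => ?_)
    (σ := fun _ => ![0, 1, 0, ρ₁, 0, 0]) contDiffOn_const (fun x hx => ?_)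
    (fun z hz => generalChart_fiber_derivative hp hn hne hp.isOpen_jetDomain Subset.rfl hJ h z hz
      (hmaps hz))
  · have hR : Convex ℝ R := hp.isPreconnected_density.ordConnected.convex
    have h1 : IsLinearMap ℝ fun a : Fin 6 → ℝ => a 1 := ⟨fun _ _ => rfl, fun _ _ => rfl⟩
    have h3 : IsLinearMap ℝ fun a : Fin 6 → ℝ => a 3 := ⟨fun _ _ => rfl, fun _ _ => rfl⟩
    have : {a | (a, generalInvariants n x) ∈ generalChartDomain R Q} =
        (fun a : Fin 6 → ℝ => a 1) ⁻¹' Ioi 0 ∩ (fun a : Fin 6 → ℝ => a 3) ⁻¹' R := by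
      ext a
      exact ⟨fun ha => ⟨ha.1, ha.2.1⟩, fun ha => ⟨ha.1, ha.2, hx.2.2⟩⟩
    rw [this]
    exact ((convex_Ioi 0).is_linear_preimage h1).inter (hR.is_linear_preimage h3)
  · exact ⟨by simp, by simpa using hρ₁, hx.2.2⟩

end General

/-! ### The travel time -/

/-- `∫_0^1 dy / √(E - z y^n)`; the travel time is `r` times this function of the energy `E` and
`z = (2/n) r q`. -/
noncomputable def travelProfile (n : ℕ) (w : ℝ × ℝ) : ℝ :=
  ∫ y in (0 : ℝ)..1, (√(w.1 - w.2 * y ^ n))⁻¹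

theorem travelTime_eq (n : ℕ) (r U q : ℝ) : travelTime n r U q =
    r * travelProfile n (U ^ 2 + 2 / (n : ℝ) * r * q, 2 / (n : ℝ) * r * q) := by
  rw [travelTime, travelProfile, ← intervalIntegral.integral_const_mul]
  refine intervalIntegral.integral_congr fun y _ => ?_
  simp only [div_eq_mul_inv]
  congr 3
  ring

/-- The expression is affine in y^n ∈ [0, 1] and positive at both ends. -/
theorem sub_mul_pow_pos {n : ℕ} {E z y : ℝ} (hE : 0 < E) (hz : 0 < E - z)
    (hy : y ∈ Icc (0 : ℝ) 1) : 0 < E - z * y ^ n := by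
  have h0 : 0 ≤ y ^ n := pow_nonneg hy.1 n
  have h1 : y ^ n ≤ 1 := pow_le_one₀ hy.1 hy.2
  rcases le_or_gt z 0 with h | h
  · nlinarith
  · nlinarith

theorem contDiffAt_travelProfile (n : ℕ) {w : ℝ × ℝ} (hE : 0 < w.1) (hz : 0 < w.1 - w.2) :
    ContDiffAt ℝ 1 (travelProfile n) w := by
  have hc : Continuous fun q : (ℝ × ℝ) × ℝ => q.1.1 - q.1.2 * q.2 ^ n := by fun_prop
  refine contDiffAt_integral_segment (F := fun q : (ℝ × ℝ) × ℝ => (√(q.1.1 - q.1.2 * q.2 ^ n))⁻¹)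
    (W := {q | 0 < q.1.1 - q.1.2 * q.2 ^ n}) (isOpen_lt continuous_const hc) ?_
    fun y hy => sub_mul_pow_pos hE hz hy
  intro q hq
  have hd : ContDiffAt ℝ 1 (fun q : (ℝ × ℝ) × ℝ => q.1.1 - q.1.2 * q.2 ^ n) q := by fun_prop
  exact ((hd.sqrt (ne_of_gt hq)).inv (Real.sqrt_ne_zero'.2 hq)).contDiffWithinAt

/-- The substitution s = r y turns the function into ∫_0^r ds/√(E - κ s^n), the travel time from the
centre at speed √(E - κ s^n), and the fundamental theorem of calculus applies. -/
theorem hasDerivAt_mul_travelProfile {n : ℕ} {E κ r : ℝ} (hE : 0 < E) (hr : 0 < r)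
    (hz : 0 < E - κ * r ^ n) :
    HasDerivAt (fun r => r * travelProfile n (E, κ * r ^ n)) (√(E - κ * r ^ n))⁻¹ r := by
  have heq : (fun r => r * travelProfile n (E, κ * r ^ n)) =
      fun r => ∫ s in (0 : ℝ)..r, (√(E - κ * s ^ n))⁻¹ := by
    ext r
    have h := intervalIntegral.mul_integral_comp_mul_left (a := 0) (b := 1)
      (f := fun s => (√(E - κ * s ^ n))⁻¹) r
    rw [mul_zero, mul_one] at h
    rw [← h, travelProfile]
    congr 1
    refine intervalIntegral.integral_congr fun y _ => ?_
    simp only [mul_pow, mul_assoc]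
  rw [heq]
  have hpos : ∀ s ∈ uIcc 0 r, 0 < E - κ * s ^ n := by
    intro s hs
    rw [uIcc_of_le hr.le] at hs
    have h := sub_mul_pow_pos (n := n) (y := s / r) hE hz
      ⟨div_nonneg hs.1 hr.le, (div_le_one hr).2 hs.2⟩
    rwa [mul_assoc, ← mul_pow, mul_div_cancel₀ _ hr.ne'] at h
  have hcont : ∀ s ∈ uIcc 0 r, ContinuousAt (fun s => (√(E - κ * s ^ n))⁻¹) s := by
    intro s hs
    have hc : ContinuousAt (fun s => √(E - κ * s ^ n)) s := by fun_prop
    exact hc.inv₀ (Real.sqrt_ne_zero'.2 (hpos s hs))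
  refine intervalIntegral.integral_hasDerivAt_right
    (ContinuousOn.intervalIntegrable fun s hs => (hcont s hs).continuousWithinAt) ?_
    (hcont r right_mem_uIcc)
  have hm : Measurable fun s : ℝ => (√(E - κ * s ^ n))⁻¹ := by fun_prop
  exact hm.stronglyMeasurable.stronglyMeasurableAtFilter

/-- The chain rule for r ↦ r ψ(E, z r^n) at r = 1, with ψ the profile, compared with
`hasDerivAt_mul_travelProfile`. It avoids computing the z-derivative of the integral. -/
theorem travelProfile_add_fderiv {n : ℕ} {E z : ℝ} (hE : 0 < E) (hz : 0 < E - z) :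
    travelProfile n (E, z) + n * z * fderiv ℝ (travelProfile n) (E, z) (0, 1) = (√(E - z))⁻¹ := by
  have h1 := hasDerivAt_mul_travelProfile (n := n) (κ := z) (r := 1) hE one_pos (by simpa using hz)
  have h2 : HasFDerivAt (travelProfile n) (fderiv ℝ (travelProfile n) (E, z))
      (E, z * (1 : ℝ) ^ n) := by
    simpa using ((contDiffAt_travelProfile n (w := (E, z)) hE hz).differentiableAt
      one_ne_zero).hasFDerivAt
  have h3 : HasDerivAt (fun r : ℝ => (E, z * r ^ n)) (0, z * (n * 1 ^ (n - 1))) 1 :=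
    (hasDerivAt_const _ _).prodMk ((hasDerivAt_pow n 1).const_mul z)
  have h4 := (hasDerivAt_id (1 : ℝ)).mul (h2.comp_hasDerivAt (1 : ℝ) h3)
  have h5 := h4.unique h1
  rw [clm_plane_apply] at h5
  simp only [id, one_pow, mul_one, one_mul, Function.comp_apply, zero_mul, zero_add] at h5
  linear_combination h5

/-! ### Invariants of an entropic equation of state -/

section Entropic

variable {n : ℕ} {R Q : Set ℝ} {p : ℝ → ℝ → ℝ} {Ω : Set Jet} {J : Jet → ℝ} {ε ρ₁ : ℝ}

theorem contDiffOn_pressureForce (hp : IsEquationOfState R Q p) :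
    ContDiffOn ℝ 1 (pressureForce p) (jetDomain R Q) := by
  intro x hx
  refine ContDiffAt.contDiffWithinAt ?_
  have hz : (x.ρ, x.S) ∈ R ×ˢ Q := hx.2
  have hpair : ContDiffAt ℝ 1 (fun x : Jet => (x.ρ, x.S)) x :=
    ((contDiff_apply ℝ ℝ (3 : Fin 8)).prodMk (contDiff_apply ℝ ℝ (4 : Fin 8))).contDiffAt
  have h1 : ContDiffAt ℝ 1 (fun x : Jet => pRho p x.ρ x.S) x :=
    ContDiffAt.comp (g := fun z : ℝ × ℝ => pRho p z.1 z.2) x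
      (hp.analyticOnNhd_pRho _ hz).contDiffAt hpair
  have h2 : ContDiffAt ℝ 1 (fun x : Jet => pS p x.ρ x.S) x :=
    ContDiffAt.comp (g := fun z : ℝ × ℝ => pS p z.1 z.2) x
      (hp.analyticOnNhd_pS _ hz).contDiffAt hpair
  exact ((h2.mul (contDiff_apply ℝ ℝ (7 : Fin 8)).contDiffAt).add
    (h1.mul (contDiff_apply ℝ ℝ (6 : Fin 8)).contDiffAt)).div
    (contDiff_apply ℝ ℝ (3 : Fin 8)).contDiffAt (hp.density_pos _ hx.2.1).ne'

theorem contDiffOn_energyInvariant (n : ℕ) (hp : IsEquationOfState R Q p) :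
    ContDiffOn ℝ 1 (energyInvariant n p) (jetDomain R Q) :=
  ((contDiff_apply ℝ ℝ (2 : Fin 8)).pow 2).contDiffOn.add
    ((contDiff_const.mul (contDiff_apply ℝ ℝ (1 : Fin 8))).contDiffOn.mul
      (contDiffOn_pressureForce hp))

theorem isOpen_travelDomain (n : ℕ) (hp : IsEquationOfState R Q p) (ε : ℝ) :
    IsOpen (travelDomain n R Q p ε) := by
  have h1 : IsOpen (jetDomain R Q ∩ energyInvariant n p ⁻¹' Ioi 0) :=
    (contDiffOn_energyInvariant n hp).continuousOn.isOpen_inter_preimage hp.isOpen_jetDomain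
      isOpen_Ioi
  have h2 : Continuous fun x : Jet => ε * x.U := continuous_const.mul (continuous_apply 2)
  have h3 := h1.inter (isOpen_lt (continuous_const (y := (0 : ℝ))) h2)
  convert h3 using 1
  ext x
  exact ⟨fun h => ⟨⟨h.1, h.2.2⟩, h.2.1⟩, fun h => ⟨h.1.1, h.2, h.1.2⟩⟩

theorem energyInvariant_sub (n : ℕ) (p : ℝ → ℝ → ℝ) (x : Jet) :
    energyInvariant n p x - 2 / (n : ℝ) * x.r * pressureForce p x = x.U ^ 2 := by
  rw [energyInvariant]; ring

theorem travelTime_jet (n : ℕ) (p : ℝ → ℝ → ℝ) (x : Jet) :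
    travelTime n x.r x.U (pressureForce p x) = x.r * travelProfile n
      (energyInvariant n p x, 2 / (n : ℝ) * x.r * pressureForce p x) := travelTime_eq _ _ _ _

theorem velocity_sq_pos {x : Jet} (hx : x ∈ travelDomain n R Q p ε) :
    0 < energyInvariant n p x - 2 / (n : ℝ) * x.r * pressureForce p x := by
  rw [energyInvariant_sub]
  have : x.U ≠ 0 := by
    intro h
    have := hx.2.1
    rw [h, mul_zero] at this
    exact lt_irrefl _ this
  positivity

theorem contDiffOn_entropicInvariants (hn : 1 ≤ n) (hp : IsEquationOfState R Q p) (ε : ℝ) :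
    ContDiffOn ℝ 1 (entropicInvariants n p ε) (travelDomain n R Q p ε) := by
  have hsub : travelDomain n R Q p ε ⊆ jetDomain R Q := fun x hx => hx.1
  have hg := contDiffOn_pi.1 ((contDiffOn_generalInvariants hn hp).mono hsub)
  have hE := (contDiffOn_energyInvariant n hp).mono hsub
  have hF := (contDiffOn_pressureForce hp).mono hsub
  have hr : ContDiffOn ℝ 1 (fun x : Jet => x.r) (travelDomain n R Q p ε) :=
    (contDiff_apply ℝ ℝ (1 : Fin 8)).contDiffOn
  have ht : ContDiffOn ℝ 1 (fun x : Jet => x.t) (travelDomain n R Q p ε) :=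
    (contDiff_apply ℝ ℝ (0 : Fin 8)).contDiffOn
  rw [contDiffOn_pi]
  intro i
  fin_cases i
  · exact hg 0
  · exact hg 1
  · exact hE
  · change ContDiffOn ℝ 1 (fun x : Jet =>
      ε * travelTime n x.r x.U (pressureForce p x) - x.t) _
    simp only [travelTime_jet]
    have hpair := hE.prodMk ((contDiffOn_const (c := 2 / (n : ℝ))).mul hr |>.mul hF)
    have hψ : ContDiffOn ℝ 1 (fun x : Jet => travelProfile n
        (energyInvariant n p x, 2 / (n : ℝ) * x.r * pressureForce p x))
        (travelDomain n R Q p ε) := fun x hx =>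
      (contDiffAt_travelProfile n hx.2.2 (velocity_sq_pos hx)).comp_contDiffWithinAt x (hpair x hx)
    exact (contDiffOn_const.mul (hr.mul hψ)).sub ht

theorem pRho_eq_zero_of_isEntropic (hp : IsEquationOfState R Q p) (he : IsEntropic R Q p) {ρ S : ℝ}
    (hρ : ρ ∈ R) (hS : S ∈ Q) : pRho p ρ S = 0 := by
  obtain ⟨κ, hκ⟩ := he
  have h : (fun q => p q S) =ᶠ[𝓝 ρ] fun _ => κ S := by
    filter_upwards [hp.isOpen_density.mem_nhds hρ] with q hq using hκ q hq S hS
  rw [pRho, h.deriv_eq, deriv_const]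

theorem pS_eq_of_isEntropic (hp : IsEquationOfState R Q p) (he : IsEntropic R Q p) {ρ ρ' S : ℝ}
    (hρ : ρ ∈ R) (hρ' : ρ' ∈ R) (hS : S ∈ Q) : pS p ρ S = pS p ρ' S := by
  obtain ⟨κ, hκ⟩ := he
  have h : (fun s => p ρ s) =ᶠ[𝓝 S] fun s => p ρ' s := by
    filter_upwards [hp.isOpen_entropy.mem_nhds hS] with s hs
    rw [hκ ρ hρ s hs, hκ ρ' hρ' s hs]
  rw [pS, pS, h.deriv_eq]

theorem pressureForce_of_isEntropic (hp : IsEquationOfState R Q p) (he : IsEntropic R Q p)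
    (hρ₁ : ρ₁ ∈ R) {x : Jet} (hx : x ∈ jetDomain R Q) :
    pressureForce p x = pS p ρ₁ x.S * x.Sr / x.ρ := by
  rw [pressureForce, pRho_eq_zero_of_isEntropic hp he hx.2.1 hx.2.2, zero_mul, add_zero,
    pS_eq_of_isEntropic hp he hx.2.1 hρ₁ hx.2.2]

/-- For p = κ(S) the force is κ'(S) I r^(n-1) with S and I = r^(1-n) S_r/ρ constant along particles,
so only the power of r contributes. -/
theorem hasDerivAt_pressureForce (hp : IsEquationOfState R Q p) (he : IsEntropic R Q p) {x : Jet}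
    (hx : x ∈ jetDomain R Q) (U₂ ρ₂ S₂ : ℝ) :
    HasDerivAt (fun s : ℝ => pressureForce p (x + s • jetVelocity n p x U₂ ρ₂ S₂))
      (((n : ℝ) - 1) * x.U / x.r * pressureForce p x) 0 := by
  have hρ : x.ρ ≠ 0 := (hp.density_pos _ hx.2.1).ne'
  have hl := hasDerivAt_line x (jetVelocity n p x U₂ ρ₂ S₂)
  have h := ((hl 7).const_mul (pS p x.ρ x.S)).fun_div (hl 3) (by simpa using hρ)
  have hc : ContinuousAt (fun s : ℝ => x + s • jetVelocity n p x U₂ ρ₂ S₂) 0 := by fun_prop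
  have hmem : ∀ᶠ s in 𝓝 (0 : ℝ), x + s • jetVelocity n p x U₂ ρ₂ S₂ ∈ jetDomain R Q :=
    hc.preimage_mem_nhds (hp.isOpen_jetDomain.mem_nhds (by simpa using hx))
  refine (h.congr_of_eventuallyEq ?_).congr_deriv ?_
  · filter_upwards [hmem] with s hs
    -- The S-component of `jetVelocity` is 0, so the coefficient p_S stays fixed along the line.
    have h4 : (x + s • jetVelocity n p x U₂ ρ₂ S₂).S = x.S := by
      change x 4 + s * (0 : ℝ) = x 4
      ring
    rw [pressureForce_of_isEntropic hp he hx.2.1 hs, h4]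
  · rw [pressureForce_of_isEntropic hp he hx.2.1 hx]
    have hρ' : x 3 ≠ 0 := hρ
    simp [jetVelocity]
    field_simp
    ring

/-- A particle obeys r'' = -c r^(n-1) with c constant, and r'² + (2/n) c r^n is the energy of this
motion. -/
theorem hasDerivAt_energyInvariant (hn : 1 ≤ n) (hp : IsEquationOfState R Q p)
    (he : IsEntropic R Q p) {x : Jet} (hx : x ∈ jetDomain R Q) (U₂ ρ₂ S₂ : ℝ) :
    HasDerivAt (fun s : ℝ => energyInvariant n p (x + s • jetVelocity n p x U₂ ρ₂ S₂)) 0 0 := by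
  have hl := hasDerivAt_line x (jetVelocity n p x U₂ ρ₂ S₂)
  have h := ((hl 2).fun_pow 2).fun_add (((hl 1).const_mul (2 / (n : ℝ))).fun_mul
    (hasDerivAt_pressureForce (n := n) hp he hx U₂ ρ₂ S₂))
  refine h.congr_deriv ?_
  have hr : x 1 ≠ 0 := ne_of_gt hx.1
  have hn0 : (n : ℝ) ≠ 0 := by positivity
  simp [jetVelocity]
  field_simp
  ring

/-- E is constant and z = (2/n) r p_r/ρ has derivative n z U/r, so the result is U (ψ + n z ∂_z ψ)
with ψ the profile; `travelProfile_add_fderiv` evaluates the bracket. -/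
theorem hasDerivAt_travelTime (hn : 1 ≤ n) (hp : IsEquationOfState R Q p)
    (he : IsEntropic R Q p) {x : Jet} (hx : x ∈ travelDomain n R Q p ε) (U₂ ρ₂ S₂ : ℝ) :
    HasDerivAt (fun s : ℝ => travelTime n (x + s • jetVelocity n p x U₂ ρ₂ S₂).r
      (x + s • jetVelocity n p x U₂ ρ₂ S₂).U
      (pressureForce p (x + s • jetVelocity n p x U₂ ρ₂ S₂))) (x.U * (√(x.U ^ 2))⁻¹) 0 := by
  simp only [travelTime_jet]
  have hl := hasDerivAt_line x (jetVelocity n p x U₂ ρ₂ S₂)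
  have hE := hasDerivAt_energyInvariant hn hp he hx.1 U₂ ρ₂ S₂
  have hF := hasDerivAt_pressureForce (n := n) hp he hx.1 U₂ ρ₂ S₂
  have hpair := hE.prodMk (((hl 1).const_mul (2 / (n : ℝ))).fun_mul hF)
  have hψ : HasFDerivAt (travelProfile n) (fderiv ℝ (travelProfile n)
      (energyInvariant n p x, 2 / (n : ℝ) * x.r * pressureForce p x))
      (energyInvariant n p (x + (0 : ℝ) • jetVelocity n p x U₂ ρ₂ S₂),
        2 / (n : ℝ) * (x + (0 : ℝ) • jetVelocity n p x U₂ ρ₂ S₂) 1 *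
          pressureForce p (x + (0 : ℝ) • jetVelocity n p x U₂ ρ₂ S₂)) := by
    rw [zero_smul, add_zero]
    exact ((contDiffAt_travelProfile n hx.2.2 (velocity_sq_pos hx)).differentiableAt
      one_ne_zero).hasFDerivAt
  have h := (hl 1).mul (hψ.comp_hasDerivAt (0 : ℝ) hpair)
  refine h.congr_deriv ?_
  have hid := travelProfile_add_fderiv (n := n) hx.2.2 (velocity_sq_pos hx)
  rw [energyInvariant_sub] at hid
  have hr : x 1 ≠ 0 := ne_of_gt hx.1.1
  have hn0 : (n : ℝ) ≠ 0 := by positivity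
  have hv : jetVelocity n p x U₂ ρ₂ S₂ 1 = x.U := rfl
  rw [← hid, clm_plane_apply]
  simp only [zero_smul, add_zero, Function.comp_apply, hv, zero_mul, zero_add]
  field_simp
  ring

theorem fderiv_eq_zero_of_entropicInvariants (hn : 1 ≤ n) (hp : IsEquationOfState R Q p)
    (he : IsEntropic R Q p) (hε : ε = 1 ∨ ε = -1) (hsub : Ω ⊆ travelDomain n R Q p ε)
    (h : IsLocallyFunctionOf (entropicInvariants n p ε) J Ω) :
    ∀ x ∈ Ω, ∀ U₂ ρ₂ S₂ : ℝ, fderiv ℝ J x (jetVelocity n p x U₂ ρ₂ S₂) = 0 := by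
  intro x hx U₂ ρ₂ S₂
  have hxd := hsub hx
  refine fderiv_eq_zero_of_isLocallyFunctionOf h hx
    (hasFDerivAt_of_contDiffOn_one (isOpen_travelDomain n hp ε)
      (contDiffOn_entropicInvariants hn hp ε) hxd).differentiableAt fun i => ?_
  fin_cases i
  · exact (hasDerivAt_line x _ 4).congr_deriv (by simp [jetVelocity])
  · exact hasDerivAt_entropyGradient hn hp hxd.1 U₂ ρ₂ S₂
  · exact hasDerivAt_energyInvariant hn hp he hxd.1 U₂ ρ₂ S₂
  · refine (((hasDerivAt_travelTime hn hp he hxd U₂ ρ₂ S₂).const_mul ε).sub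
      (hasDerivAt_line x _ 0)).congr_deriv ?_
    have hU := hxd.2.1
    have hU0 : x.U ≠ 0 := by
      intro h0
      rw [h0, mul_zero] at hU
      exact lt_irrefl _ hU
    rw [Real.sqrt_sq_eq_abs]
    rcases hε with rfl | rfl
    · rw [abs_of_pos (by linarith)]
      simp [jetVelocity, hU0]
    · rw [abs_of_neg (by linarith)]
      simp [jetVelocity, inv_neg, hU0]

/-- The parametrization of jets by `(r, ρ, U_r, ρ_r)` and the entropic invariants, where `π = κ'`
and `ε` is the sign of the velocity. -/
noncomputable def entropicChart (n : ℕ) (π : ℝ → ℝ) (ε : ℝ)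
    (z : (Fin 4 → ℝ) × (Fin 4 → ℝ)) : Jet :=
  ![ε * (z.1 0 * travelProfile n (z.2 2, 2 / (n : ℝ) * π (z.2 0) * z.2 1 * z.1 0 ^ n)) - z.2 3,
    z.1 0, ε * √(z.2 2 - 2 / (n : ℝ) * π (z.2 0) * z.2 1 * z.1 0 ^ n), z.1 1, z.2 0, z.1 2, z.1 3,
    z.2 1 * z.1 1 * z.1 0 ^ (n - 1)]

/-- The domain of `entropicChart`. -/
def entropicChartDomain (n : ℕ) (R Q : Set ℝ) (π : ℝ → ℝ) : Set ((Fin 4 → ℝ) × (Fin 4 → ℝ)) :=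
  {z | 0 < z.1 0 ∧ z.1 1 ∈ R ∧ z.2 0 ∈ Q ∧ 0 < z.2 2 ∧
    0 < z.2 2 - 2 / (n : ℝ) * π (z.2 0) * z.2 1 * z.1 0 ^ n}

/-- The coordinates complementary to the entropic invariants. -/
def entropicFiberCoord (x : Jet) : Fin 4 → ℝ := ![x.r, x.ρ, x.Ur, x.ρr]

theorem contDiffOn_pS_slice (hp : IsEquationOfState R Q p) (hρ₁ : ρ₁ ∈ R) :
    ContDiffOn ℝ 1 (pS p ρ₁) Q := fun s hs =>
  ((hp.analyticOnNhd_pS (ρ₁, s) ⟨hρ₁, hs⟩).contDiffAt.comp s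
    (contDiffAt_const.prodMk contDiffAt_id)).contDiffWithinAt

theorem contDiffOn_chartPotential {π : ℝ → ℝ} (hπ : ContDiffOn ℝ 1 π Q) (n : ℕ) :
    ContDiffOn ℝ 1 (fun z : (Fin 4 → ℝ) × (Fin 4 → ℝ) =>
      2 / (n : ℝ) * π (z.2 0) * z.2 1 * z.1 0 ^ n) {z | z.2 0 ∈ Q} := by
  have h0 : ContDiffOn ℝ 1 (fun z : (Fin 4 → ℝ) × (Fin 4 → ℝ) => π (z.2 0)) {z | z.2 0 ∈ Q} :=
    hπ.comp (by fun_prop : ContDiffOn ℝ 1 (fun z : (Fin 4 → ℝ) × (Fin 4 → ℝ) => z.2 0) _)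
      fun z hz => hz
  have h1 : ContDiffOn ℝ 1 (fun z : (Fin 4 → ℝ) × (Fin 4 → ℝ) => z.2 1) {z | z.2 0 ∈ Q} := by
    fun_prop
  have h2 : ContDiffOn ℝ 1 (fun z : (Fin 4 → ℝ) × (Fin 4 → ℝ) => z.1 0 ^ n) {z | z.2 0 ∈ Q} := by
    fun_prop
  exact ((contDiffOn_const.mul h0).mul h1).mul h2

theorem isOpen_entropicChartDomain (hp : IsEquationOfState R Q p) {π : ℝ → ℝ}
    (hπ : ContDiffOn ℝ 1 π Q) (n : ℕ) : IsOpen (entropicChartDomain n R Q π) := by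
  have hQ : IsOpen {z : (Fin 4 → ℝ) × (Fin 4 → ℝ) | z.2 0 ∈ Q} :=
    hp.isOpen_entropy.preimage (by fun_prop)
  have hE : ContDiffOn ℝ 1 (fun z : (Fin 4 → ℝ) × (Fin 4 → ℝ) => z.2 2) {z | z.2 0 ∈ Q} := by
    fun_prop
  have h1 := (hE.sub (contDiffOn_chartPotential hπ n)).continuousOn.isOpen_inter_preimage hQ
    (isOpen_Ioi (a := (0 : ℝ)))
  have c1 : Continuous fun z : (Fin 4 → ℝ) × (Fin 4 → ℝ) => z.1 0 := by fun_prop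
  have c2 : Continuous fun z : (Fin 4 → ℝ) × (Fin 4 → ℝ) => z.1 1 := by fun_prop
  have c3 : Continuous fun z : (Fin 4 → ℝ) × (Fin 4 → ℝ) => z.2 2 := by fun_prop
  convert ((isOpen_lt continuous_const c1).inter (hp.isOpen_density.preimage c2)).inter
    ((isOpen_lt continuous_const c3).inter h1) using 1
  ext z
  exact ⟨fun h => ⟨⟨h.1, h.2.1⟩, h.2.2.2.1, h.2.2.1, h.2.2.2.2⟩,
    fun h => ⟨h.1.1, h.1.2, h.2.2.1, h.2.1, h.2.2.2⟩⟩

theorem contDiffOn_entropicChart {π : ℝ → ℝ} (hπ : ContDiffOn ℝ 1 π Q) (n : ℕ) (ε : ℝ) :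
    ContDiffOn ℝ 1 (entropicChart n π ε) (entropicChartDomain n R Q π) := by
  have hsub : entropicChartDomain n R Q π ⊆ {z | z.2 0 ∈ Q} := fun z hz => hz.2.2.1
  have hpot := (contDiffOn_chartPotential hπ n).mono hsub
  have hE : ContDiffOn ℝ 1 (fun z : (Fin 4 → ℝ) × (Fin 4 → ℝ) => z.2 2)
    (entropicChartDomain n R Q π) := by fun_prop
  have hψ : ContDiffOn ℝ 1 (fun z : (Fin 4 → ℝ) × (Fin 4 → ℝ) => travelProfile n
      (z.2 2, 2 / (n : ℝ) * π (z.2 0) * z.2 1 * z.1 0 ^ n)) (entropicChartDomain n R Q π) :=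
    fun z hz => (contDiffAt_travelProfile n hz.2.2.2.1 hz.2.2.2.2).comp_contDiffWithinAt z
      ((hE.prodMk hpot) z hz)
  have hsqrt := (hE.sub hpot).sqrt fun z hz => (hz.2.2.2.2).ne'
  have c : ∀ j, ContDiffOn ℝ 1 (fun z : (Fin 4 → ℝ) × (Fin 4 → ℝ) => z.1 j)
    (entropicChartDomain n R Q π) := fun j => by fun_prop
  have d : ∀ j, ContDiffOn ℝ 1 (fun z : (Fin 4 → ℝ) × (Fin 4 → ℝ) => z.2 j)
    (entropicChartDomain n R Q π) := fun j => by fun_prop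
  rw [contDiffOn_pi]
  intro i
  fin_cases i
  · exact (contDiffOn_const.mul ((c 0).mul hψ)).sub (d 3)
  · exact c 0
  · exact contDiffOn_const.mul hsqrt
  · exact c 1
  · exact d 0
  · exact c 2
  · exact c 3
  · exact ((d 1).mul (c 1)).mul ((c 0).pow _)

theorem continuous_entropicFiberCoord : Continuous entropicFiberCoord := by
  refine continuous_pi fun i => ?_
  fin_cases i <;> exact continuous_apply _

/-- This rewrites the potential energy as a constant of the fibre times r^n. -/
theorem chartPotential_invariants (hn : 1 ≤ n) (hp : IsEquationOfState R Q p)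
    (he : IsEntropic R Q p) (hρ₁ : ρ₁ ∈ R) {x : Jet} (hx : x ∈ jetDomain R Q) :
    2 / (n : ℝ) * pS p ρ₁ x.S * entropyGradient n x * x.r ^ n =
      2 / (n : ℝ) * x.r * pressureForce p x := by
  have hr : x.r ≠ 0 := ne_of_gt hx.1
  have hρ : x.ρ ≠ 0 := (hp.density_pos _ hx.2.1).ne'
  rw [entropyGradient_eq hn, pressureForce_of_isEntropic hp he hρ₁ hx]
  obtain ⟨m, rfl⟩ : ∃ m, n = m + 1 := ⟨n - 1, by omega⟩
  rw [Nat.add_sub_cancel, pow_succ]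
  field_simp

theorem sign_mul_sqrt_sq {ε u : ℝ} (hε : ε = 1 ∨ ε = -1) (hu : 0 < ε * u) : ε * √(u ^ 2) = u := by
  rw [Real.sqrt_sq_eq_abs]
  rcases hε with rfl | rfl
  · rw [abs_of_pos (by linarith)]; ring
  · rw [abs_of_neg (by linarith)]; ring

theorem entropicChart_invariants (hn : 1 ≤ n) (hp : IsEquationOfState R Q p)
    (he : IsEntropic R Q p) (hρ₁ : ρ₁ ∈ R) (hε : ε = 1 ∨ ε = -1) {x : Jet}
    (hx : x ∈ travelDomain n R Q p ε) :
    (entropicFiberCoord x, entropicInvariants n p ε x) ∈ entropicChartDomain n R Q (pS p ρ₁) ∧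
      entropicChart n (pS p ρ₁) ε (entropicFiberCoord x, entropicInvariants n p ε x) = x := by
  have hr : x.r ≠ 0 := ne_of_gt hx.1.1
  have hρ : x.ρ ≠ 0 := (hp.density_pos _ hx.1.2.1).ne'
  have hpot := chartPotential_invariants hn hp he hρ₁ hx.1
  refine ⟨⟨hx.1.1, hx.1.2.1, hx.1.2.2, hx.2.2, ?_⟩, ?_⟩
  · change 0 < energyInvariant n p x - 2 / (n : ℝ) * pS p ρ₁ x.S * entropyGradient n x * x.r ^ n
    rw [hpot]
    exact velocity_sq_pos hx
  · ext i
    fin_cases i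
    · change ε * (x.r * travelProfile n (energyInvariant n p x,
        2 / (n : ℝ) * pS p ρ₁ x.S * entropyGradient n x * x.r ^ n)) -
        (ε * travelTime n x.r x.U (pressureForce p x) - x.t) = x.t
      rw [hpot, travelTime_jet]
      ring
    · rfl
    · change ε * √(energyInvariant n p x -
        2 / (n : ℝ) * pS p ρ₁ x.S * entropyGradient n x * x.r ^ n) = x.U
      rw [hpot, energyInvariant_sub, sign_mul_sqrt_sq hε hx.2.1]
    · rfl
    · rfl
    · rfl
    · rfl
    · change entropyGradient n x * x.ρ * x.r ^ (n - 1) = x.Sr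
      rw [entropyGradient_eq hn]
      field_simp

theorem pressureForce_entropicChart (hp : IsEquationOfState R Q p)
    (he : IsEntropic R Q p) (hρ₁ : ρ₁ ∈ R) (ε : ℝ) {z : (Fin 4 → ℝ) × (Fin 4 → ℝ)}
    (hz : z ∈ entropicChartDomain n R Q (pS p ρ₁)) :
    pressureForce p (entropicChart n (pS p ρ₁) ε z) =
      pS p ρ₁ (z.2 0) * z.2 1 * z.1 0 ^ (n - 1) := by
  have hmem : entropicChart n (pS p ρ₁) ε z ∈ jetDomain R Q := ⟨hz.1, hz.2.1, hz.2.2.1⟩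
  have hρ : z.1 1 ≠ 0 := (hp.density_pos _ hz.2.1).ne'
  rw [pressureForce_of_isEntropic hp he hρ₁ hmem]
  change pS p ρ₁ (z.2 0) * (z.2 1 * z.1 1 * z.1 0 ^ (n - 1)) / z.1 1 = _
  field_simp

theorem sign_mul_self {ε : ℝ} (hε : ε = 1 ∨ ε = -1) : ε * ε = 1 := by
  rcases hε with rfl | rfl <;> norm_num

theorem mapsTo_entropicChart (hn : 1 ≤ n) (hp : IsEquationOfState R Q p)
    (he : IsEntropic R Q p) (hρ₁ : ρ₁ ∈ R) (hε : ε = 1 ∨ ε = -1) :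
    MapsTo (entropicChart n (pS p ρ₁) ε) (entropicChartDomain n R Q (pS p ρ₁))
      (travelDomain n R Q p ε) := by
  intro z hz
  have hs : 0 < √(z.2 2 - 2 / (n : ℝ) * pS p ρ₁ (z.2 0) * z.2 1 * z.1 0 ^ n) :=
    Real.sqrt_pos.2 hz.2.2.2.2
  refine ⟨⟨hz.1, hz.2.1, hz.2.2.1⟩, ?_, ?_⟩
  · change 0 < ε * (ε * √(z.2 2 - 2 / (n : ℝ) * pS p ρ₁ (z.2 0) * z.2 1 * z.1 0 ^ n))
    rw [← mul_assoc, sign_mul_self hε, one_mul]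
    exact hs
  · rw [energyInvariant, pressureForce_entropicChart hp he hρ₁ ε hz]
    change 0 < (ε * √(z.2 2 - 2 / (n : ℝ) * pS p ρ₁ (z.2 0) * z.2 1 * z.1 0 ^ n)) ^ 2 +
      2 / (n : ℝ) * z.1 0 * (pS p ρ₁ (z.2 0) * z.2 1 * z.1 0 ^ (n - 1))
    have h1 : ε ^ 2 = 1 := by rw [sq, sign_mul_self hε]
    rw [mul_pow, h1, Real.sq_sqrt hz.2.2.2.2.le]
    obtain ⟨m, rfl⟩ : ∃ m, n = m + 1 := ⟨n - 1, by omega⟩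
    have := hz.2.2.2.1
    rw [Nat.add_sub_cancel]
    convert this using 1
    ring

/-- Moving r with the invariants fixed forces dt = dr/U and dU = -(p_r/ρ) dr/U as in the particle
motion, while S_r follows r at fixed ρ. This direction is the transport equation divided by U,
corrected by a multiple of ρ J_ρ + S_r J_{S_r} = 0; the latter equation also settles the
ρ-direction. -/
theorem entropicChart_fiber_derivative (hp : IsEquationOfState R Q p) (hn : 1 ≤ n)
    (he : IsEntropic R Q p) (hρ₁ : ρ₁ ∈ R) (hε : ε = 1 ∨ ε = -1)
    (hΩ : IsOpen Ω) (hsub : Ω ⊆ travelDomain n R Q p ε) (hJ : ContDiffOn ℝ 1 J Ω)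
    (h : ∀ x ∈ Ω, ∀ U₂ ρ₂ S₂ : ℝ, fderiv ℝ J x (jetVelocity n p x U₂ ρ₂ S₂) = 0) :
    ∀ z ∈ entropicChartDomain n R Q (pS p ρ₁), entropicChart n (pS p ρ₁) ε z ∈ Ω → ∀ v, ∃ w,
      HasDerivAt (fun s : ℝ => entropicChart n (pS p ρ₁) ε (z.1 + s • v, z.2)) w 0 ∧
      fderiv ℝ J (entropicChart n (pS p ρ₁) ε z) w = 0 := by
  intro z hz hzΩ v
  have hl : ∀ j, HasDerivAt (fun s : ℝ => (z.1 + s • v) j) (v j) 0 := fun j => by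
    simpa using ((hasDerivAt_id (0 : ℝ)).mul_const (v j)).const_add (z.1 j)
  set κ : ℝ := 2 / (n : ℝ) * pS p ρ₁ (z.2 0) * z.2 1 with hκ
  set E : ℝ := z.2 2 with hE
  have hEpos : 0 < E := hz.2.2.2.1
  have hpos : 0 < E - κ * z.1 0 ^ n := hz.2.2.2.2
  set q : ℝ := √(E - κ * z.1 0 ^ n) with hq
  have hqpos : 0 < q := Real.sqrt_pos.2 hpos
  have hl0 : (z.1 + (0 : ℝ) • v) 0 = z.1 0 := by simp
  refine ⟨![ε * (q⁻¹ * v 0), v 0, ε * (-(κ * (n * z.1 0 ^ (n - 1) * v 0)) / (2 * q)), v 1, 0, v 2,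
    v 3, z.2 1 * v 1 * z.1 0 ^ (n - 1) +
    z.2 1 * z.1 1 * (((n - 1 : ℕ) : ℝ) * z.1 0 ^ (n - 1 - 1) * v 0)], ?_, ?_⟩
  · refine hasDerivAt_pi.2 fun i => ?_
    fin_cases i
    · have h0 := hasDerivAt_mul_travelProfile (n := n) (κ := κ) hEpos hz.1 hpos
      rw [← hl0] at h0
      have h1 := ((h0.comp (0 : ℝ) (hl 0)).const_mul ε).sub_const (z.2 3)
      rw [hl0] at h1
      exact h1
    · exact hl 0
    · have h2 := ((((hl 0).fun_pow n).const_mul κ).const_sub E).sqrt (by rw [hl0]; exact hpos.ne')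
      rw [hl0] at h2
      exact h2.const_mul ε
    · exact hl 1
    · exact hasDerivAt_const _ _
    · exact hl 2
    · exact hl 3
    · have h7 := ((hl 1).const_mul (z.2 1)).fun_mul ((hl 0).fun_pow (n - 1))
      exact h7.congr_deriv (by simp)
  · obtain ⟨h5, h6, ha, hb⟩ := jetPartials_of_invariant hp hΩ (fun x hx => (hsub hx).1) hJ h
    have ha := ha _ hzΩ
    have hb := hb _ hzΩ
    rw [pressureForce_entropicChart hp he hρ₁ ε hz] at hb
    have hr : z.1 0 ≠ 0 := ne_of_gt hz.1
    have hρ : z.1 1 ≠ 0 := (hp.density_pos _ hz.2.1).ne'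
    rw [fderiv_jet_apply, h5 _ hzΩ, h6 _ hzΩ]
    set x := entropicChart n (pS p ρ₁) ε z with hx
    have e1 : x 1 = z.1 0 := rfl
    have e2 : x 2 = ε * q := rfl
    have e3 : x 3 = z.1 1 := rfl
    have e7 : x 7 = z.2 1 * z.1 1 * z.1 0 ^ (n - 1) := rfl
    simp only [Jet.ρ, Jet.Sr, Jet.U, Jet.r, e1, e2, e3, e7] at ha hb
    set J0 := jetPartial J 0 x
    set J1 := jetPartial J 1 x
    set J2 := jetPartial J 2 x
    set J3 := jetPartial J 3 x
    set J7 := jetPartial J 7 x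
    have hn0 : (n : ℝ) ≠ 0 := by positivity
    have hεε := sign_mul_self hε
    have hε0 : ε ≠ 0 := by
      rintro rfl
      simp at hεε
    have hF : pS p ρ₁ (z.2 0) * z.2 1 = κ * n / 2 := by
      rw [hκ]; field_simp
    rw [hF] at hb
    have ha' : J3 + z.2 1 * z.1 0 ^ (n - 1) * J7 = 0 := by
      have : z.1 1 * (J3 + z.2 1 * z.1 0 ^ (n - 1) * J7) = 0 := by linear_combination ha
      exact (mul_eq_zero.1 this).resolve_left hρ
    have hpow : ((n - 1 : ℕ) : ℝ) * z.1 0 ^ (n - 1 - 1) =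
        ((n : ℝ) - 1) * z.1 0 ^ (n - 1) / z.1 0 := by
      rw [eq_div_iff hr]
      obtain ⟨m, rfl⟩ : ∃ m, n = m + 1 := ⟨n - 1, by omega⟩
      rcases m with _ | m
      · simp
      · simp only [Nat.add_sub_cancel]
        push_cast
        ring
    have hb' : ε * q⁻¹ * J0 + J1 - ε * (κ * n * z.1 0 ^ (n - 1) / (2 * q)) * J2
        + z.2 1 * z.1 1 * (((n - 1 : ℕ) : ℝ) * z.1 0 ^ (n - 1 - 1)) * J7 = 0 := by
      rw [hpow]
      have h1 : ε * q * (ε * q⁻¹ * J0 + J1 - ε * (κ * n * z.1 0 ^ (n - 1) / (2 * q)) * J2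
          + z.2 1 * z.1 1 * (((n : ℝ) - 1) * z.1 0 ^ (n - 1) / z.1 0) * J7) =
          ε * ε * J0 + ε * q * J1 - ε * ε * (κ * n / 2 * z.1 0 ^ (n - 1)) * J2
          + ε * q * (z.2 1 * z.1 1 * (((n : ℝ) - 1) * z.1 0 ^ (n - 1) / z.1 0) * J7) := by
        field_simp
      rw [hεε] at h1
      have h2 : ε * q * (ε * q⁻¹ * J0 + J1 - ε * (κ * n * z.1 0 ^ (n - 1) / (2 * q)) * J2
          + z.2 1 * z.1 1 * (((n : ℝ) - 1) * z.1 0 ^ (n - 1) / z.1 0) * J7) = 0 := by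
        rw [h1]
        linear_combination hb + ((n : ℝ) - 1) * z.1 1 * (ε * q) / z.1 0 * ha'
      exact (mul_eq_zero.1 h2).resolve_left (mul_ne_zero hε0 hqpos.ne')
    simp only [Matrix.cons_val]
    linear_combination v 0 * hb' + v 1 * ha'

theorem isLocallyFunctionOf_entropicInvariants (hp : IsEquationOfState R Q p) (hn : 1 ≤ n)
    (he : IsEntropic R Q p) (hε : ε = 1 ∨ ε = -1) (hΩ : IsOpen Ω)
    (hsub : Ω ⊆ travelDomain n R Q p ε) (hJ : ContDiffOn ℝ 1 J Ω)
    (h : ∀ x ∈ Ω, ∀ U₂ ρ₂ S₂ : ℝ, fderiv ℝ J x (jetVelocity n p x U₂ ρ₂ S₂) = 0) :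
    IsLocallyFunctionOf (entropicInvariants n p ε) J Ω := by
  obtain ⟨ρ₁, hρ₁⟩ := hp.nonempty_density
  have hπ := contDiffOn_pS_slice hp hρ₁
  exact isLocallyFunctionOf_of_chart (contDiffOn_entropicInvariants hn hp ε).continuousOn
    continuous_entropicFiberCoord.continuousOn (isOpen_entropicChartDomain hp hπ n)
    (contDiffOn_entropicChart hπ n ε)
    (fun _ hx => entropicChart_invariants hn hp he hρ₁ hε hx) hΩ hsub hJ
    (entropicChart_fiber_derivative hp hn he hρ₁ hε hΩ hsub hJ h)

/-- A radius below the turning point of the motion with energy `E` in the potential `κ r ^ n`. -/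
noncomputable def innerRadius (E κ : ℝ) : ℝ := E / (1 + κ ^ 2 + E)

theorem innerRadius_pos {E κ : ℝ} (hE : 0 < E) : 0 < innerRadius E κ := by
  unfold innerRadius; positivity

/-- 2|κ| ≤ 1 + κ² gives |κ| r < E for r = `innerRadius E κ`, and r ≤ 1 gives r^n ≤ r. The formula is
rational with positive denominator, so the radius is smooth in E and κ whatever the sign of κ. -/
theorem sub_mul_innerRadius_pow_pos {n : ℕ} (hn : 1 ≤ n) {E κ : ℝ} (hE : 0 < E) :
    0 < E - κ * innerRadius E κ ^ n := by
  have hr := innerRadius_pos (κ := κ) hE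
  have hd : 0 < 1 + κ ^ 2 + E := by positivity
  have h1 : innerRadius E κ ≤ 1 := by
    unfold innerRadius
    rw [div_le_one hd]
    nlinarith [sq_nonneg κ]
  have h2 : innerRadius E κ ^ n ≤ innerRadius E κ := pow_le_of_le_one hr.le h1 (by omega)
  have h3 : |κ| * innerRadius E κ < E := by
    unfold innerRadius
    rw [mul_div_assoc', div_lt_iff₀ hd]
    nlinarith [sq_nonneg (|κ| - 1), sq_abs κ, abs_nonneg κ]
  have h4 : κ * innerRadius E κ ^ n ≤ |κ| * innerRadius E κ :=
    (mul_le_mul_of_nonneg_right (le_abs_self κ) (by positivity)).trans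
      (mul_le_mul_of_nonneg_left h2 (abs_nonneg κ))
  linarith

theorem isFunctionOf_entropicInvariants (hp : IsEquationOfState R Q p) (hn : 1 ≤ n)
    (he : IsEntropic R Q p) (hε : ε = 1 ∨ ε = -1)
    (hJ : ContDiffOn ℝ 1 J (travelDomain n R Q p ε))
    (h : ∀ x ∈ travelDomain n R Q p ε, ∀ U₂ ρ₂ S₂ : ℝ,
      fderiv ℝ J x (jetVelocity n p x U₂ ρ₂ S₂) = 0) :
    IsFunctionOf (entropicInvariants n p ε) J (travelDomain n R Q p ε) := by
  obtain ⟨ρ₁, hρ₁⟩ := hp.nonempty_density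
  have hπ := contDiffOn_pS_slice hp hρ₁
  have hmaps := mapsTo_entropicChart hn hp he hρ₁ hε
  have hopen := isOpen_travelDomain n hp ε
  refine isFunctionOf_of_chart (α := entropicFiberCoord) hopen
    (isOpen_entropicChartDomain hp hπ n) (contDiffOn_entropicChart hπ n ε)
    (fun _ hx => entropicChart_invariants hn hp he hρ₁ hε hx) hmaps hJ (fun x hx => ?_)
    -- A C¹ choice of one jet on each fibre; the radius must stay below the turning point, which
    -- depends on the invariants.
    (σ := fun k => ![innerRadius (k 2) (2 / (n : ℝ) * pS p ρ₁ (k 0) * k 1), ρ₁, 0, 0]) ?_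
    (fun x hx => ?_)
    (fun z hz => entropicChart_fiber_derivative hp hn he hρ₁ hε hopen Subset.rfl hJ h z hz
      (hmaps hz))
  · have hR : Convex ℝ R := hp.isPreconnected_density.ordConnected.convex
    have h0 : IsLinearMap ℝ fun a : Fin 4 → ℝ => a 0 := ⟨fun _ _ => rfl, fun _ _ => rfl⟩
    have h1 : IsLinearMap ℝ fun a : Fin 4 → ℝ => a 1 := ⟨fun _ _ => rfl, fun _ _ => rfl⟩
    set E := energyInvariant n p x with hE
    have hEpos : 0 < E := hx.2.2
    set κ := 2 / (n : ℝ) * pS p ρ₁ x.S * entropyGradient n x with hκ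
    have hset : {a | (a, entropicInvariants n p ε x) ∈ entropicChartDomain n R Q (pS p ρ₁)} =
        (fun a : Fin 4 → ℝ => a 0) ⁻¹' {r | 0 < r ∧ 0 < E - κ * r ^ n} ∩
          (fun a : Fin 4 → ℝ => a 1) ⁻¹' R := by
      ext a
      exact ⟨fun ha => ⟨⟨ha.1, ha.2.2.2.2⟩, ha.2.1⟩,
        fun ha => ⟨ha.1.1, ha.2, hx.1.2.2, hx.2.2, ha.1.2⟩⟩
    -- Decreasing the radius keeps E - κ r^n positive, so the admissible radii form an interval.
    have hord : OrdConnected {r : ℝ | 0 < r ∧ 0 < E - κ * r ^ n} := by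
      refine ⟨fun r₁ hr₁ r₂ hr₂ r hr => ⟨hr₁.1.trans_le hr.1, ?_⟩⟩
      have h := sub_mul_pow_pos (n := n) (y := r / r₂) hEpos hr₂.2
        ⟨div_nonneg (hr₁.1.le.trans hr.1) hr₂.1.le, (div_le_one hr₂.1).2 hr.2⟩
      rwa [mul_assoc, ← mul_pow, mul_div_cancel₀ _ hr₂.1.ne'] at h
    rw [hset]
    exact (hord.convex.is_linear_preimage h0).inter (hR.is_linear_preimage h1)
  · have hsub : entropicInvariants n p ε '' travelDomain n R Q p ε ⊆ {k | k 0 ∈ Q ∧ 0 < k 2} := by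
      rintro _ ⟨x, hx, rfl⟩
      exact ⟨hx.1.2.2, hx.2.2⟩
    refine ContDiffOn.mono ?_ hsub
    have d : ∀ j, ContDiffOn ℝ 1 (fun k : Fin 4 → ℝ => k j) {k | k 0 ∈ Q ∧ 0 < k 2} :=
      fun j => by fun_prop
    have hκ : ContDiffOn ℝ 1 (fun k : Fin 4 → ℝ => 2 / (n : ℝ) * pS p ρ₁ (k 0) * k 1)
        {k | k 0 ∈ Q ∧ 0 < k 2} :=
      (contDiffOn_const.mul (hπ.comp (d 0) fun k hk => hk.1)).mul (d 1)
    rw [contDiffOn_pi]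
    intro i
    fin_cases i
    · refine (d 2).div ((contDiffOn_const.add (hκ.pow 2)).add (d 2)) fun k hk => ?_
      have := hk.2
      positivity
    · exact contDiffOn_const
    · exact contDiffOn_const
    · exact contDiffOn_const
  · exact ⟨innerRadius_pos hx.2.2, hρ₁, hx.1.2.2, hx.2.2, sub_mul_innerRadius_pow_pos hn hx.2.2⟩

end Entropic

/-! ### Assembly of the classification -/

section Main

variable {n : ℕ} {R Q : Set ℝ} {p : ℝ → ℝ → ℝ} {Ω : Set Jet} {J : Jet → ℝ}

theorem isIntegralInvariant_of_isFunctionOf_generalInvariants (hn : 1 ≤ n)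
    (hp : IsEquationOfState R Q p) (hΩ : IsOpen Ω) (hsub : Ω ⊆ jetDomain R Q)
    (h : IsFunctionOf (generalInvariants n) J Ω) : IsIntegralInvariant n R Q p Ω J := by
  have hJ : ContDiffOn ℝ 1 J Ω := by
    obtain ⟨f, hf, hfJ⟩ := h
    exact (hf.comp ((contDiffOn_generalInvariants hn hp).mono hsub)
      (mapsTo_image _ _)).congr hfJ
  exact (isIntegralInvariant_iff hn hp hΩ hsub hJ).2
    (fderiv_eq_zero_of_generalInvariants hn hp hsub (h.isLocallyFunctionOf hΩ))

theorem isIntegralInvariant_iff_isLocallyFunctionOf_generalInvariants (hn : 1 ≤ n)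
    (hp : IsEquationOfState R Q p) (hne : ¬ IsEntropic R Q p) (hΩ : IsOpen Ω)
    (hsub : Ω ⊆ jetDomain R Q) (hJ : ContDiffOn ℝ 1 J Ω) :
    IsIntegralInvariant n R Q p Ω J ↔ IsLocallyFunctionOf (generalInvariants n) J Ω :=
  (isIntegralInvariant_iff hn hp hΩ hsub hJ).trans
    ⟨isLocallyFunctionOf_generalInvariants hp hn hne hΩ hsub hJ,
      fderiv_eq_zero_of_generalInvariants hn hp hsub⟩

theorem isIntegralInvariant_iff_isFunctionOf_generalInvariants (hn : 1 ≤ n)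
    (hp : IsEquationOfState R Q p) (hne : ¬ IsEntropic R Q p)
    (hJ : ContDiffOn ℝ 1 J (jetDomain R Q)) :
    IsIntegralInvariant n R Q p (jetDomain R Q) J ↔
      IsFunctionOf (generalInvariants n) J (jetDomain R Q) :=
  (isIntegralInvariant_iff hn hp hp.isOpen_jetDomain Subset.rfl hJ).trans
    ⟨isFunctionOf_generalInvariants hp hn hne hJ, fun h =>
      fderiv_eq_zero_of_generalInvariants hn hp Subset.rfl
        (h.isLocallyFunctionOf hp.isOpen_jetDomain)⟩

theorem isIntegralInvariant_iff_isLocallyFunctionOf_entropicInvariants (hn : 1 ≤ n)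
    (hp : IsEquationOfState R Q p) (he : IsEntropic R Q p) {ε : ℝ} (hε : ε = 1 ∨ ε = -1)
    (hΩ : IsOpen Ω) (hsub : Ω ⊆ travelDomain n R Q p ε) (hJ : ContDiffOn ℝ 1 J Ω) :
    IsIntegralInvariant n R Q p Ω J ↔ IsLocallyFunctionOf (entropicInvariants n p ε) J Ω :=
  (isIntegralInvariant_iff hn hp hΩ (fun _ hx => (hsub hx).1) hJ).trans
    ⟨isLocallyFunctionOf_entropicInvariants hp hn he hε hΩ hsub hJ,
      fderiv_eq_zero_of_entropicInvariants hn hp he hε hsub⟩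

theorem isIntegralInvariant_iff_isFunctionOf_entropicInvariants (hn : 1 ≤ n)
    (hp : IsEquationOfState R Q p) (he : IsEntropic R Q p) {ε : ℝ} (hε : ε = 1 ∨ ε = -1)
    (hJ : ContDiffOn ℝ 1 J (travelDomain n R Q p ε)) :
    IsIntegralInvariant n R Q p (travelDomain n R Q p ε) J ↔
      IsFunctionOf (entropicInvariants n p ε) J (travelDomain n R Q p ε) :=
  have hopen := isOpen_travelDomain n hp ε
  (isIntegralInvariant_iff hn hp hopen (fun _ hx => hx.1) hJ).trans
    ⟨isFunctionOf_entropicInvariants hp hn he hε hJ, fun h =>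
      fderiv_eq_zero_of_entropicInvariants hn hp he hε Subset.rfl (h.isLocallyFunctionOf hopen)⟩

theorem isIntegralInvariant_energyInvariant (hn : 1 ≤ n) (hp : IsEquationOfState R Q p)
    (he : IsEntropic R Q p) :
    IsIntegralInvariant n R Q p (travelDomain n R Q p 1) (energyInvariant n p) :=
  (isIntegralInvariant_iff_isFunctionOf_entropicInvariants hn hp he (Or.inl rfl)
    ((contDiffOn_energyInvariant n hp).mono fun _ hx => hx.1)).2
    ⟨fun k => k 2, (contDiff_apply ℝ ℝ (2 : Fin 4)).contDiffOn, fun _ _ => rfl⟩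

/-- Where all gradients vanish the energy is U², while the general invariants do not depend on U;
varying U near 1 separates them. -/
theorem not_isLocallyFunctionOf_energyInvariant (n : ℕ) (hp : IsEquationOfState R Q p) :
    ¬ IsLocallyFunctionOf (generalInvariants n) (energyInvariant n p)
      (travelDomain n R Q p 1) := by
  intro h
  obtain ⟨ρ₁, hρ₁⟩ := hp.nonempty_density
  obtain ⟨S₁, hS₁⟩ := hp.nonempty_entropy
  set γ : ℝ → Jet := fun u => ![0, 1, u, ρ₁, S₁, 0, 0, 0] with hγ
  have hE : ∀ u, energyInvariant n p (γ u) = u ^ 2 := by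
    intro u
    change u ^ 2 + 2 / (n : ℝ) * 1 * ((pS p ρ₁ S₁ * 0 + pRho p ρ₁ S₁ * 0) / ρ₁) = u ^ 2
    ring
  have hx : γ 1 ∈ travelDomain n R Q p 1 := by
    refine ⟨⟨one_pos, hρ₁, hS₁⟩, ?_, ?_⟩
    · change (0 : ℝ) < 1 * 1
      norm_num
    · rw [hE]
      norm_num
  obtain ⟨N, hN, hxN, -, f, -, hf⟩ := h _ hx
  have hγc : Continuous γ := by
    refine continuous_pi fun i => ?_
    fin_cases i
    · exact continuous_const
    · exact continuous_const
    · exact continuous_id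
    all_goals exact continuous_const
  have hev : ∀ᶠ u in 𝓝 (1 : ℝ), γ u ∈ N := hγc.continuousAt.preimage_mem_nhds (hN.mem_nhds hxN)
  obtain ⟨u, hu, hu1⟩ := ((hev.filter_mono nhdsWithin_le_nhds).and
    (self_mem_nhdsWithin : ∀ᶠ u in 𝓝[>] (1 : ℝ), u ∈ Ioi 1)).exists
  have h1 := hf _ hxN
  have h2 := hf _ hu
  have hI : generalInvariants n (γ u) = generalInvariants n (γ 1) := rfl
  rw [hI, ← h1, hE, hE] at h2
  have : (1 : ℝ) < u := hu1
  nlinarith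

end Main

end RadialEuler

theorem theorem2 (n : ℕ) (hn : 2 ≤ n) (R Q : Set ℝ) (p : ℝ → ℝ → ℝ)
    (hp : RadialEuler.IsEquationOfState R Q p) :
    -- For every equation of state, the densities `ρ f(S, r^{1-n} S_r / ρ)` give integral invariants.
    (∀ Ω : Set RadialEuler.Jet, IsOpen Ω → Ω ⊆ RadialEuler.jetDomain R Q →
      ∀ J : RadialEuler.Jet → ℝ,
        RadialEuler.IsFunctionOf (RadialEuler.generalInvariants n) J Ω →
          RadialEuler.IsIntegralInvariant n R Q p Ω J) ∧
    -- (i) If `p` is not entropic, these are all integral invariants up to first order: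
    -- near every point for `J` on an open set, with a single `f` for `J` on the whole jet domain.
    (¬ RadialEuler.IsEntropic R Q p →
      (∀ Ω : Set RadialEuler.Jet, IsOpen Ω → Ω ⊆ RadialEuler.jetDomain R Q →
        ∀ J : RadialEuler.Jet → ℝ, ContDiffOn ℝ 1 J Ω →
          (RadialEuler.IsIntegralInvariant n R Q p Ω J ↔
            RadialEuler.IsLocallyFunctionOf (RadialEuler.generalInvariants n) J Ω)) ∧
      (∀ J : RadialEuler.Jet → ℝ, ContDiffOn ℝ 1 J (RadialEuler.jetDomain R Q) →
          (RadialEuler.IsIntegralInvariant n R Q p (RadialEuler.jetDomain R Q) J ↔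
            RadialEuler.IsFunctionOf (RadialEuler.generalInvariants n) J
              (RadialEuler.jetDomain R Q)))) ∧
    -- (ii) Additional integral invariants exist exactly in the entropic case `p = κ(S)`,
    ((∃ (Ω : Set RadialEuler.Jet) (J : RadialEuler.Jet → ℝ),
        IsOpen Ω ∧ Ω ⊆ RadialEuler.jetDomain R Q ∧ ContDiffOn ℝ 1 J Ω ∧
          RadialEuler.IsIntegralInvariant n R Q p Ω J ∧
          ¬ RadialEuler.IsLocallyFunctionOf (RadialEuler.generalInvariants n) J Ω) ↔
      RadialEuler.IsEntropic R Q p) ∧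
    -- where all integral invariants up to first order are the following ones.
    (RadialEuler.IsEntropic R Q p → ∀ ε : ℝ, (ε = 1 ∨ ε = -1) →
      (∀ Ω : Set RadialEuler.Jet, IsOpen Ω → Ω ⊆ RadialEuler.travelDomain n R Q p ε →
        ∀ J : RadialEuler.Jet → ℝ, ContDiffOn ℝ 1 J Ω →
          (RadialEuler.IsIntegralInvariant n R Q p Ω J ↔
            RadialEuler.IsLocallyFunctionOf (RadialEuler.entropicInvariants n p ε) J Ω)) ∧
      (∀ J : RadialEuler.Jet → ℝ, ContDiffOn ℝ 1 J (RadialEuler.travelDomain n R Q p ε) →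
          (RadialEuler.IsIntegralInvariant n R Q p (RadialEuler.travelDomain n R Q p ε) J ↔
            RadialEuler.IsFunctionOf (RadialEuler.entropicInvariants n p ε) J
              (RadialEuler.travelDomain n R Q p ε)))) := by
  have hn1 : 1 ≤ n := by omega
  refine ⟨fun Ω hΩ hsub J h =>
      RadialEuler.isIntegralInvariant_of_isFunctionOf_generalInvariants hn1 hp hΩ hsub h,
    fun hne => ⟨fun Ω hΩ hsub J hJ =>
      RadialEuler.isIntegralInvariant_iff_isLocallyFunctionOf_generalInvariants hn1 hp hne hΩ
        hsub hJ,
      fun J hJ =>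
        RadialEuler.isIntegralInvariant_iff_isFunctionOf_generalInvariants hn1 hp hne hJ⟩,
    ⟨?_, fun he => ?_⟩,
    fun he ε hε => ⟨fun Ω hΩ hsub J hJ =>
      RadialEuler.isIntegralInvariant_iff_isLocallyFunctionOf_entropicInvariants hn1 hp he hε hΩ
        hsub hJ,
      fun J hJ =>
        RadialEuler.isIntegralInvariant_iff_isFunctionOf_entropicInvariants hn1 hp he hε hJ⟩⟩
  · rintro ⟨Ω, J, hΩ, hsub, hJ, hinv, hnot⟩
    by_contra hne
    exact hnot ((RadialEuler.isIntegralInvariant_iff_isLocallyFunctionOf_generalInvariants hn1 hp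
      hne hΩ hsub hJ).1 hinv)
  -- The witness is the energy on the outward domain: a function of the entropic invariants but not
  -- of the general ones.
  · exact ⟨RadialEuler.travelDomain n R Q p 1, RadialEuler.energyInvariant n p,
      RadialEuler.isOpen_travelDomain n hp 1, fun _ hx => hx.1,
      (RadialEuler.contDiffOn_energyInvariant n hp).mono fun _ hx => hx.1,
      RadialEuler.isIntegralInvariant_energyInvariant hn1 hp he,
      RadialEuler.not_isLocallyFunctionOf_energyInvariant n hp⟩
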